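/- **Proposition 2.1 (Propagation of Energy Estimates).** Let $P$ be a homogeneous polynomial of degree three with real constant coefficients in $(u,\partial_t\partial_xu,\partial_x^2u;\partial_tu,\partial_xu)$, affine in $(\partial_t\partial_xu,\partial_x^2u)$. For $\varepsilon\in\,]0,1[$ and real-valued $u_0,u_1$ on $\mathbb R$, consider the Cauchy problem $$\partial_t^2u-\partial_x^2u+u=P(u,\partial_t\partial_xu,\partial_x^2u;\partial_tu,\partial_xu),\qquad u(1,x)=\varepsilon u_0(x),\quad \partial_tu(1,x)=\varepsilon u_1(x).\tag{KG}$$ Given an integer $s\ge 1$, the data are assumed to satisfy $$\|u_0\|_{H^{s+1}}+\|u_1\|_{H^s}+\|xu_0\|_{H^2}+\|xu_1\|_{H^1}\le 1,$$ and a solution of (KG) on $[1,T]$ means a real function $u\in C^0([1,T];H^{s+1}(\mathbb R))\cap C^1([1,T];H^s(\mathbb R))$ satisfying (KG); for $s\ge2$ its continuous representative, denoted $u$ again, is of class $C^2$ on $[1,T]\times\mathbb R$. Put $Z=t\partial_x+x\partial_t$, $D=\frac1i\partial$, $\langle\xi\rangle=\sqrt{1+\xi^2}$, and $$E_0(t,v)=\big(\|\partial_tv(t,\cdot)\|_{L^2}^2+\|\partial_xv(t,\cdot)\|_{L^2}^2+\|v(t,\cdot)\|_{L^2}^2\big)^{1/2},\qquad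 E_N^\Gamma(t,u)=\sum_{k=0}^NE_0(t,\Gamma^ku)\quad(\Gamma\in\{\partial_x,Z\}),$$ $$\|u(t,\cdot)\|_{W^{t,\rho,\infty}}=\sum_{i=0}^2\big\|\langle D_x\rangle^{\rho-i}D_t^iu(t,\cdot)\big\|_{L^\infty(\mathbb R)},$$ each with value $+\infty$ when a function involved is not in the corresponding Lebesgue space. Then, for every sufficiently large integer $s$ (depending on $P$), for every integer $\rho\ge\left[\frac{s-1}2\right]+3$, for every sufficiently large $B>0$ (depending on $P,s,\rho$), and for every $A>0$ and every $\sigma>0$, there is $\varepsilon_0\in\,]0,1[$ such that the following holds for all $0<\varepsilon<\varepsilon_0$, all data $(u_0,u_1)$ as above and all $T>1$. If $u$ is a solution of (KG) on $[1,T]$ and satisfies $$\|u(t,\cdot)\|_{W^{t,\rho,\infty}}\le A\varepsilon t^{-1/2},\qquad E_{s-1}^{\partial_x}(t,u)\le B\varepsilon t^\sigma,\qquad E_1^Z(t,u)\le B\varepsilon t^\sigma\qquad\text{for every }t\in[1,T],$$ then it also satisfies $$E_{s-1}^{\partial_x}(t,u)\le\frac B2\varepsilon t^\sigma,\qquad E_1^Z(t,u)\le\frac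 B2\varepsilon t^\sigma\qquad\text{for every }t\in[1,T].$$ -/

import Mathlib

open scoped SchwartzMap ENNReal Topology

namespace KleinGordon

noncomputable section

/-! ### Bessel potential norms on the real line -/

/-- The symbol of `⟨D_x⟩ ^ m`, where `D_x = -i ∂_x` and `⟨η⟩ = (1 + η ^ 2) ^ (1 / 2)`. Mathlib's Fourier transform
uses the kernel `exp (-2 π i x ξ)`, so the frequency variable of `D_x` is `η = 2 π ξ`. -/
def bracketSymbol (m : ℝ) (ξ : ℝ) : ℝ := (1 + (2 * Real.pi * ξ) ^ 2) ^ (m / 2)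

/-- The symbol is smooth of temperate growth, so that the Fourier multiplier below is the genuine one. -/
theorem bracketSymbol_hasTemperateGrowth (m : ℝ) :
    (fun ξ : ℝ ↦ ((bracketSymbol m ξ : ℝ) : ℂ)).HasTemperateGrowth := by
  have h1 : (fun y : ℝ ↦ (1 + ‖y‖ ^ 2) ^ (m / 2)).HasTemperateGrowth :=
    Function.hasTemperateGrowth_one_add_norm_sq_rpow ℝ (m / 2)
  have h2 : (fun ξ : ℝ ↦ 2 * Real.pi * ξ).HasTemperateGrowth := by fun_prop
  have h3 : (fun ξ : ℝ ↦ bracketSymbol m ξ).HasTemperateGrowth := by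
    have h4 := h1.comp h2
    have h5 : ((fun y : ℝ ↦ (1 + ‖y‖ ^ 2) ^ (m / 2)) ∘ fun ξ : ℝ ↦ 2 * Real.pi * ξ)
        = fun ξ : ℝ ↦ bracketSymbol m ξ := by
      funext ξ
      simp only [Function.comp_apply, bracketSymbol, Real.norm_eq_abs, sq_abs]
    rwa [h5] at h4
  exact Function.Complex.hasTemperateGrowth_ofReal.comp h3

/-- The operator `⟨D_x⟩ ^ m` on tempered distributions. -/
def bracketD (m : ℝ) : 𝓢'(ℝ, ℂ) →L[ℂ] 𝓢'(ℝ, ℂ) :=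
  TemperedDistribution.fourierMultiplierCLM ℂ (fun ξ : ℝ ↦ ((bracketSymbol m ξ : ℝ) : ℂ))

/-- `f`, regarded as a tempered distribution, is `S`. -/
def IsDistributionOf (f : ℝ → ℝ) (S : 𝓢'(ℝ, ℂ)) : Prop :=
  ∀ φ : 𝓢(ℝ, ℂ), MeasureTheory.Integrable (fun x : ℝ ↦ φ x * (f x : ℂ)) ∧
    S φ = ∫ x : ℝ, φ x * (f x : ℂ)

/-- The norm `‖⟨D_x⟩ ^ m f‖_{L^p}`, with value `∞` when `⟨D_x⟩ ^ m f` is not an `L^p` function. The infimum is over at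
most one pair `(S, g)`, namely `S = f` and `g = ⟨D_x⟩ ^ m f`. -/
def besselNorm (m : ℝ) (p : ℝ≥0∞) [Fact (1 ≤ p)] (f : ℝ → ℝ) : ℝ≥0∞ :=
  ⨅ (S : 𝓢'(ℝ, ℂ)) (_ : IsDistributionOf f S)
    (g : MeasureTheory.Lp ℂ p (MeasureTheory.volume : MeasureTheory.Measure ℝ))
    (_ : bracketD m S = (g : 𝓢'(ℝ, ℂ))), ‖g‖ₑ

/-- The norm of the Sobolev space `H^k(ℝ)`; `f` belongs to that space if and only if `sobolevNorm k f < ∞`. -/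
def sobolevNorm (k : ℕ) (f : ℝ → ℝ) : ℝ≥0∞ := besselNorm k 2 f

/-- `v ∈ C^0(I; H^k)`. -/
def ContinuousInSobolev (I : Set ℝ) (k : ℕ) (v : ℝ → ℝ → ℝ) : Prop :=
  (∀ t ∈ I, sobolevNorm k (v t) < ∞) ∧
    ∀ t₀ ∈ I, Filter.Tendsto (fun t ↦ sobolevNorm k (fun x ↦ v t x - v t₀ x)) (𝓝[I] t₀) (𝓝 0)

/-- `v ∈ C^1(I; H^k)`: `v` is differentiable with respect to `t` for the norm of `H^k`, with derivative
`w ∈ C^0(I; H^k)`. -/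
def ContDiffOneInSobolev (I : Set ℝ) (k : ℕ) (v : ℝ → ℝ → ℝ) : Prop :=
  ContinuousInSobolev I k v ∧
    ∃ w : ℝ → ℝ → ℝ, ContinuousInSobolev I k w ∧
      ∀ t₀ ∈ I, Filter.Tendsto
        (fun t ↦ sobolevNorm k (fun x ↦ (v t x - v t₀ x) / (t - t₀) - w t₀ x)) (𝓝[I \ {t₀}] t₀) (𝓝 0)

/-! ### Derivatives, vector fields and norms on the strip `[1,T] × ℝ`

A function on the strip is written `u t x`. -/

/-- `∂_x`. -/
def dx (u : ℝ → ℝ → ℝ) : ℝ → ℝ → ℝ := fun t x ↦ deriv (fun y ↦ u t y) x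

/-- `∂_t` on the strip (one-sided at `t = 1` and `t = T`). -/
def dt (T : ℝ) (u : ℝ → ℝ → ℝ) : ℝ → ℝ → ℝ := fun t x ↦ derivWithin (fun τ ↦ u τ x) (Set.Icc 1 T) t

/-- The Klainerman vector field `Z = t ∂_x + x ∂_t`. -/
def Z (T : ℝ) (u : ℝ → ℝ → ℝ) : ℝ → ℝ → ℝ := fun t x ↦ t * dx u t x + x * dt T u t x

/-- `‖u(t,·)‖_{W^{t,ρ,∞}} = ∑_{i ≤ 2} ‖⟨D_x⟩ ^ (ρ - i) D_t ^ i u(t,·)‖_{L^∞}`. As `D_t = -i ∂_t`, the functions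
`D_t ^ i u` and `∂_t ^ i u` differ by a factor of modulus one. -/
def wNorm (T : ℝ) (ρ : ℕ) (u : ℝ → ℝ → ℝ) (t : ℝ) : ℝ≥0∞ :=
  ∑ i ∈ Finset.range 3, besselNorm ((ρ : ℝ) - (i : ℝ)) ∞ ((dt T)^[i] u t)

/-- `E_0(t,v) = (‖∂_t v(t,·)‖² + ‖∂_x v(t,·)‖² + ‖v(t,·)‖²) ^ (1/2)`, with norms in `L^2(ℝ)`. -/
def energy (T : ℝ) (v : ℝ → ℝ → ℝ) (t : ℝ) : ℝ≥0∞ :=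
  (MeasureTheory.eLpNorm (dt T v t) 2 ^ 2 + MeasureTheory.eLpNorm (dx v t) 2 ^ 2
    + MeasureTheory.eLpNorm (v t) 2 ^ 2) ^ (1 / 2 : ℝ)

/-- `E_N^Γ(t,u) = ∑_{k = 0}^N E_0(t, Γ^k u)`. -/
def energySum (T : ℝ) (Γ : (ℝ → ℝ → ℝ) → ℝ → ℝ → ℝ) (N : ℕ) (u : ℝ → ℝ → ℝ) (t : ℝ) : ℝ≥0∞ :=
  ∑ k ∈ Finset.range (N + 1), energy T (Γ^[k] u) t

/-! ### The Cauchy problem -/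

/-- The admissible nonlinearities: real homogeneous polynomials of degree three in the five variables
`(X₁, X₂, X₃, Y₁, Y₂)`, to be replaced by `(u, ∂_t ∂_x u, ∂_x² u, ∂_t u, ∂_x u)`, affine in `(X₂, X₃)`. -/
structure IsCubicQuasilinear (P : MvPolynomial (Fin 5) ℝ) : Prop where
  homogeneous : P.IsHomogeneous 3
  affine : ∀ d ∈ P.support, d 1 + d 2 ≤ 1

/-- `‖u₀‖_{H^{s+1}} + ‖u₁‖_{H^s} + ‖x u₀‖_{H^2} + ‖x u₁‖_{H^1} ≤ 1`. -/
def NormalizedData (s : ℕ) (u₀ u₁ : ℝ → ℝ) : Prop :=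
  sobolevNorm (s + 1) u₀ + sobolevNorm s u₁ + sobolevNorm 2 (fun x ↦ x * u₀ x)
    + sobolevNorm 1 (fun x ↦ x * u₁ x) ≤ 1

/-- `u` is a real solution on `[1,T]`, in the class `C^0([1,T]; H^{s+1}) ∩ C^1([1,T]; H^s)`, of
`∂_t² u - ∂_x² u + u = P(u, ∂_t ∂_x u, ∂_x² u; ∂_t u, ∂_x u)`, `u(1,·) = ε u₀`, `∂_t u(1,·) = ε u₁`.
For `s ≥ 2`, the equation shows that a solution in this class lies in `C^2([1,T]; H^{s-1})`, and its continuous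
representative is then of class `C^2` on `[1,T] × ℝ`. The field `classical` selects this representative, for which all
derivatives in the equation are classical. -/
structure IsSolution (P : MvPolynomial (Fin 5) ℝ) (s : ℕ) (ε : ℝ) (u₀ u₁ : ℝ → ℝ) (T : ℝ)
    (u : ℝ → ℝ → ℝ) : Prop where
  classical : ContDiffOn ℝ 2 (fun q : ℝ × ℝ ↦ u q.1 q.2) (Set.Icc 1 T ×ˢ Set.univ)
  continuous_sobolev : ContinuousInSobolev (Set.Icc 1 T) (s + 1) u
  contDiff_sobolev : ContDiffOneInSobolev (Set.Icc 1 T) s u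
  equation : ∀ t ∈ Set.Icc 1 T, ∀ x : ℝ,
    dt T (dt T u) t x - dx (dx u) t x + u t x =
      MvPolynomial.eval ![u t x, dt T (dx u) t x, dx (dx u) t x, dt T u t x, dx u t x] P
  initial_value : ∀ x : ℝ, u 1 x = ε * u₀ x
  initial_velocity : ∀ x : ℝ, dt T u 1 x = ε * u₁ x

end

end KleinGordon

open scoped SchwartzMap ENNReal Topology

namespace KleinGordon

noncomputable section

/-! This is the improvement step of a bootstrap, and it closes because the nonlinearity is cubic.
Let `v` be `∂_x ^ k u` with `k ≤ s - 1`, or `Z u`. It solves a linear equation `v_tt - v_xx + v = a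
v_tx + b v_xx + f`, where `a` and `b` are quadratic in `(u, ∂_t u, ∂_x u)` and `f` is a sum of cubic
terms with two factors in `L^∞` and one in `L^2`. By the assumed decay, two factors in `L^∞`
contribute `O(ε ^ 2 / t)`. Inserting the assumed growth as well, the energy grows at a rate of order
`δ / t * (B ε t ^ σ) ^ 2`, where `δ` is a fixed small number dominating `ε ^ 2` times a constant.
Integration in time gives a multiple of `δ / σ * (B ε t ^ σ) ^ 2`. No Gronwall argument is needed:
`δ / σ` is made small through `ε₀`, and a large `B` absorbs the initial energy, which is `O(ε ^ 2)`.

The energy density `v_t ^ 2 + (1 + b) v_x ^ 2 + v ^ 2` makes all second derivatives cancel. As only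
`L^2` bounds are known at spatial infinity, the energy is localized by the weight `1 - x ^ 2 / R ^
2`, at the cost of an error `O(1 / R)`, and `R → ∞` (`QuasilinearWave.local_energy_le`,
`QuasilinearWave.energy_le`).

Three points need care. For `k = s - 1` the derivative `∂_x ^ k ∂_t ^ 2 u` need not exist
classically. The energy estimate is therefore applied to difference quotients of derivatives of
order `k - 1`, uniformly in the step `h`; their Leibniz rule is `diffOp_mul_mul`, and Fatou's lemma
gives the limit (`L2Le.of_diffOp`). Among three orders of total at most `s - 1`, at most one exceeds
`[(s - 1) / 2]`, so sup bounds up to about that order suffice (`Tame.mul_mul`).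

The field `Z` commutes with the Klein-Gordon operator, and its commutators with `∂_t` and `∂_x`
produce only terms already controlled (`RegularSolution.linearized_zField_le`). The weights in the
data bound `Z u` and its first derivatives at `t = 1`.

Finally, the norms are defined by Fourier multipliers on distributions. They are turned into
classical regularity and pointwise bounds with a loss of one derivative
(`contDiff_of_sobolevNorm_lt_top`, `exists_abs_iteratedDeriv_le_besselNorm_top`), whence the
condition `[(s - 1) / 2] + 3 ≤ ρ`. -/

open MeasureTheory FourierTransform
open scoped ContDiff

/-! ### Test functions: integration by parts and the Fourier transform. -/

section

/-- A smooth compactly supported real function, as a complex Schwartz function. -/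
def testSchwartz (φ : ℝ → ℝ) (h1 : ContDiff ℝ ∞ φ) (h2 : HasCompactSupport φ) : 𝓢(ℝ, ℂ) :=
  HasCompactSupport.toSchwartzMap (f := fun x ↦ (φ x : ℂ)) (h2.comp_left (g := fun y : ℝ ↦ (y : ℂ)) (by simp))
    (Complex.ofRealCLM.contDiff.comp h1)

@[simp] theorem testSchwartz_apply (φ : ℝ → ℝ) (h1 : ContDiff ℝ ∞ φ) (h2 : HasCompactSupport φ) (x : ℝ) :
    testSchwartz φ h1 h2 x = (φ x : ℂ) := by
  rfl

theorem contDiff_infty_iteratedDeriv {φ : ℝ → ℝ} (h1 : ContDiff ℝ ∞ φ) (j : ℕ) :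
    ContDiff ℝ ∞ (iteratedDeriv j φ) := by
  induction j with
  | zero => simpa using h1
  | succ j ih => rw [iteratedDeriv_succ]; exact (contDiff_infty_iff_deriv.1 ih).2

theorem hasCompactSupport_iteratedDeriv {φ : ℝ → ℝ} (h2 : HasCompactSupport φ) (j : ℕ) :
    HasCompactSupport (iteratedDeriv j φ) := by
  induction j with
  | zero => simpa using h2
  | succ j ih => rw [iteratedDeriv_succ]; exact ih.deriv

/-- The kernel of the inverse transform is `exp (2 π i x ξ)`, so integration by parts brings out
minus the symbol of `∂_x`. The sign in `derivSymbol` comes from here. -/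
theorem fourierInv_derivCLM (Φ : 𝓢(ℝ, ℂ)) (ξ : ℝ) :
    𝓕⁻ (SchwartzMap.derivCLM ℂ ℂ Φ) ξ = -(2 * Real.pi * Complex.I * ξ) * 𝓕⁻ Φ ξ := by
  have h := SchwartzMap.fourierInv_lineDerivOp_eq Φ (1 : ℝ)
  have h3 : LineDeriv.lineDerivOp (1 : ℝ) Φ = SchwartzMap.derivCLM ℂ ℂ Φ := by
    ext x
    rw [SchwartzMap.lineDerivOp_apply_eq_fderiv]
    simp
  rw [h3] at h
  rw [h]
  have hg : (fun x : ℝ ↦ inner ℝ x (1 : ℝ)).HasTemperateGrowth := by fun_prop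
  rw [smul_apply, SchwartzMap.smulLeftCLM_apply_apply hg]
  simp
  ring

theorem fourierInv_testSchwartz_iteratedDeriv {φ : ℝ → ℝ} (h1 : ContDiff ℝ ∞ φ) (h2 : HasCompactSupport φ)
    (j : ℕ) (ξ : ℝ) :
    𝓕⁻ (testSchwartz (iteratedDeriv j φ) (contDiff_infty_iteratedDeriv h1 j)
      (hasCompactSupport_iteratedDeriv h2 j)) ξ
      = (-(2 * Real.pi * Complex.I * ξ)) ^ j * 𝓕⁻ (testSchwartz φ h1 h2) ξ := by
  induction j with
  | zero => simp
  | succ j ih =>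
    have : testSchwartz (iteratedDeriv (j + 1) φ) (contDiff_infty_iteratedDeriv h1 _)
        (hasCompactSupport_iteratedDeriv h2 _) = SchwartzMap.derivCLM ℂ ℂ
        (testSchwartz (iteratedDeriv j φ) (contDiff_infty_iteratedDeriv h1 j)
          (hasCompactSupport_iteratedDeriv h2 j)) := by
      ext x
      simp only [testSchwartz_apply, SchwartzMap.derivCLM_apply]
      have hd : HasDerivAt (iteratedDeriv j φ) (iteratedDeriv (j + 1) φ x) x := by
        rw [iteratedDeriv_succ]
        exact (((contDiff_infty_iteratedDeriv h1 j).differentiable (by simp)) x).hasDerivAt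
      have := hd.ofReal_comp
      rw [← this.deriv]
      congr 1
    rw [this, fourierInv_derivCLM, ih]
    ring

/-- Repeated integration by parts against a test function. -/
theorem integral_iteratedDeriv_mul {φ : ℝ → ℝ} (h1 : ContDiff ℝ ∞ φ) (h2 : HasCompactSupport φ)
    (j : ℕ) {f : ℝ → ℝ} (hf : ContDiff ℝ j f) :
    ∫ x, iteratedDeriv j φ x * f x = (-1) ^ j * ∫ x, φ x * iteratedDeriv j f x := by
  induction j generalizing φ with
  | zero => simp
  | succ j ih =>
    rw [iteratedDeriv_succ', ih (contDiff_infty_iff_deriv.1 h1).2 h2.deriv (hf.of_le (by simp))]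
    have hfj : ContDiff ℝ 1 (iteratedDeriv j f) := by
      rw [iteratedDeriv_eq_iterate]
      exact ContDiff.iterate_deriv' 1 j (by rw [add_comm]; exact hf)
    have key := integral_mul_deriv_eq_deriv_mul_of_integrable (u := φ) (v := iteratedDeriv j f)
      (u' := deriv φ) (v' := iteratedDeriv (j + 1) f)
      (fun x _ ↦ ((h1.differentiable (by simp)) x).hasDerivAt)
      (fun x _ ↦ by
        rw [iteratedDeriv_succ]
        exact ((hfj.differentiable (by simp)) x).hasDerivAt)
      (((h1.continuous).mul (hf.continuous_iteratedDeriv' (j+1))).integrable_of_hasCompactSupport h2.mul_right)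
      ((((contDiff_infty_iff_deriv.1 h1).2.continuous).mul hfj.continuous).integrable_of_hasCompactSupport
        h2.deriv.mul_right)
      ((h1.continuous.mul hfj.continuous).integrable_of_hasCompactSupport h2.mul_right)
    rw [key]
    ring

end

/-! ### Fourier multipliers and `L^2` bounds of derivatives. -/

section

/-- The symbol of `(-∂_x) ^ j ⟨D_x⟩ ^ (-m)`. -/
def derivSymbol (m : ℝ) (j : ℕ) (ξ : ℝ) : ℂ := (-(2 * Real.pi * Complex.I * ξ)) ^ j * (bracketSymbol (-m) ξ : ℂ)

theorem derivSymbol_hasTemperateGrowth (m : ℝ) (j : ℕ) : (derivSymbol m j).HasTemperateGrowth := by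
  unfold derivSymbol
  have h1 := bracketSymbol_hasTemperateGrowth (-m)
  have h2 : (fun ξ : ℝ ↦ (ξ : ℂ)).HasTemperateGrowth := Function.Complex.hasTemperateGrowth_ofReal
  fun_prop

theorem bracketSymbol_pos (m ξ : ℝ) : 0 < bracketSymbol m ξ := by
  unfold bracketSymbol; positivity

theorem bracketSymbol_mul (m n ξ : ℝ) : bracketSymbol m ξ * bracketSymbol n ξ = bracketSymbol (m + n) ξ := by
  unfold bracketSymbol
  rw [← Real.rpow_add (by positivity)]
  ring_nf

theorem bracketSymbol_zero (ξ : ℝ) : bracketSymbol 0 ξ = 1 := by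
  simp [bracketSymbol]

theorem bracketD_neg_bracketD (m : ℝ) (S : 𝓢'(ℝ, ℂ)) : bracketD (-m) (bracketD m S) = S := by
  unfold bracketD
  rw [TemperedDistribution.fourierMultiplierCLM_fourierMultiplierCLM_apply
    (bracketSymbol_hasTemperateGrowth m) (bracketSymbol_hasTemperateGrowth (-m))]
  have : ((fun ξ : ℝ ↦ ((bracketSymbol m ξ : ℝ) : ℂ)) * fun ξ : ℝ ↦ ((bracketSymbol (-m) ξ : ℝ) : ℂ))
      = fun _ ↦ 1 := by
    ext ξ
    simp only [Pi.mul_apply]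
    rw [← Complex.ofReal_mul, bracketSymbol_mul, add_neg_cancel, bracketSymbol_zero, Complex.ofReal_one]
  rw [this]
  simp

theorem eq_bracketD_neg {m : ℝ} {S T : 𝓢'(ℝ, ℂ)} (h : bracketD m S = T) : S = bracketD (-m) T := by
  rw [← h, bracketD_neg_bracketD]

theorem norm_two_pi_mul_pow_le (j : ℕ) (ξ : ℝ) :
    |2 * Real.pi * ξ| ^ j ≤ bracketSymbol j ξ := by
  unfold bracketSymbol
  rw [Real.rpow_div_two_eq_sqrt _ (by positivity), Real.rpow_natCast]
  gcongr
  rw [← Real.sqrt_sq_eq_abs]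
  apply Real.sqrt_le_sqrt
  linarith

theorem bracketSymbol_mono {m n : ℝ} (h : m ≤ n) (ξ : ℝ) : bracketSymbol m ξ ≤ bracketSymbol n ξ := by
  unfold bracketSymbol
  apply Real.rpow_le_rpow_of_exponent_le
  · nlinarith [sq_nonneg (2 * Real.pi * ξ)]
  · linarith

theorem norm_derivSymbol_le (m : ℝ) (j : ℕ) (ξ : ℝ) : ‖derivSymbol m j ξ‖ ≤ bracketSymbol (j - m) ξ := by
  have h1 : ‖(-(2 * Real.pi * Complex.I * ξ : ℂ)) ^ j‖ = |2 * Real.pi * ξ| ^ j := by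
    rw [norm_pow, norm_neg]
    congr 1
    simp [abs_mul]
  unfold derivSymbol
  rw [norm_mul, h1, Complex.norm_real, Real.norm_of_nonneg (bracketSymbol_pos _ _).le, sub_eq_add_neg,
    ← bracketSymbol_mul]
  gcongr
  · exact (bracketSymbol_pos _ _).le
  · exact norm_two_pi_mul_pow_le j ξ

theorem norm_derivSymbol_le_one {m : ℝ} {j : ℕ} (h : j ≤ m) (ξ : ℝ) : ‖derivSymbol m j ξ‖ ≤ 1 := by
  refine (norm_derivSymbol_le m j ξ).trans ?_
  rw [← bracketSymbol_zero ξ]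
  exact bracketSymbol_mono (by linarith) ξ

/-- Pairing of a test function with a derivative, through the distribution `⟨D_x⟩ ^ m f`. -/
theorem integral_test_iteratedDeriv {φ : ℝ → ℝ} (h1 : ContDiff ℝ ∞ φ) (h2 : HasCompactSupport φ) {m : ℝ}
    {j : ℕ} {f : ℝ → ℝ} (hf : ContDiff ℝ j f) {S T : 𝓢'(ℝ, ℂ)} (hS : IsDistributionOf f S)
    (hT : bracketD m S = T) :
    (((-1) ^ j * ∫ x, φ x * iteratedDeriv j f x : ℝ) : ℂ)
      = T (𝓕 (SchwartzMap.smulLeftCLM ℂ (derivSymbol m j) (𝓕⁻ (testSchwartz φ h1 h2)))) := by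
  -- The derivatives and the operator `⟨D_x⟩ ^ (-m)` are both moved onto the test function, so that
  -- estimates on `f ^ (j)` become estimates on one Schwartz function.
  rw [← integral_iteratedDeriv_mul h1 h2 j hf, ← integral_complex_ofReal]
  have h3 := (hS (testSchwartz (iteratedDeriv j φ) (contDiff_infty_iteratedDeriv h1 j)
      (hasCompactSupport_iteratedDeriv h2 j))).2
  simp only [testSchwartz_apply] at h3
  push_cast
  rw [← h3, eq_bracketD_neg hT, bracketD, TemperedDistribution.fourierMultiplierCLM_apply_apply]
  congr 2
  ext ξ
  rw [SchwartzMap.smulLeftCLM_apply_apply (bracketSymbol_hasTemperateGrowth (-m)),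
    SchwartzMap.smulLeftCLM_apply_apply (derivSymbol_hasTemperateGrowth m j),
    fourierInv_testSchwartz_iteratedDeriv h1 h2]
  simp only [derivSymbol, smul_eq_mul]
  ring

/-- By Plancherel: on the Fourier side the operator is multiplication by a function of modulus at
most one. -/
theorem exists_Lp_fourierMultiplier {σ : ℝ → ℂ} (hσ : σ.HasTemperateGrowth) (hb : ∀ ξ, ‖σ ξ‖ ≤ 1)
    (g : Lp ℂ 2 (volume : Measure ℝ)) :
    ∃ h : Lp ℂ 2 (volume : Measure ℝ), ‖h‖ ≤ ‖g‖ ∧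
      TemperedDistribution.fourierMultiplierCLM ℂ σ (g : 𝓢'(ℝ, ℂ)) = (h : 𝓢'(ℝ, ℂ)) := by
  set σ' : BoundedContinuousFunction ℝ ℂ := BoundedContinuousFunction.ofNormedAddCommGroup σ hσ.1.continuous 1 hb
  set L : Lp ℂ ∞ (volume : Measure ℝ) := σ'.memLp_top.toLp _ (μ := volume)
  have hL : ‖L‖ ≤ 1 := by
    rw [Lp.norm_toLp, eLpNorm_exponent_top]
    have : eLpNormEssSup σ' (volume : Measure ℝ) ≤ ENNReal.ofReal 1 :=
      eLpNormEssSup_le_of_ae_bound (Filter.Eventually.of_forall hb)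
    exact ENNReal.toReal_le_of_le_ofReal zero_le_one this
  refine ⟨𝓕⁻ (L • (𝓕 g : Lp ℂ 2 (volume : Measure ℝ)) : Lp ℂ 2 (volume : Measure ℝ)), ?_, ?_⟩
  · have h1 : ‖𝓕⁻ (L • (𝓕 g : Lp ℂ 2 (volume : Measure ℝ)) : Lp ℂ 2 (volume : Measure ℝ))‖
        = ‖(L • (𝓕 g : Lp ℂ 2 (volume : Measure ℝ)) : Lp ℂ 2 (volume : Measure ℝ))‖ := by
      rw [← Lp.norm_fourier_eq, FourierTransform.fourier_fourierInv_eq]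
    rw [h1]
    refine (Lp.norm_smul_le _ _).trans ?_
    rw [Lp.norm_fourier_eq]
    exact mul_le_of_le_one_left (norm_nonneg _) hL
  · have h2 := Lp.toTemperedDistribution_smul_eq (r := 2) (g := σ) hσ σ'.memLp_top
      (𝓕 g : Lp ℂ 2 (volume : Measure ℝ))
    rw [TemperedDistribution.fourierMultiplierCLM_apply, ← Lp.fourierInv_toTemperedDistribution_eq,
      Lp.fourier_toTemperedDistribution_eq, ← h2]
    rfl

/-- `‖f ^ (j)‖_{L^2} ≤ ‖f‖_{H^m}` for `j ≤ m`. -/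
theorem eLpNorm_iteratedDeriv_le_sobolevNorm {m j : ℕ} (hj : j ≤ m) {f : ℝ → ℝ} (hf : ContDiff ℝ j f) :
    eLpNorm (iteratedDeriv j f) 2 ≤ sobolevNorm m f := by
  unfold sobolevNorm besselNorm
  refine le_iInf fun S ↦ le_iInf fun hS ↦ le_iInf fun g ↦ le_iInf fun hg ↦ ?_
  obtain ⟨h, hh, hgh⟩ := exists_Lp_fourierMultiplier (derivSymbol_hasTemperateGrowth m j)
    (norm_derivSymbol_le_one (by exact_mod_cast hj)) g
  have hcont : Continuous (iteratedDeriv j f) := hf.continuous_iteratedDeriv'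
  have key : ∀ᵐ x, ((-1) ^ j * iteratedDeriv j f x : ℂ) = h x := by
    apply ae_eq_of_integral_contDiff_smul_eq
    · exact (Continuous.locallyIntegrable (by fun_prop))
    · exact (Lp.memLp h).locallyIntegrable (by norm_num)
    · intro φ h1 h2
      have h3 := integral_test_iteratedDeriv h1 h2 hf hS hg
      rw [← TemperedDistribution.fourierMultiplierCLM_apply_apply, hgh, Lp.toTemperedDistribution_apply] at h3
      simp only [testSchwartz_apply, smul_eq_mul] at h3
      simp only [Complex.real_smul]
      rw [← h3, ← integral_const_mul, ← integral_complex_ofReal]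
      congr 1
      ext x
      push_cast
      ring
  have h5 : eLpNorm (iteratedDeriv j f) 2 = eLpNorm h 2 := by
    apply eLpNorm_congr_norm_ae
    filter_upwards [key] with x hx
    rw [← hx]
    simp
  rw [h5, ← Lp.enorm_def]
  rw [← ofReal_norm, ← ofReal_norm]
  exact ENNReal.ofReal_le_ofReal hh

end

/-! ### Bounds in the sup norm. -/

section

/-- Bumps of integral one that concentrate at `x₀` recover the value of a continuous function there.
Test functions supported within distance one of `x₀` are enough, so the weight `(x - x₀) ^ 2` used
below costs nothing. -/
theorem abs_le_of_integral_test_le {h : ℝ → ℝ} (hc : Continuous h) (x₀ C : ℝ)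
    (H : ∀ φ : ℝ → ℝ, ContDiff ℝ ∞ φ → HasCompactSupport φ → (∀ x, φ x ≠ 0 → |x - x₀| ≤ 1) →
      |∫ x, φ x * h x| ≤ C * ∫ x, |φ x|) : |h x₀| ≤ C := by
  refine le_of_forall_pos_le_add fun δ hδ ↦ ?_
  obtain ⟨r, hr, hrh⟩ := Metric.continuousAt_iff.1 hc.continuousAt δ hδ
  set ρ := min r 1
  have hρ : 0 < ρ := lt_min hr one_pos
  let b : ContDiffBump x₀ := ⟨ρ / 2, ρ, by positivity, by linarith⟩
  set φ := b.normed volume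
  have hφs : ContDiff ℝ ∞ φ := b.contDiff_normed
  have hφc : HasCompactSupport φ := b.hasCompactSupport_normed
  have hφn : ∀ x, 0 ≤ φ x := b.nonneg_normed
  have hφi : ∫ x, φ x = 1 := b.integral_normed
  have hsupp : ∀ x, φ x ≠ 0 → |x - x₀| < ρ := by
    intro x hx
    have : x ∈ Function.support φ := hx
    rw [b.support_normed_eq] at this
    simpa [Real.dist_eq] using this
  have h1 := H φ hφs hφc (fun x hx ↦ (hsupp x hx).le.trans (min_le_right _ _))
  have hφint : Integrable φ := hφs.continuous.integrable_of_hasCompactSupport hφc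
  have h2 : ∫ x, |φ x| = 1 := by
    rw [← hφi]; congr 1; ext x; exact abs_of_nonneg (hφn x)
  rw [h2, mul_one] at h1
  have hint : Integrable (fun x ↦ φ x * h x) :=
    (hφs.continuous.mul hc).integrable_of_hasCompactSupport hφc.mul_right
  have h3 : h x₀ = (∫ x, φ x * h x) - ∫ x, φ x * (h x - h x₀) := by
    rw [← integral_sub hint]
    · have : ∀ x, φ x * h x - φ x * (h x - h x₀) = φ x * h x₀ := fun x ↦ by ring
      simp_rw [this]
      rw [integral_mul_const, hφi, one_mul]
    · exact (hφs.continuous.mul (hc.sub continuous_const)).integrable_of_hasCompactSupport hφc.mul_right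
  have h4 : |∫ x, φ x * (h x - h x₀)| ≤ δ := by
    rw [← Real.norm_eq_abs]
    calc ‖∫ x, φ x * (h x - h x₀)‖ ≤ ∫ x, φ x * δ := by
          apply norm_integral_le_of_norm_le (hφint.mul_const δ)
          refine Filter.Eventually.of_forall fun x ↦ ?_
          rw [norm_mul, Real.norm_of_nonneg (hφn x)]
          by_cases hx : φ x = 0
          · simp [hx]
          · apply mul_le_mul_of_nonneg_left _ (hφn x)
            have := hrh (x := x) (by rw [Real.dist_eq]; exact (hsupp x hx).trans_le (min_le_left _ _))
            rw [Real.dist_eq] at this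
            exact this.le
      _ = δ := by rw [integral_mul_const, hφi, one_mul]
  rw [h3]
  exact (abs_sub _ _).trans (add_le_add h1 h4)

theorem hasDerivAt_bracketSymbol (m ξ : ℝ) :
    HasDerivAt (bracketSymbol m) (2 * Real.pi * m * (2 * Real.pi * ξ) * bracketSymbol (m - 2) ξ) ξ := by
  have h1 : HasDerivAt (fun ξ : ℝ ↦ 1 + (2 * Real.pi * ξ) ^ 2) (2 * (2 * Real.pi * ξ) * (2 * Real.pi)) ξ := by
    have := (((hasDerivAt_id ξ).const_mul (2 * Real.pi)).pow 2).const_add 1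
    simpa using this
  have h2 := h1.rpow_const (p := m / 2) (Or.inl (by positivity))
  convert! h2 using 1
  unfold bracketSymbol
  rw [show (m - 2) / 2 = m / 2 - 1 by ring]
  ring

theorem integrable_bracketSymbol_neg_two : Integrable (bracketSymbol (-2)) := by
  have h1 : Integrable (fun x : ℝ ↦ (1 + x ^ 2)⁻¹) := integrable_inv_one_add_sq
  have h2 := h1.comp_mul_left' (R := 2 * Real.pi) (by positivity)
  refine h2.congr (Filter.Eventually.of_forall fun ξ ↦ ?_)
  simp only [bracketSymbol]
  rw [show (-2 / 2 : ℝ) = -1 by norm_num, Real.rpow_neg_one]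

/-- Decay of order `-1` makes the symbol and its derivative square integrable; the derivative
corresponds to a spatial weight on the kernel. The two terms of the product rule contribute `2 π j`
and `2 π m` to the constant, and the added one covers the symbol itself. -/
theorem exists_hasDerivAt_derivSymbol {m : ℝ} {j : ℕ} (hj : j + 1 ≤ m) :
    ∃ M : ℝ, 0 ≤ M ∧ (∀ ξ, ‖derivSymbol m j ξ‖ ≤ M * bracketSymbol (-1) ξ) ∧
      ∃ d : ℝ → ℂ, (∀ ξ, HasDerivAt (derivSymbol m j) (d ξ) ξ) ∧ ∀ ξ, ‖d ξ‖ ≤ M * bracketSymbol (-1) ξ := by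
  have hm0 : 0 ≤ m := by have : (0 : ℝ) ≤ j := j.cast_nonneg; linarith
  refine ⟨2 * Real.pi * (j + m) + 1, by positivity, fun ξ ↦ ?_,
    fun ξ ↦ (j * (-(2 * Real.pi * Complex.I * ξ)) ^ (j - 1) * -(2 * Real.pi * Complex.I)) * (bracketSymbol (-m) ξ : ℂ)
      + (-(2 * Real.pi * Complex.I * ξ)) ^ j *
        ((2 * Real.pi * (-m) * (2 * Real.pi * ξ) * bracketSymbol (-m - 2) ξ : ℝ) : ℂ), fun ξ ↦ ?_, fun ξ ↦ ?_⟩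
  · have hp := bracketSymbol_pos (-1) ξ
    have : 0 ≤ 2 * Real.pi * (j + m) := by positivity
    have h2 := (norm_derivSymbol_le m j ξ).trans (bracketSymbol_mono (show j - m ≤ -1 by linarith) ξ)
    nlinarith
  · have h1 := (hasDerivAt_bracketSymbol (-m) ξ).ofReal_comp
    have h2 : HasDerivAt (fun ξ : ℝ ↦ -(2 * Real.pi * Complex.I * (ξ : ℂ))) (-(2 * Real.pi * Complex.I)) ξ := by
      have := ((hasDerivAt_id ξ).ofReal_comp.const_mul (2 * Real.pi * Complex.I)).neg
      convert! this using 1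
      simp
    exact (h2.pow j).mul h1
  · have hy : ‖(-(2 * Real.pi * Complex.I * ξ) : ℂ)‖ = |2 * Real.pi * ξ| := by
      rw [norm_neg]; simp [abs_mul]
    have hb1 : ‖((j : ℂ) * (-(2 * Real.pi * Complex.I * ξ)) ^ (j - 1) * -(2 * Real.pi * Complex.I)) *
        (bracketSymbol (-m) ξ : ℂ)‖ ≤ 2 * Real.pi * j * bracketSymbol (-1) ξ := by
      rcases Nat.eq_zero_or_pos j with h0 | h0
      · subst h0; simp
      rw [norm_mul, norm_mul, norm_mul, norm_pow, hy, Complex.norm_real,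
        Real.norm_of_nonneg (bracketSymbol_pos _ _).le]
      have h3 : ‖(-(2 * Real.pi * Complex.I) : ℂ)‖ = 2 * Real.pi := by
        rw [norm_neg]; simp [Real.pi_pos.le]
      rw [h3]
      simp only [Complex.norm_natCast]
      have h4 := norm_two_pi_mul_pow_le (j - 1) ξ
      calc (j : ℝ) * |2 * Real.pi * ξ| ^ (j - 1) * (2 * Real.pi) * bracketSymbol (-m) ξ
          = 2 * Real.pi * j * (|2 * Real.pi * ξ| ^ (j - 1) * bracketSymbol (-m) ξ) := by ring
        _ ≤ 2 * Real.pi * j * (bracketSymbol ((j - 1 : ℕ) : ℝ) ξ * bracketSymbol (-m) ξ) := by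
          have := (bracketSymbol_pos (-m) ξ).le
          gcongr
        _ ≤ _ := by
          rw [bracketSymbol_mul]
          gcongr
          apply bracketSymbol_mono
          rw [Nat.cast_sub h0]
          push_cast
          linarith
    have hb2 : ‖(-(2 * Real.pi * Complex.I * ξ)) ^ j *
        ((2 * Real.pi * (-m) * (2 * Real.pi * ξ) * bracketSymbol (-m - 2) ξ : ℝ) : ℂ)‖
        ≤ 2 * Real.pi * m * bracketSymbol (-1) ξ := by
      rw [norm_mul, norm_pow, hy, Complex.norm_real, norm_mul, norm_mul,
        Real.norm_of_nonneg (bracketSymbol_pos _ _).le, norm_mul, norm_neg,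
        Real.norm_of_nonneg hm0, Real.norm_eq_abs (2 * Real.pi * ξ), Real.norm_of_nonneg (by positivity : 0 ≤ 2 * Real.pi)]
      have h4 := norm_two_pi_mul_pow_le (j + 1) ξ
      calc |2 * Real.pi * ξ| ^ j * (2 * Real.pi * m * |2 * Real.pi * ξ| * bracketSymbol (-m - 2) ξ)
          = 2 * Real.pi * m * (|2 * Real.pi * ξ| ^ (j + 1) * bracketSymbol (-m - 2) ξ) := by ring
        _ ≤ 2 * Real.pi * m * (bracketSymbol ((j + 1 : ℕ) : ℝ) ξ * bracketSymbol (-m - 2) ξ) := by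
          have := (bracketSymbol_pos (-m - 2) ξ).le
          gcongr
        _ ≤ _ := by
          rw [bracketSymbol_mul]
          gcongr
          apply bracketSymbol_mono
          push_cast
          linarith
    have hp := (bracketSymbol_pos (-1) ξ).le
    refine (norm_add_le _ _).trans ((add_le_add hb1 hb2).trans ?_)
    nlinarith

theorem bracketSymbol_neg_one_sq (ξ : ℝ) : bracketSymbol (-1) ξ ^ 2 = bracketSymbol (-2) ξ := by
  rw [sq, bracketSymbol_mul]; norm_num

section Localized

variable {φ : ℝ → ℝ} (h1 : ContDiff ℝ ∞ φ) (h2 : HasCompactSupport φ)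

theorem norm_fourierInv_le_integral (Φ : 𝓢(ℝ, ℂ)) (ξ : ℝ) : ‖𝓕⁻ Φ ξ‖ ≤ ∫ x, ‖Φ x‖ := by
  rw [SchwartzMap.fourierInv_coe, Real.fourierInv_eq]
  refine (norm_integral_le_integral_norm _).trans (le_of_eq ?_)
  simp

/-- By Plancherel it suffices to argue on the Fourier side, where `𝓕⁻ φ` is at most `∫ |φ|` and the
symbol is square integrable. -/
theorem integral_norm_sq_multiplier_le {μ : ℝ → ℂ} (hμ : μ.HasTemperateGrowth) {M : ℝ} (hM : 0 ≤ M)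
    (hb : ∀ ξ, ‖μ ξ‖ ≤ M * bracketSymbol (-1) ξ) :
    ∫ x, ‖𝓕 (SchwartzMap.smulLeftCLM ℂ μ (𝓕⁻ (testSchwartz φ h1 h2))) x‖ ^ 2
      ≤ (∫ ξ, bracketSymbol (-2) ξ) * (M * ∫ x, |φ x|) ^ 2 := by
  rw [SchwartzMap.integral_norm_sq_fourier, ← integral_mul_const]
  have hN : ∀ ξ, ‖𝓕⁻ (testSchwartz φ h1 h2) ξ‖ ≤ ∫ x, |φ x| := fun ξ ↦ by
    simpa using norm_fourierInv_le_integral (testSchwartz φ h1 h2) ξ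
  have hint : Integrable fun ξ ↦ bracketSymbol (-2) ξ * (M * ∫ x, |φ x|) ^ 2 :=
    integrable_bracketSymbol_neg_two.mul_const _
  refine integral_mono_of_nonneg (Filter.Eventually.of_forall fun ξ ↦ by positivity) hint
    (Filter.Eventually.of_forall fun ξ ↦ ?_)
  simp only
  rw [SchwartzMap.smulLeftCLM_apply_apply hμ, smul_eq_mul, norm_mul, ← bracketSymbol_neg_one_sq, ← mul_pow]
  have hp := (bracketSymbol_pos (-1) ξ).le
  refine pow_le_pow_left₀ (by positivity) ?_ 2
  calc ‖μ ξ‖ * ‖𝓕⁻ (testSchwartz φ h1 h2) ξ‖ ≤ (M * bracketSymbol (-1) ξ) * ∫ x, |φ x| := by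
        gcongr
        · exact hb ξ
        · exact hN ξ
    _ = _ := by ring

/-- Multiplication by `x - x₀` is a derivative on the Fourier side. It falls on the symbol, or on
`𝓕⁻ φ`, where it amounts to multiplying `φ` by `x - x₀`, of modulus at most one on the support. The
two contributions account for the factor `2 * M`. -/
theorem integral_sq_mul_norm_sq_multiplier_le {μ d : ℝ → ℂ} (hμ : μ.HasTemperateGrowth) {M : ℝ} (hM : 0 ≤ M)
    (hb : ∀ ξ, ‖μ ξ‖ ≤ M * bracketSymbol (-1) ξ) (hd : ∀ ξ, HasDerivAt μ (d ξ) ξ)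
    (hdb : ∀ ξ, ‖d ξ‖ ≤ M * bracketSymbol (-1) ξ) (x₀ : ℝ) (hsupp : ∀ x, φ x ≠ 0 → |x - x₀| ≤ 1) :
    Integrable (fun x ↦ (x - x₀) ^ 2 * ‖𝓕 (SchwartzMap.smulLeftCLM ℂ μ (𝓕⁻ (testSchwartz φ h1 h2))) x‖ ^ 2) ∧
    ∫ x, (x - x₀) ^ 2 * ‖𝓕 (SchwartzMap.smulLeftCLM ℂ μ (𝓕⁻ (testSchwartz φ h1 h2))) x‖ ^ 2
      ≤ (∫ ξ, bracketSymbol (-2) ξ) * (2 * M * ∫ x, |φ x|) ^ 2 := by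
  set Φ := testSchwartz φ h1 h2
  set θ := SchwartzMap.smulLeftCLM ℂ μ (𝓕⁻ Φ)
  set c : ℂ := (2 * Real.pi * Complex.I)⁻¹
  have hpi : (2 * Real.pi * Complex.I : ℂ) ≠ 0 := by simp [Real.pi_ne_zero]
  have hg : (fun x : ℝ ↦ inner ℝ x (1 : ℝ)).HasTemperateGrowth := by fun_prop
  have hF : ∀ (Θ : 𝓢(ℝ, ℂ)), LineDeriv.lineDerivOp (1 : ℝ) Θ = SchwartzMap.derivCLM ℂ ℂ Θ := by
    intro Θ
    ext x
    rw [SchwartzMap.lineDerivOp_apply_eq_fderiv]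
    simp
  have key : ∀ x, ((x - x₀ : ℝ) : ℂ) * 𝓕 θ x = 𝓕 (c • SchwartzMap.derivCLM ℂ ℂ θ - (x₀ : ℂ) • θ) x := by
    intro x
    have h3 := SchwartzMap.fourier_lineDerivOp_eq θ (1 : ℝ)
    rw [hF] at h3
    have h4 : 𝓕 (c • SchwartzMap.derivCLM ℂ ℂ θ - (x₀ : ℂ) • θ)
        = c • 𝓕 (SchwartzMap.derivCLM ℂ ℂ θ) - (x₀ : ℂ) • 𝓕 θ := by
      rw [sub_eq_add_neg, FourierTransform.fourier_add, ← neg_smul, FourierTransform.fourier_smul,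
        FourierTransform.fourier_smul, neg_smul, ← sub_eq_add_neg]
    rw [h4, h3]
    simp only [sub_apply, smul_apply, SchwartzMap.smulLeftCLM_apply_apply hg]
    simp only [smul_eq_mul, Real.inner_apply, mul_one, Complex.real_smul, c]
    field_simp
    push_cast
    ring
  set Φ' := SchwartzMap.smulLeftCLM ℂ (fun x : ℝ ↦ inner ℝ x (1 : ℝ)) Φ - (x₀ : ℂ) • Φ
  have hN : ∀ ξ, ‖𝓕⁻ Φ ξ‖ ≤ ∫ x, |φ x| := fun ξ ↦ by
    simpa [Φ] using norm_fourierInv_le_integral Φ ξ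
  have hN' : ∀ ξ, ‖𝓕⁻ Φ' ξ‖ ≤ ∫ x, |φ x| := fun ξ ↦ by
    refine (norm_fourierInv_le_integral Φ' ξ).trans ?_
    have : Integrable φ := h1.continuous.integrable_of_hasCompactSupport h2
    refine integral_mono Φ'.integrable.norm this.abs fun x ↦ ?_
    have : Φ' x = ((x - x₀ : ℝ) : ℂ) * φ x := by
      simp only [Φ', sub_apply, smul_apply, SchwartzMap.smulLeftCLM_apply_apply hg]
      simp only [Φ, testSchwartz_apply, Real.inner_apply, mul_one, smul_eq_mul, Complex.real_smul]
      push_cast; ring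
    simp only [this, norm_mul, Complex.norm_real, Real.norm_eq_abs]
    by_cases hx : φ x = 0
    · simp [hx]
    · exact mul_le_of_le_one_left (abs_nonneg _) (hsupp x hx)
  have hval : ∀ ξ, (c • SchwartzMap.derivCLM ℂ ℂ θ - (x₀ : ℂ) • θ) ξ = c * d ξ * 𝓕⁻ Φ ξ + μ ξ * 𝓕⁻ Φ' ξ := by
    intro ξ
    have h3 := SchwartzMap.lineDerivOp_fourierInv_eq Φ (1 : ℝ)
    rw [hF] at h3
    have h4 : HasDerivAt (fun y ↦ 𝓕⁻ Φ y) (SchwartzMap.derivCLM ℂ ℂ (𝓕⁻ Φ) ξ) ξ := by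
      rw [SchwartzMap.derivCLM_apply]
      exact (𝓕⁻ Φ).differentiableAt.hasDerivAt
    have h5 : HasDerivAt (⇑θ) (d ξ * 𝓕⁻ Φ ξ + μ ξ * SchwartzMap.derivCLM ℂ ℂ (𝓕⁻ Φ) ξ) ξ := by
      have := (hd ξ).mul h4
      convert! this using 1
      ext y
      simp [θ, SchwartzMap.smulLeftCLM_apply_apply hμ]
    have h6 : 𝓕⁻ Φ' = 𝓕⁻ (SchwartzMap.smulLeftCLM ℂ (fun x : ℝ ↦ inner ℝ x (1 : ℝ)) Φ) - (x₀ : ℂ) • 𝓕⁻ Φ := by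
      rw [sub_eq_add_neg, ← neg_smul, ← FourierTransform.fourierInv_smul, ← FourierTransform.fourierInv_add]
      simp only [Φ', sub_eq_add_neg, neg_smul]
    rw [h6]
    simp only [sub_apply, smul_apply, SchwartzMap.derivCLM_apply, h5.deriv]
    rw [← SchwartzMap.derivCLM_apply ℂ (𝓕⁻ Φ), h3, FourierTransform.fourierInv_smul]
    simp only [smul_apply, smul_eq_mul, c, θ, SchwartzMap.smulLeftCLM_apply_apply hμ]
    field_simp
    ring
  have heq : (fun x ↦ (x - x₀) ^ 2 * ‖𝓕 θ x‖ ^ 2)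
      = fun x ↦ ‖𝓕 (c • SchwartzMap.derivCLM ℂ ℂ θ - (x₀ : ℂ) • θ) x‖ ^ 2 := by
    ext x
    rw [← key, norm_mul, mul_pow, Complex.norm_real, Real.norm_eq_abs, sq_abs]
  refine ⟨?_, ?_⟩
  · rw [heq]
    exact ((𝓕 (c • SchwartzMap.derivCLM ℂ ℂ θ - (x₀ : ℂ) • θ)).memLp 2 volume).integrable_norm_pow (by norm_num)
  · rw [heq, SchwartzMap.integral_norm_sq_fourier, ← integral_mul_const]
    refine integral_mono_of_nonneg (Filter.Eventually.of_forall fun ξ ↦ by positivity)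
      (integrable_bracketSymbol_neg_two.mul_const _) (Filter.Eventually.of_forall fun ξ ↦ ?_)
    simp only
    rw [hval, ← bracketSymbol_neg_one_sq, ← mul_pow]
    have hp := (bracketSymbol_pos (-1) ξ).le
    have hI : 0 ≤ ∫ x, |φ x| := integral_nonneg fun x ↦ abs_nonneg _
    refine pow_le_pow_left₀ (norm_nonneg _) ?_ 2
    have hc : ‖c‖ ≤ 1 := by
      simp only [c, norm_inv, norm_mul, Complex.norm_I, mul_one, Complex.norm_ofNat, Complex.norm_real,
        Real.norm_of_nonneg Real.pi_pos.le]
      apply inv_le_one_of_one_le₀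
      linarith [Real.pi_gt_three]
    calc ‖c * d ξ * 𝓕⁻ Φ ξ + μ ξ * 𝓕⁻ Φ' ξ‖ ≤ ‖c‖ * ‖d ξ‖ * ‖𝓕⁻ Φ ξ‖ + ‖μ ξ‖ * ‖𝓕⁻ Φ' ξ‖ := by
          refine (norm_add_le _ _).trans (by simp only [norm_mul]; rfl)
      _ ≤ 1 * (M * bracketSymbol (-1) ξ) * (∫ x, |φ x|) + (M * bracketSymbol (-1) ξ) * ∫ x, |φ x| := by
          gcongr
          · exact hdb ξ
          · exact hN ξ
          · exact hb ξ
          · exact hN' ξ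
      _ = _ := by ring

end Localized

/-- The `L^1` norm is controlled by the two preceding `L^2` bounds and the integrable weight `(1 +
(x - x₀) ^ 2)⁻¹`, of integral `π`. By duality, an `L^1` bound of this kind yields estimates in
`L^∞`. -/
theorem integral_norm_multiplier_le {φ : ℝ → ℝ} (h1 : ContDiff ℝ ∞ φ) (h2 : HasCompactSupport φ)
    {μ d : ℝ → ℂ} (hμ : μ.HasTemperateGrowth) {M : ℝ} (hM : 0 ≤ M)
    (hb : ∀ ξ, ‖μ ξ‖ ≤ M * bracketSymbol (-1) ξ) (hd : ∀ ξ, HasDerivAt μ (d ξ) ξ)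
    (hdb : ∀ ξ, ‖d ξ‖ ≤ M * bracketSymbol (-1) ξ) (x₀ : ℝ) (hsupp : ∀ x, φ x ≠ 0 → |x - x₀| ≤ 1) :
    ∫ x, ‖𝓕 (SchwartzMap.smulLeftCLM ℂ μ (𝓕⁻ (testSchwartz φ h1 h2))) x‖
      ≤ (5 * M ^ 2 * (∫ ξ, bracketSymbol (-2) ξ) + Real.pi) * ∫ x, |φ x| := by
  set Ψ := 𝓕 (SchwartzMap.smulLeftCLM ℂ μ (𝓕⁻ (testSchwartz φ h1 h2)))
  set N := ∫ x, |φ x|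
  set κ := ∫ ξ, bracketSymbol (-2) ξ
  have hN : 0 ≤ N := integral_nonneg fun x ↦ abs_nonneg _
  have hκ : 0 ≤ κ := integral_nonneg fun x ↦ (bracketSymbol_pos _ _).le
  obtain ⟨hi, hI⟩ := integral_sq_mul_norm_sq_multiplier_le h1 h2 hμ hM hb hd hdb x₀ hsupp
  have hJ := integral_norm_sq_multiplier_le h1 h2 hμ hM hb
  have hj : Integrable fun x ↦ ‖Ψ x‖ ^ 2 := (Ψ.memLp 2 volume).integrable_norm_pow (by norm_num)
  have hc : Integrable (fun x : ℝ ↦ (1 + (x - x₀) ^ 2)⁻¹) := integrable_inv_one_add_sq.comp_sub_right x₀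
  have hcv : ∫ x : ℝ, (1 + (x - x₀) ^ 2)⁻¹ = Real.pi := by
    rw [integral_sub_right_eq_self (fun x : ℝ ↦ (1 + x ^ 2)⁻¹) x₀, integral_univ_inv_one_add_sq]
  -- A positive parameter `l ≥ N` balances the two terms of the arithmetic-geometric inequality. It
  -- can be inverted even if `N = 0`, and it is sent to `N` at the end.
  have main : ∀ l : ℝ, 0 < l → N ≤ l → ∫ x, ‖Ψ x‖ ≤ (5 * M ^ 2 * κ + Real.pi) * l := by
    intro l hl hNl
    have hpt : ∀ x, ‖Ψ x‖ ≤ l⁻¹ * (‖Ψ x‖ ^ 2 + (x - x₀) ^ 2 * ‖Ψ x‖ ^ 2) + l * (1 + (x - x₀) ^ 2)⁻¹ := by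
      intro x
      have hw : 0 < 1 + (x - x₀) ^ 2 := by positivity
      set w := 1 + (x - x₀) ^ 2
      have : l⁻¹ * (‖Ψ x‖ ^ 2 + (x - x₀) ^ 2 * ‖Ψ x‖ ^ 2) + l * w⁻¹ - ‖Ψ x‖
          = (l * w)⁻¹ * ((‖Ψ x‖ * w - l / 2) ^ 2 + 3 * l ^ 2 / 4) := by
        have : ‖Ψ x‖ ^ 2 + (x - x₀) ^ 2 * ‖Ψ x‖ ^ 2 = w * ‖Ψ x‖ ^ 2 := by simp only [w]; ring
        rw [this]
        field_simp
        ring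
      have h3 : 0 ≤ (l * w)⁻¹ * ((‖Ψ x‖ * w - l / 2) ^ 2 + 3 * l ^ 2 / 4) := by positivity
      linarith
    have h4 : ∫ x, ‖Ψ x‖ ≤ l⁻¹ * ((∫ x, ‖Ψ x‖ ^ 2) + ∫ x, (x - x₀) ^ 2 * ‖Ψ x‖ ^ 2) + l * Real.pi := by
      rw [← integral_add hj hi, ← hcv, ← integral_const_mul, ← integral_const_mul, ← integral_add]
      · exact integral_mono Ψ.integrable.norm
          (((hj.add hi).const_mul _).add (hc.const_mul l)) hpt
      · exact (hj.add hi).const_mul _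
      · exact hc.const_mul l
    have hNl2 : N ^ 2 ≤ l ^ 2 := by gcongr
    have h5 : (∫ x, ‖Ψ x‖ ^ 2) + ∫ x, (x - x₀) ^ 2 * ‖Ψ x‖ ^ 2 ≤ 5 * M ^ 2 * κ * l ^ 2 := by
      calc _ ≤ κ * (M * N) ^ 2 + κ * (2 * M * N) ^ 2 := add_le_add hJ hI
        _ = 5 * M ^ 2 * κ * N ^ 2 := by ring
        _ ≤ _ := by gcongr
    refine h4.trans ?_
    calc _ ≤ l⁻¹ * (5 * M ^ 2 * κ * l ^ 2) + l * Real.pi := by gcongr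
      _ = _ := by field_simp
  have hC : 0 ≤ 5 * M ^ 2 * κ + Real.pi := by positivity
  refine le_of_forall_pos_le_add fun δ hδ ↦ ?_
  set C := 5 * M ^ 2 * κ + Real.pi
  refine (main (N + δ / (C + 1)) (by positivity) (by simp; positivity)).trans ?_
  rw [mul_add]
  gcongr
  rw [mul_div_assoc', div_le_iff₀ (by positivity)]
  nlinarith

/-- Reduces a bound by the norm to a bound by each admissible representative. The constant `C + 1`
is positive, hence can be divided out, which also covers an infinite norm. -/
theorem le_mul_besselNorm {m : ℝ} {p : ℝ≥0∞} [Fact (1 ≤ p)] {f : ℝ → ℝ} {X C : ℝ} (hC : 0 ≤ C)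
    (h : ∀ (S : 𝓢'(ℝ, ℂ)), IsDistributionOf f S → ∀ g : Lp ℂ p (volume : Measure ℝ),
      bracketD m S = (g : 𝓢'(ℝ, ℂ)) → X ≤ C * ‖g‖) :
    ENNReal.ofReal X ≤ ENNReal.ofReal (C + 1) * besselNorm m p f := by
  have h0 : ENNReal.ofReal (C + 1) ≠ 0 := by simp; linarith
  rw [← ENNReal.div_le_iff' h0 ENNReal.ofReal_ne_top]
  unfold besselNorm
  refine le_iInf fun S ↦ le_iInf fun hS ↦ le_iInf fun g ↦ le_iInf fun hg ↦ ?_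
  rw [ENNReal.div_le_iff' h0 ENNReal.ofReal_ne_top, ← ofReal_norm g, ← ENNReal.ofReal_mul (by positivity)]
  exact ENNReal.ofReal_le_ofReal ((h S hS g hg).trans (by nlinarith [norm_nonneg g]))

/-- Sobolev embedding in the sup norm: `|f ^ (j)| ≤ C ‖f‖_{H^m}` for `j < m`. -/
theorem exists_abs_iteratedDeriv_le_sobolevNorm {m j : ℕ} (hj : j + 1 ≤ m) :
    ∃ C : ℝ, 0 ≤ C ∧ ∀ f : ℝ → ℝ, ContDiff ℝ j f → ∀ x : ℝ,
      ENNReal.ofReal |iteratedDeriv j f x| ≤ ENNReal.ofReal C * sobolevNorm m f := by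
  obtain ⟨M, hM, hb, -⟩ := exists_hasDerivAt_derivSymbol (m := m) (j := j) (by exact_mod_cast hj)
  set κ := ∫ ξ, bracketSymbol (-2) ξ
  have hκ : 0 ≤ κ := integral_nonneg fun x ↦ (bracketSymbol_pos _ _).le
  refine ⟨Real.sqrt κ * M + 1, by positivity, fun f hf x₀ ↦ ?_⟩
  refine le_mul_besselNorm (by positivity) fun S hS g hg ↦ ?_
  apply abs_le_of_integral_test_le hf.continuous_iteratedDeriv'
  intro φ h1 h2 _
  have h3 := integral_test_iteratedDeriv h1 h2 hf hS hg
  set Ψ := 𝓕 (SchwartzMap.smulLeftCLM ℂ (derivSymbol m j) (𝓕⁻ (testSchwartz φ h1 h2)))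
  have h4 : |∫ x, φ x * iteratedDeriv j f x| = ‖∫ x, Ψ x • g x‖ := by
    rw [← Lp.toTemperedDistribution_apply, ← h3, Complex.norm_real, norm_mul]
    simp
  have h5 : ∫ x, ‖Ψ x‖ ^ 2 ≤ κ * (M * ∫ x, |φ x|) ^ 2 :=
    integral_norm_sq_multiplier_le h1 h2 (derivSymbol_hasTemperateGrowth m j) hM hb
  have h6 : ‖∫ x, Ψ x • g x‖ ≤ Real.sqrt (∫ x, ‖Ψ x‖ ^ 2) * ‖g‖ := by
    have hg2 : ‖g‖ = Real.sqrt (∫ x, ‖g x‖ ^ 2) := by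
      rw [Lp.norm_def, eLpNorm_eq_lintegral_rpow_enorm_toReal (by norm_num) (by norm_num)]
      rw [← ENNReal.toReal_rpow, Real.sqrt_eq_rpow]
      simp only [ENNReal.toReal_ofNat]
      congr 1
      have hm : AEStronglyMeasurable (fun x ↦ ‖g x‖ ^ 2) (volume : Measure ℝ) := (Lp.memLp g).1.norm.pow 2
      rw [integral_eq_lintegral_of_nonneg_ae (Filter.Eventually.of_forall fun x ↦ by positivity) hm]
      congr 2
      ext x
      rw [← ofReal_norm, ENNReal.ofReal_pow (norm_nonneg _)]
      norm_cast
    rw [hg2]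
    refine (norm_integral_le_integral_norm _).trans ?_
    simp only [norm_smul]
    have := integral_mul_le_Lp_mul_Lq_of_nonneg (μ := (volume : Measure ℝ)) (p := 2) (q := 2)
      (f := fun x ↦ ‖Ψ x‖) (g := fun x ↦ ‖g x‖) (by norm_num [Real.holderConjugate_iff])
      (Filter.Eventually.of_forall fun x ↦ norm_nonneg _) (Filter.Eventually.of_forall fun x ↦ norm_nonneg _)
      (by simpa using (Ψ.memLp 2 volume).norm) (by simpa using (Lp.memLp g).norm)
    simpa [Real.sqrt_eq_rpow] using this
  rw [h4]
  refine h6.trans ?_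
  have hI : 0 ≤ ∫ x, |φ x| := integral_nonneg fun x ↦ abs_nonneg _
  have h7 : Real.sqrt (∫ x, ‖Ψ x‖ ^ 2) ≤ Real.sqrt κ * (M * ∫ x, |φ x|) := by
    refine (Real.sqrt_le_sqrt h5).trans (le_of_eq ?_)
    rw [Real.sqrt_mul hκ, Real.sqrt_sq (by positivity)]
  calc _ ≤ Real.sqrt κ * (M * ∫ x, |φ x|) * ‖g‖ := by gcongr
    _ = _ := by ring

/-- `‖f ^ (j)‖_{L^∞} ≤ C ‖⟨D_x⟩ ^ m f‖_{L^∞}` for `j ≤ m - 1`. -/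
theorem exists_abs_iteratedDeriv_le_besselNorm_top {m : ℝ} {j : ℕ} (hj : j + 1 ≤ m) :
    ∃ C : ℝ, 0 ≤ C ∧ ∀ f : ℝ → ℝ, ContDiff ℝ j f → ∀ x : ℝ,
      ENNReal.ofReal |iteratedDeriv j f x| ≤ ENNReal.ofReal C * besselNorm m ∞ f := by
  obtain ⟨M, hM, hb, d, hd, hdb⟩ := exists_hasDerivAt_derivSymbol hj
  set κ := ∫ ξ, bracketSymbol (-2) ξ
  have hκ : 0 ≤ κ := integral_nonneg fun x ↦ (bracketSymbol_pos _ _).le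
  refine ⟨5 * M ^ 2 * κ + Real.pi + 1, by positivity, fun f hf x₀ ↦ ?_⟩
  refine le_mul_besselNorm (by positivity) fun S hS g hg ↦ ?_
  apply abs_le_of_integral_test_le hf.continuous_iteratedDeriv'
  intro φ h1 h2 hsupp
  have h3 := integral_test_iteratedDeriv h1 h2 hf hS hg
  have h5 := integral_norm_multiplier_le h1 h2 (derivSymbol_hasTemperateGrowth m j) hM hb hd hdb x₀ hsupp
  set Ψ := 𝓕 (SchwartzMap.smulLeftCLM ℂ (derivSymbol m j) (𝓕⁻ (testSchwartz φ h1 h2)))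
  have h4 : |∫ x, φ x * iteratedDeriv j f x| = ‖∫ x, Ψ x • g x‖ := by
    rw [← Lp.toTemperedDistribution_apply, ← h3, Complex.norm_real, norm_mul]
    simp
  have hgb : ∀ᵐ x, ‖g x‖ ≤ ‖g‖ := by
    have := ae_le_eLpNormEssSup (f := g) (μ := (volume : Measure ℝ))
    filter_upwards [this] with x hx
    rw [Lp.norm_def, eLpNorm_exponent_top]
    have hfin : eLpNormEssSup g (volume : Measure ℝ) ≠ (⊤ : ℝ≥0∞) := by
      rw [← eLpNorm_exponent_top]; exact (Lp.memLp g).2.ne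
    rw [← toReal_enorm]
    exact ENNReal.toReal_mono hfin hx
  rw [h4]
  calc ‖∫ x, Ψ x • g x‖ ≤ ∫ x, ‖Ψ x‖ * ‖g‖ := by
        apply norm_integral_le_of_norm_le (Ψ.integrable.norm.mul_const _)
        filter_upwards [hgb] with x hx
        rw [norm_smul]
        gcongr
    _ = (∫ x, ‖Ψ x‖) * ‖g‖ := integral_mul_const _ _
    _ ≤ _ := by
      refine (mul_le_mul_of_nonneg_right h5 (norm_nonneg _)).trans (le_of_eq ?_)
      ring

end

/-! ### From Sobolev norms to classical regularity. -/

section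

theorem IsDistributionOf.congr {f f' : ℝ → ℝ} {S : 𝓢'(ℝ, ℂ)} (h : f =ᵐ[volume] f') (hS : IsDistributionOf f S) :
    IsDistributionOf f' S := by
  intro φ
  have : (fun x : ℝ ↦ φ x * (f x : ℂ)) =ᵐ[volume] fun x : ℝ ↦ φ x * (f' x : ℂ) := by
    filter_upwards [h] with x hx
    rw [hx]
  exact ⟨(hS φ).1.congr this, by rw [(hS φ).2, integral_congr_ae this]⟩

theorem besselNorm_congr_ae {m : ℝ} {p : ℝ≥0∞} [Fact (1 ≤ p)] {f f' : ℝ → ℝ} (h : f =ᵐ[volume] f') :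
    besselNorm m p f = besselNorm m p f' := by
  have : ∀ S, IsDistributionOf f S ↔ IsDistributionOf f' S :=
    fun S ↦ ⟨fun hS ↦ hS.congr h, fun hS ↦ hS.congr h.symm⟩
  unfold besselNorm
  simp only [this]

theorem sobolevNorm_congr_ae {k : ℕ} {f f' : ℝ → ℝ} (h : f =ᵐ[volume] f') : sobolevNorm k f = sobolevNorm k f' :=
  besselNorm_congr_ae h

theorem exists_of_besselNorm_lt_top {m : ℝ} {p : ℝ≥0∞} [Fact (1 ≤ p)] {f : ℝ → ℝ} (h : besselNorm m p f < ⊤) :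
    ∃ S, IsDistributionOf f S ∧ ∃ g : Lp ℂ p (volume : Measure ℝ), bracketD m S = (g : 𝓢'(ℝ, ℂ)) := by
  unfold besselNorm at h
  simp only [iInf_lt_iff] at h
  obtain ⟨S, hS, g, hg, -⟩ := h
  exact ⟨S, hS, g, hg⟩

theorem IsDistributionOf.locallyIntegrable {f : ℝ → ℝ} {S : 𝓢'(ℝ, ℂ)} (hS : IsDistributionOf f S) :
    LocallyIntegrable f := by
  intro x
  let b : ContDiffBump x := ⟨1, 2, one_pos, by norm_num⟩
  have h1 := (hS (testSchwartz b b.contDiff b.hasCompactSupport)).1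
  refine ⟨Metric.closedBall x 1, Metric.closedBall_mem_nhds x one_pos, ?_⟩
  have h2 : Integrable fun y ↦ (b y * f y : ℝ) := by
    have := h1.re
    refine this.congr (Filter.Eventually.of_forall fun y ↦ ?_)
    simp only [testSchwartz_apply, ← Complex.ofReal_mul]
    exact Complex.ofReal_re _
  refine (h2.integrableOn (s := Metric.closedBall x 1)).congr_fun (fun y hy ↦ ?_) Metric.isClosed_closedBall.measurableSet
  simp only
  rw [b.one_of_mem_closedBall hy, one_mul]

theorem bracketSymbol_continuous (m : ℝ) : Continuous (bracketSymbol m) :=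
  continuous_iff_continuousAt.2 fun ξ ↦ (hasDerivAt_bracketSymbol m ξ).continuousAt

/-- The transform of `f` is `⟨D_x⟩ ^ (-n-1)`'s symbol times a square integrable function, so its
moments up to order `n` are integrable and its inverse transform is of class `C ^ n`. Continuity of
`f` turns equality almost everywhere into equality. -/
theorem contDiff_of_sobolevNorm_lt_top {n : ℕ} {f : ℝ → ℝ} (hf : Continuous f)
    (h : sobolevNorm (n + 1) f < ⊤) : ContDiff ℝ n f := by
  obtain ⟨S, hS, g, hg⟩ := exists_of_besselNorm_lt_top h
  set G : Lp ℂ 2 (volume : Measure ℝ) := 𝓕 g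
  set m : ℝ := ((n + 1 : ℕ) : ℝ)
  set H : ℝ → ℂ := fun ξ ↦ (bracketSymbol (-m) ξ : ℂ) * G ξ
  have hGm : AEStronglyMeasurable G volume := (Lp.memLp G).1
  have hHm : AEStronglyMeasurable H volume :=
    (Complex.continuous_ofReal.comp (bracketSymbol_continuous (-m))).aestronglyMeasurable.mul hGm
  have hG2 : Integrable fun ξ ↦ ‖G ξ‖ ^ 2 := (Lp.memLp G).integrable_norm_pow (by norm_num)
  have hmom : ∀ k : ℕ, (k : ℕ∞) ≤ (n : ℕ∞) → Integrable fun ξ : ℝ ↦ ‖ξ‖ ^ k * ‖H ξ‖ := by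
    intro k hk
    have hk' : k ≤ n := by exact_mod_cast hk
    refine Integrable.mono' (integrable_bracketSymbol_neg_two.add hG2)
      ((continuous_norm.pow k).aestronglyMeasurable.mul hHm.norm) (Filter.Eventually.of_forall fun ξ ↦ ?_)
    simp only [Pi.add_apply]
    rw [Real.norm_of_nonneg (by positivity), norm_mul, Complex.norm_real,
      Real.norm_of_nonneg (bracketSymbol_pos _ _).le]
    have h1 : ‖ξ‖ ^ k ≤ bracketSymbol k ξ := by
      refine le_trans ?_ (norm_two_pi_mul_pow_le k ξ)
      gcongr
      rw [Real.norm_eq_abs, abs_mul, abs_of_nonneg (by positivity : 0 ≤ 2 * Real.pi)]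
      nlinarith [Real.pi_gt_three, abs_nonneg ξ]
    have h2 : ‖ξ‖ ^ k * bracketSymbol (-m) ξ ≤ bracketSymbol (-1) ξ := by
      refine (mul_le_mul_of_nonneg_right h1 (bracketSymbol_pos _ _).le).trans ?_
      rw [bracketSymbol_mul]
      apply bracketSymbol_mono
      have : (k : ℝ) ≤ n := by exact_mod_cast hk'
      simp only [m]; push_cast; linarith
    rw [← bracketSymbol_neg_one_sq, ← mul_assoc]
    have h3 := mul_le_mul_of_nonneg_right h2 (norm_nonneg (G ξ))
    nlinarith [sq_nonneg (bracketSymbol (-1) ξ - ‖G ξ‖), sq_nonneg (bracketSymbol (-1) ξ), sq_nonneg ‖G ξ‖]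
  have hHi : Integrable H := by
    have := hmom 0 (by simp)
    simp only [pow_zero, one_mul] at this
    exact (integrable_norm_iff hHm).1 this
  have hC : ContDiff ℝ n (𝓕⁻ H) := by
    have : ContDiff ℝ n (𝓕 H) := Real.contDiff_fourier (N := n) hmom
    have h2 : 𝓕⁻ H = fun x ↦ 𝓕 H (-x) := by
      ext x; exact Real.fourierInv_eq_fourier_neg H x
    rw [h2]
    exact this.comp contDiff_neg
  have key : ∀ᵐ x, (f x : ℂ) = 𝓕⁻ H x := by
    apply ae_eq_of_integral_contDiff_smul_eq
    · exact (Complex.continuous_ofReal.comp hf).locallyIntegrable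
    · exact hC.continuous.locallyIntegrable
    · intro φ h1 h2
      set Φ := testSchwartz φ h1 h2
      have h3 : S Φ = ∫ ξ, 𝓕⁻ Φ ξ * H ξ := by
        have h4 : bracketD (-m) (g : 𝓢'(ℝ, ℂ)) = S := (eq_bracketD_neg hg).symm
        rw [← h4, bracketD, TemperedDistribution.fourierMultiplierCLM_apply,
          TemperedDistribution.fourierInv_apply, TemperedDistribution.smulLeftCLM_apply_apply,
          Lp.fourier_toTemperedDistribution_eq, Lp.toTemperedDistribution_apply]
        congr 1
        ext ξ
        rw [SchwartzMap.smulLeftCLM_apply_apply (bracketSymbol_hasTemperateGrowth (-m))]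
        simp only [H, smul_eq_mul]
        ring
      have h5 : ∫ ξ, 𝓕⁻ Φ ξ * H ξ = ∫ x, Φ x * 𝓕⁻ H x := by
        -- The form `-innerₗ ℝ` turns the forward transform into the inverse one, so this is the
        -- exchange formula for `𝓕⁻`.
        have h6 := VectorFourier.integral_fourierIntegral_smul_eq_flip (L := -innerₗ ℝ) (μ := volume) (ν := volume)
          Real.continuous_fourierChar (by simp only [LinearMap.neg_apply, innerₗ_apply_apply, Real.inner_apply]; fun_prop) Φ.integrable hHi
        have h7 : ∀ x, VectorFourier.fourierIntegral Real.fourierChar volume (-innerₗ ℝ) (fun y ↦ Φ y) x = 𝓕⁻ Φ x := by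
          intro x
          rw [SchwartzMap.fourierInv_coe, Real.fourierInv_eq]
          simp [VectorFourier.fourierIntegral]
        have h9 : ∀ x, VectorFourier.fourierIntegral Real.fourierChar volume (-innerₗ ℝ).flip H x = 𝓕⁻ H x := by
          intro x
          rw [Real.fourierInv_eq]
          simp [VectorFourier.fourierIntegral, mul_comm]
        simp only [h7, h9, smul_eq_mul] at h6
        exact h6
      have h8 := (hS Φ).2
      simp only [Φ, testSchwartz_apply] at h8 h5
      simp only [Complex.real_smul]
      rw [← h8, h3, h5]
  have hae : (fun x ↦ (f x : ℂ)) = 𝓕⁻ H :=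
    Continuous.ae_eq_iff_eq volume (Complex.continuous_ofReal.comp hf) hC.continuous |>.1 key
  have : f = fun x ↦ (𝓕⁻ H x).re := by
    ext x
    rw [← hae]; simp
  rw [this]
  exact Complex.reCLM.contDiff.comp hC

end

section

/-! ### Functions on the strip -/

/-- `g = ∂_t f` on the strip, one-sided at the end points. -/
def IsDerivT (T : ℝ) (f g : ℝ → ℝ → ℝ) : Prop :=
  ∀ t ∈ Set.Icc 1 T, ∀ x, HasDerivWithinAt (fun τ ↦ f τ x) (g t x) (Set.Icc 1 T) t

/-- `g = ∂_x f` on the strip. -/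
def IsDerivX (T : ℝ) (f g : ℝ → ℝ → ℝ) : Prop :=
  ∀ t ∈ Set.Icc 1 T, ∀ x, HasDerivAt (f t) (g t x) x

/-- Joint continuity on the strip. -/
def ContStrip (T : ℝ) (f : ℝ → ℝ → ℝ) : Prop :=
  ContinuousOn (fun q : ℝ × ℝ ↦ f q.1 q.2) (Set.Icc 1 T ×ˢ Set.univ)

variable {T : ℝ} {f f' g g' : ℝ → ℝ → ℝ}

theorem IsDerivT.add (hf : IsDerivT T f f') (hg : IsDerivT T g g') :
    IsDerivT T (fun t x ↦ f t x + g t x) (fun t x ↦ f' t x + g' t x) :=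
  fun t ht x ↦ (hf t ht x).add (hg t ht x)

theorem IsDerivT.sub (hf : IsDerivT T f f') (hg : IsDerivT T g g') :
    IsDerivT T (fun t x ↦ f t x - g t x) (fun t x ↦ f' t x - g' t x) :=
  fun t ht x ↦ (hf t ht x).sub (hg t ht x)

theorem IsDerivT.mul (hf : IsDerivT T f f') (hg : IsDerivT T g g') :
    IsDerivT T (fun t x ↦ f t x * g t x) (fun t x ↦ f' t x * g t x + f t x * g' t x) :=
  fun t ht x ↦ (hf t ht x).mul (hg t ht x)

theorem IsDerivT.const_mul (hf : IsDerivT T f f') (c : ℝ) :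
    IsDerivT T (fun t x ↦ c * f t x) (fun t x ↦ c * f' t x) :=
  fun t ht x ↦ (hf t ht x).const_mul c

theorem IsDerivT.sum {ι : Type*} {s : Finset ι} {f f' : ι → ℝ → ℝ → ℝ} (hf : ∀ i ∈ s, IsDerivT T (f i) (f' i)) :
    IsDerivT T (fun t x ↦ ∑ i ∈ s, f i t x) (fun t x ↦ ∑ i ∈ s, f' i t x) :=
  fun t ht x ↦ HasDerivWithinAt.fun_sum fun i hi ↦ hf i hi t ht x

theorem IsDerivT.congr (hf : IsDerivT T f f') (h : ∀ t ∈ Set.Icc 1 T, ∀ x, g t x = f t x)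
    (h' : ∀ t ∈ Set.Icc 1 T, ∀ x, g' t x = f' t x) : IsDerivT T g g' := by
  intro t ht x
  rw [h' t ht x]
  exact (hf t ht x).congr (fun τ hτ ↦ h τ hτ x) (h t ht x)

theorem IsDerivX.add (hf : IsDerivX T f f') (hg : IsDerivX T g g') :
    IsDerivX T (fun t x ↦ f t x + g t x) (fun t x ↦ f' t x + g' t x) :=
  fun t ht x ↦ (hf t ht x).add (hg t ht x)

theorem IsDerivX.sub (hf : IsDerivX T f f') (hg : IsDerivX T g g') :
    IsDerivX T (fun t x ↦ f t x - g t x) (fun t x ↦ f' t x - g' t x) :=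
  fun t ht x ↦ (hf t ht x).sub (hg t ht x)

theorem IsDerivX.mul (hf : IsDerivX T f f') (hg : IsDerivX T g g') :
    IsDerivX T (fun t x ↦ f t x * g t x) (fun t x ↦ f' t x * g t x + f t x * g' t x) :=
  fun t ht x ↦ (hf t ht x).mul (hg t ht x)

theorem IsDerivX.const_mul (hf : IsDerivX T f f') (c : ℝ) :
    IsDerivX T (fun t x ↦ c * f t x) (fun t x ↦ c * f' t x) :=
  fun t ht x ↦ (hf t ht x).const_mul c

theorem IsDerivX.sum {ι : Type*} {s : Finset ι} {f f' : ι → ℝ → ℝ → ℝ} (hf : ∀ i ∈ s, IsDerivX T (f i) (f' i)) :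
    IsDerivX T (fun t x ↦ ∑ i ∈ s, f i t x) (fun t x ↦ ∑ i ∈ s, f' i t x) :=
  fun t ht x ↦ HasDerivAt.fun_sum fun i hi ↦ hf i hi t ht x

theorem IsDerivX.congr (hf : IsDerivX T f f') (h : ∀ t ∈ Set.Icc 1 T, ∀ x, g t x = f t x)
    (h' : ∀ t ∈ Set.Icc 1 T, ∀ x, g' t x = f' t x) : IsDerivX T g g' := by
  intro t ht x
  rw [h' t ht x, funext (h t ht)]
  exact hf t ht x

theorem ContStrip.add (hf : ContStrip T f) (hg : ContStrip T g) : ContStrip T (fun t x ↦ f t x + g t x) :=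
  ContinuousOn.add hf hg

theorem ContStrip.sub (hf : ContStrip T f) (hg : ContStrip T g) : ContStrip T (fun t x ↦ f t x - g t x) :=
  ContinuousOn.sub hf hg

theorem ContStrip.mul (hf : ContStrip T f) (hg : ContStrip T g) : ContStrip T (fun t x ↦ f t x * g t x) :=
  ContinuousOn.mul hf hg

theorem ContStrip.const_mul (hf : ContStrip T f) (c : ℝ) : ContStrip T (fun t x ↦ c * f t x) :=
  ContinuousOn.mul continuousOn_const hf

theorem ContStrip.sum {ι : Type*} {s : Finset ι} {f : ι → ℝ → ℝ → ℝ} (hf : ∀ i ∈ s, ContStrip T (f i)) :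
    ContStrip T (fun t x ↦ ∑ i ∈ s, f i t x) :=
  continuousOn_finsetSum s hf

theorem ContStrip.congr (hf : ContStrip T f) (h : ∀ t ∈ Set.Icc 1 T, ∀ x, g t x = f t x) : ContStrip T g :=
  ContinuousOn.congr hf fun q hq ↦ h q.1 hq.1 q.2

theorem contStrip_of_continuous (hf : Continuous fun q : ℝ × ℝ ↦ f q.1 q.2) : ContStrip T f :=
  hf.continuousOn

theorem ContStrip.comp_add_right (hf : ContStrip T f) (h : ℝ) : ContStrip T (fun t x ↦ f t (x + h)) :=
  ContinuousOn.comp (g := fun q : ℝ × ℝ ↦ f q.1 q.2) (f := fun q : ℝ × ℝ ↦ (q.1, q.2 + h)) hf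
    (by fun_prop) (fun q hq ↦ ⟨hq.1, Set.mem_univ _⟩)

theorem ContStrip.continuous (hf : ContStrip T f) {t : ℝ} (ht : t ∈ Set.Icc 1 T) : Continuous (f t) :=
  ContinuousOn.comp_continuous (g := fun q : ℝ × ℝ ↦ f q.1 q.2) (f := fun x : ℝ ↦ (t, x)) hf
    (by fun_prop) (fun x ↦ ⟨ht, Set.mem_univ _⟩)

theorem ContStrip.continuousOn_t (hf : ContStrip T f) (x : ℝ) : ContinuousOn (fun t ↦ f t x) (Set.Icc 1 T) :=
  ContinuousOn.comp (g := fun q : ℝ × ℝ ↦ f q.1 q.2) (f := fun t : ℝ ↦ (t, x)) hf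
    (by fun_prop) (fun t ht ↦ ⟨ht, Set.mem_univ _⟩)

theorem IsDerivT.comp_add_right (hf : IsDerivT T f f') (h : ℝ) :
    IsDerivT T (fun t x ↦ f t (x + h)) (fun t x ↦ f' t (x + h)) :=
  fun t ht x ↦ hf t ht (x + h)

theorem IsDerivX.comp_add_right (hf : IsDerivX T f f') (h : ℝ) :
    IsDerivX T (fun t x ↦ f t (x + h)) (fun t x ↦ f' t (x + h)) :=
  fun t ht x ↦ (hf t ht (x + h)).comp_add_const x h

/-- A function continuous on the strip extends continuously to the plane. -/
theorem ContStrip.exists_extension (hT : 1 ≤ T) (hf : ContStrip T f) :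
    ∃ F : ℝ → ℝ → ℝ, (Continuous fun q : ℝ × ℝ ↦ F q.1 q.2) ∧ ∀ t ∈ Set.Icc 1 T, ∀ x, F t x = f t x := by
  refine ⟨fun t x ↦ f (max 1 (min t T)) x, ?_, fun t ht x ↦ ?_⟩
  · exact ContinuousOn.comp_continuous (g := fun q : ℝ × ℝ ↦ f q.1 q.2)
      (f := fun q : ℝ × ℝ ↦ (max 1 (min q.1 T), q.2)) hf (by fun_prop)
      (fun q ↦ ⟨⟨le_max_left _ _, max_le hT (min_le_right _ _)⟩, Set.mem_univ _⟩)
  · simp only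
    rw [min_eq_left ht.2, max_eq_right ht.1]

theorem IsDerivT.dt_eq (hT : 1 < T) (hf : IsDerivT T f f') {t : ℝ} (ht : t ∈ Set.Icc 1 T) (x : ℝ) :
    dt T f t x = f' t x :=
  (hf t ht x).derivWithin (uniqueDiffOn_Icc hT t ht)

theorem IsDerivX.dx_eq (hf : IsDerivX T f f') {t : ℝ} (ht : t ∈ Set.Icc 1 T) (x : ℝ) :
    dx f t x = f' t x :=
  (hf t ht x).deriv

/-- Symmetry of mixed derivatives on the strip. -/
theorem IsDerivT.of_mixed {g p q r : ℝ → ℝ → ℝ} (hp : IsDerivX T g p) (hq : IsDerivT T g q)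
    (hr : IsDerivX T q r) (hc : ContStrip T r) : IsDerivT T p r := by
  intro t₀ ht₀ x₀
  rw [hasDerivWithinAt_iff_isLittleO, Asymptotics.isLittleO_iff]
  intro ε hε
  have hct := hc (t₀, x₀) ⟨ht₀, Set.mem_univ _⟩
  obtain ⟨η, hη, hball⟩ := Metric.continuousWithinAt_iff.1 hct ε hε
  have hr0 : ∀ t ∈ Set.Icc 1 T, |t - t₀| < η → ∀ x, |x - x₀| < η → |r t x - r t₀ x₀| ≤ ε := by
    intro t ht htη x hx
    have := hball (x := (t, x)) ⟨ht, Set.mem_univ _⟩ (by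
      rw [Prod.dist_eq]; exact max_lt (by simpa [Real.dist_eq] using htη) (by simpa [Real.dist_eq] using hx))
    exact this.le
  have hnear : ∀ᶠ t in 𝓝[Set.Icc 1 T] t₀, t ∈ Set.Icc 1 T ∧ |t - t₀| < η := by
    refine Filter.Eventually.and self_mem_nhdsWithin (nhdsWithin_le_nhds ?_)
    filter_upwards [Metric.ball_mem_nhds t₀ hη] with t ht
    simpa [Real.dist_eq] using ht
  filter_upwards [hnear] with t ht
  obtain ⟨htI, htη⟩ := ht
  set r₀ := r t₀ x₀
  -- The mean value inequality in `x` controls the increments of `g_t`, and then the mean value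
  -- inequality in `t` controls the second difference of `g`. Dividing by `h` and letting `h → 0`
  -- gives the derivative of `p = g_x` in `t`.
  have key : ∀ h : ℝ, |h| < η →
      |(g t (x₀ + h) - g t x₀) - (g t₀ (x₀ + h) - g t₀ x₀) - r₀ * h * (t - t₀)| ≤ ε * |h| * |t - t₀| := by
    intro h hh
    have hq' : ∀ τ ∈ Set.Icc 1 T, |τ - t₀| < η → |q τ (x₀ + h) - q τ x₀ - r₀ * h| ≤ ε * |h| := by
      intro τ hτ hτη
      have := Convex.norm_image_sub_le_of_norm_hasDerivWithin_le (f := fun x ↦ q τ x - r₀ * x)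
        (f' := fun x ↦ r τ x - r₀) (s := Metric.ball x₀ η) (C := ε) (x := x₀) (y := x₀ + h)
        (fun x _ ↦ ((hr τ hτ x).sub (by simpa using (hasDerivAt_id x).const_mul r₀)).hasDerivWithinAt)
        (fun x hx ↦ hr0 τ hτ hτη x (by simpa [Real.dist_eq] using hx)) (convex_ball _ _)
        (Metric.mem_ball_self hη) (by simpa [Real.dist_eq] using hh)
      simp only [Real.norm_eq_abs, add_sub_cancel_left] at this
      calc _ = |q τ (x₀ + h) - r₀ * (x₀ + h) - (q τ x₀ - r₀ * x₀)| := by ring_nf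
        _ ≤ _ := this
    have := Convex.norm_image_sub_le_of_norm_hasDerivWithin_le
      (f := fun τ ↦ g τ (x₀ + h) - g τ x₀ - r₀ * h * τ)
      (f' := fun τ ↦ q τ (x₀ + h) - q τ x₀ - r₀ * h) (s := Set.Icc 1 T ∩ Metric.ball t₀ η) (C := ε * |h|)
      (x := t₀) (y := t)
      (fun τ hτ ↦ ((((hq τ hτ.1 (x₀ + h)).sub (hq τ hτ.1 x₀)).sub
        (by simpa using ((hasDerivAt_id τ).const_mul (r₀ * h)).hasDerivWithinAt)).mono Set.inter_subset_left))
      (fun τ hτ ↦ hq' τ hτ.1 (by simpa [Real.dist_eq] using hτ.2)) ((convex_Icc _ _).inter (convex_ball _ _))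
      ⟨ht₀, Metric.mem_ball_self hη⟩ ⟨htI, by simpa [Real.dist_eq] using htη⟩
    simp only [Real.norm_eq_abs] at this
    calc _ = |g t (x₀ + h) - g t x₀ - r₀ * h * t - (g t₀ (x₀ + h) - g t₀ x₀ - r₀ * h * t₀)| := by ring_nf
      _ ≤ _ := this
  have hlim : Filter.Tendsto (fun h : ℝ ↦ |h⁻¹ • (g t (x₀ + h) - g t x₀) - h⁻¹ • (g t₀ (x₀ + h) - g t₀ x₀)
      - r₀ * (t - t₀)|) (𝓝[≠] 0) (𝓝 |p t x₀ - p t₀ x₀ - r₀ * (t - t₀)|) :=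
    (((hasDerivAt_iff_tendsto_slope_zero.1 (hp t htI x₀)).sub
      (hasDerivAt_iff_tendsto_slope_zero.1 (hp t₀ ht₀ x₀))).sub_const _).abs
  have hle : |p t x₀ - p t₀ x₀ - r₀ * (t - t₀)| ≤ ε * |t - t₀| := by
    refine le_of_tendsto hlim ?_
    have : ∀ᶠ h in 𝓝[≠] (0 : ℝ), h ≠ 0 ∧ |h| < η := by
      refine Filter.Eventually.and self_mem_nhdsWithin (nhdsWithin_le_nhds ?_)
      filter_upwards [Metric.ball_mem_nhds (0 : ℝ) hη] with h hh
      simpa [Real.dist_eq] using hh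
    filter_upwards [this] with h hh
    have h1 := key h hh.2
    have h2 : 0 < |h| := abs_pos.2 hh.1
    have h3 : h⁻¹ • (g t (x₀ + h) - g t x₀) - h⁻¹ • (g t₀ (x₀ + h) - g t₀ x₀) - r₀ * (t - t₀)
        = h⁻¹ * ((g t (x₀ + h) - g t x₀) - (g t₀ (x₀ + h) - g t₀ x₀) - r₀ * h * (t - t₀)) := by
      simp only [smul_eq_mul]
      field_simp [hh.1]
    rw [h3, abs_mul, abs_inv, inv_mul_le_iff₀ h2]
    linarith
  simp only [smul_eq_mul, Real.norm_eq_abs]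
  rw [mul_comm (t - t₀)]
  exact hle

end

section

/-! ### Bounds in `L^2` -/

/-- `‖f‖_{L^2} ≤ K`. -/
def L2Le (f : ℝ → ℝ) (K : ℝ) : Prop := eLpNorm f 2 volume ≤ ENNReal.ofReal K

theorem L2Le.mono {f : ℝ → ℝ} {K K' : ℝ} (h : L2Le f K) (hK : K ≤ K') : L2Le f K' :=
  h.trans (ENNReal.ofReal_le_ofReal hK)

theorem L2Le.add {f g : ℝ → ℝ} {K K' : ℝ} (hf : Continuous f) (hg : Continuous g) (h : L2Le f K) (h' : L2Le g K')
    (hK : 0 ≤ K) (hK' : 0 ≤ K') : L2Le (fun x ↦ f x + g x) (K + K') := by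
  unfold L2Le
  rw [ENNReal.ofReal_add hK hK']
  exact (eLpNorm_add_le hf.aestronglyMeasurable hg.aestronglyMeasurable (by norm_num)).trans (add_le_add h h')

theorem L2Le.neg {f : ℝ → ℝ} {K : ℝ} (h : L2Le f K) : L2Le (fun x ↦ -f x) K := by
  unfold L2Le
  have : eLpNorm (fun x ↦ -f x) 2 volume = eLpNorm f 2 volume := eLpNorm_neg f 2 volume
  rw [this]
  exact h

theorem L2Le.sub {f g : ℝ → ℝ} {K K' : ℝ} (hf : Continuous f) (hg : Continuous g) (h : L2Le f K) (h' : L2Le g K')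
    (hK : 0 ≤ K) (hK' : 0 ≤ K') : L2Le (fun x ↦ f x - g x) (K + K') := by
  simp only [sub_eq_add_neg]
  exact h.add hf hg.neg h'.neg hK hK'

theorem L2Le.zero : L2Le (fun _ ↦ 0) 0 := by
  simp [L2Le]

theorem L2Le.of_abs_le {f g : ℝ → ℝ} {K S : ℝ} (hS : 0 ≤ S) (h : L2Le g K) (hf : ∀ x, |f x| ≤ S * |g x|) :
    L2Le f (S * K) := by
  unfold L2Le
  rw [ENNReal.ofReal_mul hS]
  have := eLpNorm_le_mul_eLpNorm_of_ae_le_mul (f := f) (g := g) (c := S) (μ := volume)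
    (Filter.Eventually.of_forall hf) 2
  exact this.trans (by gcongr; exact h)

theorem L2Le.const_mul {f : ℝ → ℝ} {K : ℝ} (h : L2Le f K) (c : ℝ) : L2Le (fun x ↦ c * f x) (|c| * K) :=
  h.of_abs_le (abs_nonneg c) (fun _ ↦ (abs_mul _ _).le)

theorem L2Le.sum {ι : Type*} {s : Finset ι} {f : ι → ℝ → ℝ} {K : ι → ℝ} (hf : ∀ i ∈ s, Continuous (f i))
    (h : ∀ i ∈ s, L2Le (f i) (K i)) (hK : ∀ i ∈ s, 0 ≤ K i) :
    L2Le (fun x ↦ ∑ i ∈ s, f i x) (∑ i ∈ s, K i) := by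
  classical
  induction s using Finset.induction_on with
  | empty => simpa using L2Le.zero
  | insert a s ha ih =>
    simp only [Finset.sum_insert ha]
    apply L2Le.add (hf _ (by simp)) (continuous_finsetSum _ fun i hi ↦ hf i (by simp [hi])) (h _ (by simp))
      (ih (fun i hi ↦ hf i (by simp [hi])) (fun i hi ↦ h i (by simp [hi])) (fun i hi ↦ hK i (by simp [hi])))
      (hK _ (by simp)) (Finset.sum_nonneg fun i hi ↦ hK i (by simp [hi]))

theorem L2Le.comp_add_right {f : ℝ → ℝ} {K : ℝ} (hf : Continuous f) (h : L2Le f K) (a : ℝ) :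
    L2Le (fun x ↦ f (x + a)) K := by
  unfold L2Le
  have := eLpNorm_comp_measurePreserving (p := 2) hf.aestronglyMeasurable
    (measurePreserving_add_right (volume : Measure ℝ) a)
  have h2 : eLpNorm (fun x ↦ f (x + a)) 2 volume = eLpNorm f 2 volume := this
  rw [h2]
  exact h

theorem eLpNorm_two_sq (f : ℝ → ℝ) (μ : Measure ℝ) :
    eLpNorm f 2 μ ^ 2 = ∫⁻ x, ENNReal.ofReal (f x ^ 2) ∂μ := by
  rw [eLpNorm_eq_lintegral_rpow_enorm_toReal (by norm_num) (by norm_num)]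
  rw [← ENNReal.rpow_natCast, ← ENNReal.rpow_mul]
  simp only [ENNReal.toReal_ofNat, Nat.cast_ofNat, ENNReal.rpow_ofNat]
  norm_num
  congr 1
  ext x
  rw [← ofReal_norm, ← ENNReal.ofReal_pow (norm_nonneg _), Real.norm_eq_abs, sq_abs]

theorem L2Le.integral_sq_le {f : ℝ → ℝ} {K : ℝ} (hf : Continuous f) (hK : 0 ≤ K) (h : L2Le f K) {a b : ℝ}
    (hab : a ≤ b) : ∫ x in a..b, f x ^ 2 ≤ K ^ 2 := by
  rw [intervalIntegral.integral_of_le hab,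
    integral_eq_lintegral_of_nonneg_ae (Filter.Eventually.of_forall fun x ↦ sq_nonneg _)
      (hf.pow 2).aestronglyMeasurable]
  apply ENNReal.toReal_le_of_le_ofReal (sq_nonneg _)
  rw [← eLpNorm_two_sq f, ENNReal.ofReal_pow hK]
  gcongr
  exact (eLpNorm_mono_measure f Measure.restrict_le_self).trans h

theorem L2Le.of_integral_sq_le {f : ℝ → ℝ} {K : ℝ} (hf : Continuous f) (hK : 0 ≤ K)
    (h : ∀ r : ℝ, 0 < r → ∫ x in (-r)..r, f x ^ 2 ≤ K ^ 2) : L2Le f K := by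
  unfold L2Le
  have h2 : eLpNorm f 2 volume ^ 2 ≤ ENNReal.ofReal K ^ 2 := by
    rw [eLpNorm_two_sq f, ← ENNReal.ofReal_pow hK]
    have hmono : Monotone fun n : ℕ ↦ Set.Ioc (-(n + 1 : ℝ)) (n + 1) := by
      intro m n hmn
      have : (m : ℝ) ≤ n := by exact_mod_cast hmn
      exact Set.Ioc_subset_Ioc (by linarith) (by linarith)
    have hU : ⋃ n : ℕ, Set.Ioc (-(n + 1 : ℝ)) (n + 1) = Set.univ := by
      rw [Set.eq_univ_iff_forall]
      intro x
      obtain ⟨n, hn⟩ := exists_nat_gt |x|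
      rw [Set.mem_iUnion]
      exact ⟨n, by linarith [neg_abs_le x], by linarith [le_abs_self x]⟩
    have := setLIntegral_iUnion_of_directed (μ := (volume : Measure ℝ)) (fun x ↦ ENNReal.ofReal (f x ^ 2)) hmono.directed_le
    rw [hU, Measure.restrict_univ] at this
    rw [this]
    refine iSup_le fun n ↦ ?_
    have hn := h (n + 1) (by positivity)
    rw [intervalIntegral.integral_of_le (by linarith [(n.cast_nonneg : (0 : ℝ) ≤ n)])] at hn
    rw [← ofReal_integral_eq_lintegral_ofReal]
    · exact ENNReal.ofReal_le_ofReal hn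
    · exact ((hf.pow 2).integrableOn_Icc).mono_set Set.Ioc_subset_Icc_self
    · exact Filter.Eventually.of_forall fun x ↦ sq_nonneg _
  exact (ENNReal.pow_le_pow_left_iff (by norm_num)).1 h2

end

/-! ### Energy estimates for linear equations with variable coefficients. -/

section

/-- The energy estimate on a bounded interval, for the weight `1 - x ^ 2 / R ^ 2`. -/
theorem energy_weighted_le {T R : ℝ} (hT : 1 ≤ T) (hR : 0 < R) {e et G Gx : ℝ → ℝ → ℝ} {β : ℝ → ℝ}
    (he : IsDerivT T e et) (hec : ContStrip T e) (hetc : ContStrip T et) (hG : IsDerivX T G Gx)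
    (hGx : ContStrip T Gx) {t : ℝ} (ht : t ∈ Set.Icc 1 T) (hβ : IntervalIntegrable β volume 1 t)
    (hb : ∀ τ ∈ Set.Icc 1 t, ∫ x in (-R)..R,
      ((1 - x ^ 2 / R ^ 2) * (et τ x - Gx τ x) + 2 * x / R ^ 2 * G τ x) ≤ β τ) :
    ∫ x in (-R)..R, (1 - x ^ 2 / R ^ 2) * e t x
      ≤ (∫ x in (-R)..R, (1 - x ^ 2 / R ^ 2) * e 1 x) + ∫ τ in (1 : ℝ)..t, β τ := by
  have h1I : (1 : ℝ) ∈ Set.Icc 1 T := ⟨le_rfl, hT⟩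
  have hsub : Set.Icc 1 t ⊆ Set.Icc 1 T := Set.Icc_subset_Icc_right ht.2
  obtain ⟨E, hE, hEe⟩ := hetc.exists_extension hT
  have hχ : Continuous fun x : ℝ ↦ 1 - x ^ 2 / R ^ 2 := by fun_prop
  have hec' : ∀ τ ∈ Set.Icc 1 T, Continuous (e τ) := fun τ hτ ↦ hec.continuous hτ
  have hEu : Continuous fun q : ℝ × ℝ ↦ (1 - q.2 ^ 2 / R ^ 2) * E q.1 q.2 := by fun_prop
  have step1 : (∫ x in (-R)..R, (1 - x ^ 2 / R ^ 2) * e t x) - ∫ x in (-R)..R, (1 - x ^ 2 / R ^ 2) * e 1 x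
      = ∫ x in (-R)..R, ∫ τ in (1 : ℝ)..t, (1 - x ^ 2 / R ^ 2) * E τ x := by
    have c1 := hec' t ht
    have c2 := hec' 1 h1I
    rw [← intervalIntegral.integral_sub (Continuous.intervalIntegrable (by fun_prop) _ _)
      (Continuous.intervalIntegrable (by fun_prop) _ _)]
    congr 1
    ext x
    rw [intervalIntegral.integral_const_mul, ← mul_sub]
    congr 1
    have hEx : Continuous fun τ ↦ E τ x := hE.comp (f := fun τ : ℝ ↦ (τ, x)) (by fun_prop)
    rw [intervalIntegral.integral_eq_sub_of_hasDeriv_right_of_le (f := fun τ ↦ e τ x) ht.1]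
    · exact (hec.continuousOn_t x).mono hsub
    · intro τ hτ
      have hτI : τ ∈ Set.Icc 1 T := hsub ⟨hτ.1.le, hτ.2.le⟩
      rw [hEe τ hτI]
      refine (he τ hτI x).mono_of_mem_nhdsWithin ?_
      exact mem_nhdsWithin_of_mem_nhds (Icc_mem_nhds hτ.1 (hτ.2.trans_le ht.2))
    · exact hEx.intervalIntegrable _ _
  have step2 : (∫ x in (-R)..R, ∫ τ in (1 : ℝ)..t, (1 - x ^ 2 / R ^ 2) * E τ x)
      = ∫ τ in (1 : ℝ)..t, ∫ x in (-R)..R, (1 - x ^ 2 / R ^ 2) * E τ x := by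
    apply intervalIntegral_intervalIntegral_swap
    have hc : Continuous (Function.uncurry fun x τ ↦ (1 - x ^ 2 / R ^ 2) * E τ x) :=
      hEu.comp continuous_swap
    exact (hc.continuousOn.integrableOn_compact (isCompact_uIcc.prod isCompact_uIcc)).mono_set
      (Set.prod_mono Set.uIoc_subset_uIcc Set.uIoc_subset_uIcc)
  have step3 : (∫ τ in (1 : ℝ)..t, ∫ x in (-R)..R, (1 - x ^ 2 / R ^ 2) * E τ x) ≤ ∫ τ in (1 : ℝ)..t, β τ := by
    apply intervalIntegral.integral_mono_on ht.1 _ hβ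
    · intro τ hτ
      have hτI := hsub hτ
      refine le_trans (le_of_eq ?_) (hb τ hτ)
      have hGc : Continuous (G τ) := continuous_iff_continuousAt.2 fun x ↦ (hG τ hτI x).continuousAt
      have hGxc : Continuous (Gx τ) := hGx.continuous hτI
      have hetc' : Continuous (et τ) := hetc.continuous hτI
      -- The weight vanishes at `± R`, so the weighted flux leaves no boundary term, whatever the
      -- behaviour at infinity.
      have hQ : ∫ x in (-R)..R, ((1 - x ^ 2 / R ^ 2) * Gx τ x - 2 * x / R ^ 2 * G τ x) = 0 := by
        rw [intervalIntegral.integral_eq_sub_of_hasDerivAt (f := fun x ↦ (1 - x ^ 2 / R ^ 2) * G τ x)]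
        · field_simp; ring
        · intro x _
          have h2 : HasDerivAt (fun x : ℝ ↦ 1 - x ^ 2 / R ^ 2) (-(2 * x / R ^ 2)) x := by
            have := ((hasDerivAt_pow 2 x).div_const (R ^ 2)).const_sub 1
            simpa using this
          convert! h2.mul (hG τ hτI x) using 1
          ring
        · exact Continuous.intervalIntegrable (by fun_prop) _ _
      have : (∫ x in (-R)..R, (1 - x ^ 2 / R ^ 2) * E τ x)
          = (∫ x in (-R)..R, ((1 - x ^ 2 / R ^ 2) * (et τ x - Gx τ x) + 2 * x / R ^ 2 * G τ x))
            + ∫ x in (-R)..R, ((1 - x ^ 2 / R ^ 2) * Gx τ x - 2 * x / R ^ 2 * G τ x) := by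
        rw [← intervalIntegral.integral_add]
        · congr 1
          ext x
          rw [hEe τ hτI]
          ring
        · exact Continuous.intervalIntegrable (by fun_prop) _ _
        · exact Continuous.intervalIntegrable (by fun_prop) _ _
      rw [this, hQ, add_zero]
    · exact (intervalIntegral.continuous_parametric_intervalIntegral_of_continuous' (f := fun τ x ↦
        (1 - x ^ 2 / R ^ 2) * E τ x) hEu _ _).intervalIntegrable _ _
  linarith

/-- The data of a classical solution of `v_tt - v_xx + v = a v_tx + b v_xx + f` on the strip. -/
structure QuasilinearWave (T : ℝ) (v vt vx vtt vtx vxx a at' ax b bt bx f : ℝ → ℝ → ℝ) : Prop where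
  v_t : IsDerivT T v vt
  v_x : IsDerivX T v vx
  vt_t : IsDerivT T vt vtt
  vt_x : IsDerivX T vt vtx
  vx_t : IsDerivT T vx vtx
  vx_x : IsDerivX T vx vxx
  a_t : IsDerivT T a at'
  a_x : IsDerivX T a ax
  b_t : IsDerivT T b bt
  b_x : IsDerivX T b bx
  cont_v : ContStrip T v
  cont_vt : ContStrip T vt
  cont_vx : ContStrip T vx
  cont_vtt : ContStrip T vtt
  cont_vtx : ContStrip T vtx
  cont_vxx : ContStrip T vxx
  cont_a : ContStrip T a
  cont_ax : ContStrip T ax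
  cont_b : ContStrip T b
  cont_bt : ContStrip T bt
  cont_bx : ContStrip T bx
  cont_f : ContStrip T f
  eq : ∀ t ∈ Set.Icc 1 T, ∀ x, vtt t x - vxx t x + v t x = a t x * vtx t x + b t x * vxx t x + f t x

variable {T : ℝ} {v vt vx vtt vtx vxx a at' ax b bt bx f : ℝ → ℝ → ℝ}

/-- The first bracket is the source of the energy identity; the second is the flux against the
derivative of the weight, of size `1 / R`. The product `2 f v_t` is split with parameter `μ` because
`f` will itself carry a factor `μ` in `L^2`, so that `f ^ 2 / μ` is again of size `μ`. -/
theorem energy_density_bound {μ R x a ax b bt bx f v vt vx : ℝ} (hμ : 0 < μ) (hμ1 : μ ≤ 1 / 2) (hR : 0 < R)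
    (hx : |x| ≤ R) (ha : |a| ≤ μ) (hax : |ax| ≤ μ) (hb : |b| ≤ μ) (hbt : |bt| ≤ μ) (hbx : |bx| ≤ μ) :
    (1 - x ^ 2 / R ^ 2) * (-2 * bx * vt * vx - ax * vt ^ 2 + bt * vx ^ 2 + 2 * f * vt)
      + 2 * x / R ^ 2 * (2 * (1 + b) * vt * vx + a * vt ^ 2)
      ≤ (4 / R + 4 * μ) * (vt ^ 2 + vx ^ 2 + v ^ 2) + f ^ 2 / μ := by
  have hx2 : x ^ 2 ≤ R ^ 2 := sq_le_sq' (by linarith [neg_abs_le x]) (by linarith [le_abs_self x])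
  have hχ0 : 0 ≤ 1 - x ^ 2 / R ^ 2 := by
    rw [sub_nonneg, div_le_one (by positivity)]; exact hx2
  have hχ1 : 1 - x ^ 2 / R ^ 2 ≤ 1 := by
    have : 0 ≤ x ^ 2 / R ^ 2 := by positivity
    linarith
  have h1 : -2 * bx * vt * vx - ax * vt ^ 2 + bt * vx ^ 2 + 2 * f * vt
      ≤ 4 * μ * (vt ^ 2 + vx ^ 2 + v ^ 2) + f ^ 2 / μ := by
    have e1 : -2 * bx * vt * vx ≤ μ * (vt ^ 2 + vx ^ 2) := by
      rw [abs_le] at hbx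
      nlinarith [sq_nonneg (vt + vx), sq_nonneg (vt - vx)]
    have e2 : -ax * vt ^ 2 ≤ μ * vt ^ 2 := by
      rw [abs_le] at hax
      nlinarith [sq_nonneg vt]
    have e3 : bt * vx ^ 2 ≤ μ * vx ^ 2 := by
      rw [abs_le] at hbt
      nlinarith [sq_nonneg vx]
    have e4 : 2 * f * vt ≤ μ * vt ^ 2 + f ^ 2 / μ := by
      have : μ * vt ^ 2 + f ^ 2 / μ - 2 * f * vt = (μ * vt - f) ^ 2 / μ := by field_simp; ring
      have : 0 ≤ (μ * vt - f) ^ 2 / μ := by positivity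
      linarith
    nlinarith [sq_nonneg v, sq_nonneg vt, sq_nonneg vx, mul_nonneg hμ.le (sq_nonneg v),
      mul_nonneg hμ.le (sq_nonneg vt), mul_nonneg hμ.le (sq_nonneg vx)]
  have hpos : 0 ≤ 4 * μ * (vt ^ 2 + vx ^ 2 + v ^ 2) + f ^ 2 / μ := by positivity
  have h2 : (1 - x ^ 2 / R ^ 2) * (-2 * bx * vt * vx - ax * vt ^ 2 + bt * vx ^ 2 + 2 * f * vt)
      ≤ 4 * μ * (vt ^ 2 + vx ^ 2 + v ^ 2) + f ^ 2 / μ :=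
    (mul_le_mul_of_nonneg_left h1 hχ0).trans (mul_le_of_le_one_left hpos hχ1)
  have hG : |2 * (1 + b) * vt * vx + a * vt ^ 2| ≤ 2 * (vt ^ 2 + vx ^ 2 + v ^ 2) := by
    rw [abs_le] at ha hb ⊢
    constructor <;> nlinarith [sq_nonneg (vt + vx), sq_nonneg (vt - vx), sq_nonneg v, sq_nonneg vt, sq_nonneg vx]
  have h3 : 2 * x / R ^ 2 * (2 * (1 + b) * vt * vx + a * vt ^ 2) ≤ 4 / R * (vt ^ 2 + vx ^ 2 + v ^ 2) := by
    refine (le_abs_self _).trans ?_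
    rw [abs_mul]
    have : |2 * x / R ^ 2| ≤ 2 / R := by
      rw [abs_div, abs_mul, abs_of_nonneg (by positivity : 0 ≤ R ^ 2), abs_two, div_le_div_iff₀ (by positivity) hR]
      nlinarith
    calc _ ≤ 2 / R * (2 * (vt ^ 2 + vx ^ 2 + v ^ 2)) := by gcongr
      _ = _ := by ring
  linarith

/-- With density `e = v_t ^ 2 + (1 + b) v_x ^ 2 + v ^ 2` and flux `G = 2 (1 + b) v_t v_x + a v_t ^
2`, the equation gives `e_t - G_x = 2 f v_t + b_t v_x ^ 2 - a_x v_t ^ 2 - 2 b_x v_t v_x`, free of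
second derivatives. The a priori bounds make its integral `O(δ κ ^ 2 τ ^ (2 σ - 1))`, up to the
error `O(1 / R)` from the weight. -/
theorem QuasilinearWave.local_energy_le (hv : QuasilinearWave T v vt vx vtt vtx vxx a at' ax b bt bx f)
    (hT : 1 ≤ T) {σ δ κ κ₁ : ℝ} (hσ : 0 < σ) (hδ : 0 < δ) (hδ2 : δ ≤ 1 / 2) (hκ : 0 ≤ κ) (hκ₁ : 0 ≤ κ₁)
    (hvb : ∀ t ∈ Set.Icc 1 T, L2Le (v t) (κ * t ^ σ)) (hvtb : ∀ t ∈ Set.Icc 1 T, L2Le (vt t) (κ * t ^ σ))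
    (hvxb : ∀ t ∈ Set.Icc 1 T, L2Le (vx t) (κ * t ^ σ))
    (hfb : ∀ t ∈ Set.Icc 1 T, L2Le (f t) (δ / t * (κ * t ^ σ)))
    (ha : ∀ t ∈ Set.Icc 1 T, ∀ x, |a t x| ≤ δ / t) (hax : ∀ t ∈ Set.Icc 1 T, ∀ x, |ax t x| ≤ δ / t)
    (hb : ∀ t ∈ Set.Icc 1 T, ∀ x, |b t x| ≤ δ / t) (hbt : ∀ t ∈ Set.Icc 1 T, ∀ x, |bt t x| ≤ δ / t)
    (hbx : ∀ t ∈ Set.Icc 1 T, ∀ x, |bx t x| ≤ δ / t)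
    (h1 : L2Le (v 1) κ₁) (h1t : L2Le (vt 1) κ₁) (h1x : L2Le (vx 1) κ₁)
    {t : ℝ} (ht : t ∈ Set.Icc 1 T) {R : ℝ} (hR : 0 < R) :
    ∫ x in (-(R / 2))..(R / 2), (vt t x ^ 2 + vx t x ^ 2 + v t x ^ 2)
      ≤ 12 * κ₁ ^ 2 + 18 * δ * κ ^ 2 * t ^ (2 * σ) / σ + 32 * κ ^ 2 * T ^ (2 * σ) * T / R := by
  have h1I : (1 : ℝ) ∈ Set.Icc 1 T := ⟨le_rfl, hT⟩
  have hsub : Set.Icc 1 t ⊆ Set.Icc 1 T := Set.Icc_subset_Icc_right ht.2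
  set e : ℝ → ℝ → ℝ := fun t x ↦ vt t x * vt t x + (vx t x * vx t x + b t x * (vx t x * vx t x)) + v t x * v t x
  set et : ℝ → ℝ → ℝ := fun t x ↦ (vtt t x * vt t x + vt t x * vtt t x)
    + ((vtx t x * vx t x + vx t x * vtx t x)
      + (bt t x * (vx t x * vx t x) + b t x * (vtx t x * vx t x + vx t x * vtx t x)))
    + (vt t x * v t x + v t x * vt t x)
  set G : ℝ → ℝ → ℝ := fun t x ↦ 2 * (vt t x * vx t x + b t x * (vt t x * vx t x)) + a t x * (vt t x * vt t x)
  set Gx : ℝ → ℝ → ℝ := fun t x ↦ 2 * ((vtx t x * vx t x + vt t x * vxx t x)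
      + (bx t x * (vt t x * vx t x) + b t x * (vtx t x * vx t x + vt t x * vxx t x)))
    + (ax t x * (vt t x * vt t x) + a t x * (vtx t x * vt t x + vt t x * vtx t x))
  have he : IsDerivT T e et :=
    ((hv.vt_t.mul hv.vt_t).add ((hv.vx_t.mul hv.vx_t).add (hv.b_t.mul (hv.vx_t.mul hv.vx_t)))).add
      (hv.v_t.mul hv.v_t)
  have hG : IsDerivX T G Gx :=
    (((hv.vt_x.mul hv.vx_x).add (hv.b_x.mul (hv.vt_x.mul hv.vx_x))).const_mul 2).add
      (hv.a_x.mul (hv.vt_x.mul hv.vt_x))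
  obtain ⟨-, -, -, -, -, -, -, -, -, -, c0, c1, c2, c3, c4, c5, c6, c7, c8, c9, c10, c11, heq⟩ := hv
  have hec : ContStrip T e := ((c1.mul c1).add ((c2.mul c2).add (c8.mul (c2.mul c2)))).add (c0.mul c0)
  have hetc : ContStrip T et := (((c3.mul c1).add (c1.mul c3)).add (((c4.mul c2).add (c2.mul c4)).add
    ((c9.mul (c2.mul c2)).add (c8.mul ((c4.mul c2).add (c2.mul c4)))))).add ((c1.mul c0).add (c0.mul c1))
  have hGxc : ContStrip T Gx := ((((c4.mul c2).add (c1.mul c5)).add ((c10.mul (c1.mul c2)).add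
    (c8.mul ((c4.mul c2).add (c1.mul c5))))).const_mul 2).add
    ((c7.mul (c1.mul c1)).add (c6.mul ((c4.mul c1).add (c1.mul c4))))
  have hb12 : ∀ τ ∈ Set.Icc 1 T, δ / τ ≤ 1 / 2 := by
    intro τ hτ
    have : δ / τ ≤ δ := div_le_self hδ.le hτ.1
    linarith
  have hs : ∀ τ ∈ Set.Icc 1 T, ∀ r s : ℝ, r ≤ s →
      ∫ x in r..s, (vt τ x ^ 2 + vx τ x ^ 2 + v τ x ^ 2) ≤ 3 * (κ * τ ^ σ) ^ 2 := by
    intro τ hτ r s hrs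
    have hτ0 : (0 : ℝ) ≤ τ := by linarith [hτ.1]
    have k0 : 0 ≤ κ * τ ^ σ := by positivity
    have d1 := (hvtb τ hτ).integral_sq_le (c1.continuous hτ) k0 hrs
    have d2 := (hvxb τ hτ).integral_sq_le (c2.continuous hτ) k0 hrs
    have d3 := (hvb τ hτ).integral_sq_le (c0.continuous hτ) k0 hrs
    rw [intervalIntegral.integral_add, intervalIntegral.integral_add]
    · linarith
    all_goals
      have := c0.continuous hτ
      have := c1.continuous hτ
      have := c2.continuous hτ
      exact Continuous.intervalIntegrable (by fun_prop) _ _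
  -- The coefficient `4 / R + 4 δ / τ` of `energy_density_bound` multiplies three squared norms,
  -- which gives `12 / R` and `12 δ / τ`; the source `f` adds one more `δ / τ`.
  set β : ℝ → ℝ := fun τ ↦ 12 * κ ^ 2 * T ^ (2 * σ) / R + 13 * δ * κ ^ 2 * τ ^ (2 * σ - 1)
  have hsq : ∀ τ ∈ Set.Icc 1 T, (τ ^ σ) ^ 2 = τ ^ (2 * σ) := by
    intro τ hτ
    rw [← Real.rpow_natCast, ← Real.rpow_mul (by linarith [hτ.1])]
    congr 1; push_cast; ring
  have hβc : IntervalIntegrable β volume 1 t := by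
    apply ContinuousOn.intervalIntegrable
    rw [Set.uIcc_of_le ht.1]
    refine continuousOn_const.add (continuousOn_const.mul ?_)
    exact continuousOn_id.rpow_const fun τ hτ ↦ Or.inl (by simp only [id]; linarith [hτ.1])
  have main := energy_weighted_le hT hR he hec hetc hG hGxc ht hβc (by
    intro τ hτ
    have hτI := hsub hτ
    have hτ0 : 0 < τ := by linarith [hτ.1]
    have hμ : 0 < δ / τ := by positivity
    have cc0 := c0.continuous hτI
    have cc1 := c1.continuous hτI
    have cc2 := c2.continuous hτI
    have ccf := c11.continuous hτI
    have ccG : Continuous (G τ) := continuous_iff_continuousAt.2 fun x ↦ (hG τ hτI x).continuousAt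
    have ccGx := hGxc.continuous hτI
    have ccet := hetc.continuous hτI
    have hle : ∫ x in (-R)..R, ((1 - x ^ 2 / R ^ 2) * (et τ x - Gx τ x) + 2 * x / R ^ 2 * G τ x)
        ≤ ∫ x in (-R)..R, ((4 / R + 4 * (δ / τ)) * (vt τ x ^ 2 + vx τ x ^ 2 + v τ x ^ 2) + f τ x ^ 2 * (δ / τ)⁻¹) := by
      apply intervalIntegral.integral_mono_on (by linarith)
      · exact Continuous.intervalIntegrable (by fun_prop) _ _
      · exact Continuous.intervalIntegrable (by fun_prop) _ _
      · intro x hx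
        have hxR : |x| ≤ R := abs_le.2 hx
        have key := energy_density_bound (f := f τ x) (v := v τ x) (vt := vt τ x) (vx := vx τ x) hμ
          (hb12 τ hτI) hR hxR (ha τ hτI x) (hax τ hτI x) (hb τ hτI x) (hbt τ hτI x) (hbx τ hτI x)
        have q := heq τ hτI x
        have e1 : et τ x - Gx τ x = -2 * bx τ x * vt τ x * vx τ x - ax τ x * vt τ x ^ 2 + bt τ x * vx τ x ^ 2
            + 2 * f τ x * vt τ x := by
          have : vtt τ x = vxx τ x - v τ x + a τ x * vtx τ x + b τ x * vxx τ x + f τ x := by linarith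
          simp only [et, Gx, this]
          ring
        have e2 : G τ x = 2 * (1 + b τ x) * vt τ x * vx τ x + a τ x * vt τ x ^ 2 := by
          simp only [G]; ring
        rw [e1, e2]
        rw [div_eq_mul_inv (f τ x ^ 2)] at key
        exact key
    refine hle.trans ?_
    have k0 : 0 ≤ κ * τ ^ σ := by positivity
    rw [intervalIntegral.integral_add (Continuous.intervalIntegrable (by fun_prop) _ _)
      (Continuous.intervalIntegrable (by fun_prop) _ _), intervalIntegral.integral_const_mul,
      intervalIntegral.integral_mul_const]
    have d1 := hs τ hτI (-R) R (by linarith)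
    have d2 := (hfb τ hτI).integral_sq_le ccf (by positivity) (show -R ≤ R by linarith)
    have d3 : τ ^ (2 * σ) ≤ T ^ (2 * σ) := Real.rpow_le_rpow hτ0.le hτI.2 (by linarith)
    calc _ ≤ (4 / R + 4 * (δ / τ)) * (3 * (κ * τ ^ σ) ^ 2) + (δ / τ * (κ * τ ^ σ)) ^ 2 * (δ / τ)⁻¹ := by
          gcongr
      _ = 12 * κ ^ 2 * τ ^ (2 * σ) / R + 13 * δ * κ ^ 2 * (τ ^ (2 * σ) / τ) := by
          rw [mul_pow, mul_pow, mul_pow, hsq τ hτI]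
          field_simp
          ring
      _ ≤ β τ := by
          simp only [β]
          rw [Real.rpow_sub_one hτ0.ne']
          gcongr)
  have hI : ∫ τ in (1 : ℝ)..t, β τ ≤ 12 * κ ^ 2 * T ^ (2 * σ) * T / R + 13 / 2 * δ * κ ^ 2 * t ^ (2 * σ) / σ := by
    have hint : IntervalIntegrable (fun τ : ℝ ↦ τ ^ (2 * σ - 1)) volume 1 t := by
      apply intervalIntegral.intervalIntegrable_rpow'
      linarith
    rw [intervalIntegral.integral_add (by simp) (hint.const_mul _), intervalIntegral.integral_const,
      intervalIntegral.integral_const_mul, integral_rpow (Or.inl (by linarith))]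
    simp only [smul_eq_mul, sub_add_cancel, Real.one_rpow]
    have h5 : (t - 1) * (12 * κ ^ 2 * T ^ (2 * σ) / R) ≤ 12 * κ ^ 2 * T ^ (2 * σ) * T / R := by
      have : t - 1 ≤ T := by linarith [ht.2]
      calc _ ≤ T * (12 * κ ^ 2 * T ^ (2 * σ) / R) := by gcongr
        _ = _ := by ring
    have h6 : 13 * δ * κ ^ 2 * ((t ^ (2 * σ) - 1) / (2 * σ)) ≤ 13 / 2 * δ * κ ^ 2 * t ^ (2 * σ) / σ := by
      calc _ ≤ 13 * δ * κ ^ 2 * (t ^ (2 * σ) / (2 * σ)) := by gcongr; linarith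
        _ = _ := by field_simp
    linarith
  have cc0 := c0.continuous ht
  have cc1 := c1.continuous ht
  have cc2 := c2.continuous ht
  have cce := hec.continuous ht
  have cce1 := hec.continuous h1I
  have hinit : ∫ x in (-R)..R, (1 - x ^ 2 / R ^ 2) * e 1 x ≤ 9 / 2 * κ₁ ^ 2 := by
    have f0 := c0.continuous h1I
    have f1 := c1.continuous h1I
    have f2 := c2.continuous h1I
    have hle : ∫ x in (-R)..R, (1 - x ^ 2 / R ^ 2) * e 1 x
        ≤ ∫ x in (-R)..R, 3 / 2 * (vt 1 x ^ 2 + vx 1 x ^ 2 + v 1 x ^ 2) := by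
      apply intervalIntegral.integral_mono_on (by linarith)
      · exact Continuous.intervalIntegrable (by fun_prop) _ _
      · exact Continuous.intervalIntegrable (by fun_prop) _ _
      · intro x hx
        have hx2 : x ^ 2 ≤ R ^ 2 := sq_le_sq' hx.1 hx.2
        have hχ1 : 1 - x ^ 2 / R ^ 2 ≤ 1 := by
          have : 0 ≤ x ^ 2 / R ^ 2 := by positivity
          linarith
        have hb1 := abs_le.1 ((hb 1 h1I x).trans (hb12 1 h1I))
        have he0 : 0 ≤ e 1 x := by
          simp only [e]
          nlinarith [mul_self_nonneg (vt 1 x), mul_self_nonneg (vx 1 x), mul_self_nonneg (v 1 x)]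
        refine (mul_le_of_le_one_left he0 hχ1).trans ?_
        simp only [e]
        nlinarith [mul_self_nonneg (vt 1 x), mul_self_nonneg (vx 1 x), mul_self_nonneg (v 1 x)]
    refine hle.trans ?_
    rw [intervalIntegral.integral_const_mul, intervalIntegral.integral_add (Continuous.intervalIntegrable (by fun_prop) _ _)
      (Continuous.intervalIntegrable (by fun_prop) _ _), intervalIntegral.integral_add
      (Continuous.intervalIntegrable (by fun_prop) _ _) (Continuous.intervalIntegrable (by fun_prop) _ _)]
    have d1 := h1t.integral_sq_le f1 hκ₁ (show -R ≤ R by linarith)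
    have d2 := h1x.integral_sq_le f2 hκ₁ (show -R ≤ R by linarith)
    have d3 := h1.integral_sq_le f0 hκ₁ (show -R ≤ R by linarith)
    linarith
  -- The factor `3 / 8` is `1 / 2`, from `|b| ≤ 1 / 2`, times `3 / 4`, the minimum of the weight on
  -- `|x| ≤ R / 2`.
  have hfin : 3 / 8 * ∫ x in (-(R / 2))..(R / 2), (vt t x ^ 2 + vx t x ^ 2 + v t x ^ 2)
      ≤ ∫ x in (-R)..R, (1 - x ^ 2 / R ^ 2) * e t x := by
    have hpos : ∀ x ∈ Set.Icc (-R) R, 1 / 2 * (1 - x ^ 2 / R ^ 2) * (vt t x ^ 2 + vx t x ^ 2 + v t x ^ 2)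
        ≤ (1 - x ^ 2 / R ^ 2) * e t x ∧ 0 ≤ 1 - x ^ 2 / R ^ 2 := by
      intro x hx
      have hx2 : x ^ 2 ≤ R ^ 2 := sq_le_sq' hx.1 hx.2
      have hχ0 : 0 ≤ 1 - x ^ 2 / R ^ 2 := by
        rw [sub_nonneg, div_le_one (by positivity)]; exact hx2
      refine ⟨?_, hχ0⟩
      have hb1 := abs_le.1 ((hb t ht x).trans (hb12 t ht))
      have : 1 / 2 * (vt t x ^ 2 + vx t x ^ 2 + v t x ^ 2) ≤ e t x := by
        simp only [e]
        nlinarith [mul_self_nonneg (vt t x), mul_self_nonneg (vx t x), mul_self_nonneg (v t x)]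
      calc _ = (1 - x ^ 2 / R ^ 2) * (1 / 2 * (vt t x ^ 2 + vx t x ^ 2 + v t x ^ 2)) := by ring
        _ ≤ _ := by gcongr
    calc 3 / 8 * ∫ x in (-(R / 2))..(R / 2), (vt t x ^ 2 + vx t x ^ 2 + v t x ^ 2)
        = ∫ x in (-(R / 2))..(R / 2), 3 / 8 * (vt t x ^ 2 + vx t x ^ 2 + v t x ^ 2) := by
          rw [intervalIntegral.integral_const_mul]
      _ ≤ ∫ x in (-(R / 2))..(R / 2), 1 / 2 * (1 - x ^ 2 / R ^ 2) * (vt t x ^ 2 + vx t x ^ 2 + v t x ^ 2) := by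
          apply intervalIntegral.integral_mono_on (by linarith)
          · exact Continuous.intervalIntegrable (by fun_prop) _ _
          · exact Continuous.intervalIntegrable (by fun_prop) _ _
          · intro x hx
            have hx2 : x ^ 2 ≤ (R / 2) ^ 2 := sq_le_sq' hx.1 hx.2
            have : x ^ 2 / R ^ 2 ≤ 1 / 4 := by
              rw [div_le_iff₀ (by positivity)]; linarith
            gcongr
            linarith
      _ ≤ ∫ x in (-R)..R, 1 / 2 * (1 - x ^ 2 / R ^ 2) * (vt t x ^ 2 + vx t x ^ 2 + v t x ^ 2) := by
          apply intervalIntegral.integral_mono_interval (by linarith) (by linarith) (by linarith)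
          · rw [Filter.EventuallyLE, ae_restrict_iff' measurableSet_Ioc]
            refine Filter.Eventually.of_forall fun x hx ↦ ?_
            have := (hpos x ⟨hx.1.le, hx.2⟩).2
            simp only [Pi.zero_apply]
            positivity
          · exact Continuous.intervalIntegrable (by fun_prop) _ _
      _ ≤ _ := by
          apply intervalIntegral.integral_mono_on (by linarith)
          · exact Continuous.intervalIntegrable (by fun_prop) _ _
          · exact Continuous.intervalIntegrable (by fun_prop) _ _
          · intro x hx
            exact (hpos x hx).1
  have hnn : 0 ≤ δ * κ ^ 2 * t ^ (2 * σ) / σ := by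
    have : 0 ≤ t := by linarith [ht.1]
    positivity
  -- After multiplication by `8 / 3`, the constants `9 / 2`, `13 / 2` and `12` become `12`, at most
  -- `18`, and `32`.
  have r1 : 13 / 2 * δ * κ ^ 2 * t ^ (2 * σ) / σ = 13 / 2 * (δ * κ ^ 2 * t ^ (2 * σ) / σ) := by ring
  have r2 : 18 * δ * κ ^ 2 * t ^ (2 * σ) / σ = 18 * (δ * κ ^ 2 * t ^ (2 * σ) / σ) := by ring
  have r3 : 32 * κ ^ 2 * T ^ (2 * σ) * T / R = 8 / 3 * (12 * κ ^ 2 * T ^ (2 * σ) * T / R) := by ring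
  rw [r2, r3]
  rw [r1] at hI
  linarith

/-- The energy estimate, with the a priori bound inserted in its right-hand side. -/
theorem QuasilinearWave.energy_le (hv : QuasilinearWave T v vt vx vtt vtx vxx a at' ax b bt bx f)
    (hT : 1 ≤ T) {σ δ κ κ₁ : ℝ} (hσ : 0 < σ) (hδ : 0 < δ) (hδ2 : δ ≤ 1 / 2) (hκ : 0 ≤ κ) (hκ₁ : 0 ≤ κ₁)
    (hvb : ∀ t ∈ Set.Icc 1 T, L2Le (v t) (κ * t ^ σ)) (hvtb : ∀ t ∈ Set.Icc 1 T, L2Le (vt t) (κ * t ^ σ))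
    (hvxb : ∀ t ∈ Set.Icc 1 T, L2Le (vx t) (κ * t ^ σ))
    (hfb : ∀ t ∈ Set.Icc 1 T, L2Le (f t) (δ / t * (κ * t ^ σ)))
    (ha : ∀ t ∈ Set.Icc 1 T, ∀ x, |a t x| ≤ δ / t) (hax : ∀ t ∈ Set.Icc 1 T, ∀ x, |ax t x| ≤ δ / t)
    (hb : ∀ t ∈ Set.Icc 1 T, ∀ x, |b t x| ≤ δ / t) (hbt : ∀ t ∈ Set.Icc 1 T, ∀ x, |bt t x| ≤ δ / t)
    (hbx : ∀ t ∈ Set.Icc 1 T, ∀ x, |bx t x| ≤ δ / t)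
    (h1 : L2Le (v 1) κ₁) (h1t : L2Le (vt 1) κ₁) (h1x : L2Le (vx 1) κ₁)
    {t : ℝ} (ht : t ∈ Set.Icc 1 T) {K : ℝ} (hK : 0 ≤ K)
    (hKb : 12 * κ₁ ^ 2 + 18 * δ * κ ^ 2 * t ^ (2 * σ) / σ ≤ K ^ 2) :
    L2Le (v t) K ∧ L2Le (vt t) K ∧ L2Le (vx t) K := by
  have c0 := hv.cont_v.continuous ht
  have c1 := hv.cont_vt.continuous ht
  have c2 := hv.cont_vx.continuous ht
  have key : ∀ r : ℝ, 0 < r → ∫ x in (-r)..r, (vt t x ^ 2 + vx t x ^ 2 + v t x ^ 2) ≤ K ^ 2 := by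
    intro r hr
    -- With `r` fixed and `R → ∞`, the error due to the weight disappears.
    have hlim : Filter.Tendsto (fun R : ℝ ↦ K ^ 2 + 32 * κ ^ 2 * T ^ (2 * σ) * T / R) Filter.atTop
        (𝓝 (K ^ 2 + 0)) :=
      tendsto_const_nhds.add (tendsto_const_nhds.div_atTop Filter.tendsto_id)
    rw [add_zero] at hlim
    refine ge_of_tendsto hlim ?_
    filter_upwards [Filter.eventually_ge_atTop (2 * r)] with R hR
    have hR0 : 0 < R := by linarith
    have h2 := hv.local_energy_le hT hσ hδ hδ2 hκ hκ₁ hvb hvtb hvxb hfb ha hax hb hbt hbx h1 h1t h1x ht hR0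
    refine le_trans ?_ (h2.trans (by linarith))
    apply intervalIntegral.integral_mono_interval (by linarith) (by linarith) (by linarith)
    · exact Filter.Eventually.of_forall fun x ↦ by simp only [Pi.zero_apply]; positivity
    · exact Continuous.intervalIntegrable (by fun_prop) _ _
  refine ⟨L2Le.of_integral_sq_le c0 hK fun r hr ↦ ?_, L2Le.of_integral_sq_le c1 hK fun r hr ↦ ?_,
    L2Le.of_integral_sq_le c2 hK fun r hr ↦ ?_⟩
  all_goals
    refine le_trans ?_ (key r hr)
    apply intervalIntegral.integral_mono_on (by linarith)
    · exact Continuous.intervalIntegrable (by fun_prop) _ _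
    · exact Continuous.intervalIntegrable (by fun_prop) _ _
    · intro x _
      nlinarith [sq_nonneg (v t x), sq_nonneg (vt t x), sq_nonneg (vx t x)]

end

section

/-! ### Difference quotients of derivatives -/

/-- The translation `f (x + h)` for `k = 0`, the difference quotient of `f ^ (k - 1)` for `k ≥ 1`. -/
def diffOp (k : ℕ) (h : ℝ) (f : ℝ → ℝ) : ℝ → ℝ :=
  match k with
  | 0 => fun x ↦ f (x + h)
  | k + 1 => fun x ↦ h⁻¹ * (iteratedDeriv k f (x + h) - iteratedDeriv k f x)

theorem hasDerivAt_iteratedDeriv {n : ℕ} {f : ℝ → ℝ} (hf : ContDiff ℝ (n + 1 : ℕ) f) (x : ℝ) :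
    HasDerivAt (iteratedDeriv n f) (iteratedDeriv (n + 1) f x) x := by
  rw [iteratedDeriv_succ]
  exact ((hf.differentiable_iteratedDeriv' n) x).hasDerivAt

/-- The quotient is the mean of `f' (x + θ h)` over `θ ∈ [0, 1]`. Its square is at most the mean of
the squares, since a variance is nonnegative, and Fubini with translation invariance concludes. -/
theorem L2Le.difference_quotient {f f' : ℝ → ℝ} {K : ℝ} (hf : ∀ x, HasDerivAt f (f' x) x) (hc : Continuous f')
    (hK : 0 ≤ K) (h2 : L2Le f' K) {h : ℝ} (hh : h ≠ 0) : L2Le (fun x ↦ h⁻¹ * (f (x + h) - f x)) K := by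
  have hfc : Continuous f := continuous_iff_continuousAt.2 fun x ↦ (hf x).continuousAt
  refine L2Le.of_integral_sq_le (by fun_prop) hK fun r hr ↦ ?_
  have hrep : ∀ x, h⁻¹ * (f (x + h) - f x) = ∫ θ in (0 : ℝ)..1, f' (x + θ * h) := by
    intro x
    have : ∫ θ in (0 : ℝ)..1, f' (x + θ * h) = ∫ θ in (0 : ℝ)..1, h⁻¹ * (f' (x + θ * h) * h) := by
      congr 1; ext θ; field_simp
    rw [this, intervalIntegral.integral_const_mul,
      intervalIntegral.integral_eq_sub_of_hasDerivAt (f := fun θ ↦ f (x + θ * h))]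
    · simp
    · intro θ _
      have h3 : HasDerivAt (fun θ : ℝ ↦ x + θ * h) h θ := by
        simpa using ((hasDerivAt_id θ).mul_const h).const_add x
      exact (hf (x + θ * h)).comp θ h3
    · exact Continuous.intervalIntegrable (by fun_prop) _ _
  have hJ : ∀ x, (h⁻¹ * (f (x + h) - f x)) ^ 2 ≤ ∫ θ in (0 : ℝ)..1, f' (x + θ * h) ^ 2 := by
    intro x
    rw [hrep x]
    set c := ∫ θ in (0 : ℝ)..1, f' (x + θ * h)
    have h0 : 0 ≤ ∫ θ in (0 : ℝ)..1, (f' (x + θ * h) - c) ^ 2 :=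
      intervalIntegral.integral_nonneg zero_le_one fun θ _ ↦ sq_nonneg _
    have h1 : ∫ θ in (0 : ℝ)..1, (f' (x + θ * h) - c) ^ 2
        = (∫ θ in (0 : ℝ)..1, f' (x + θ * h) ^ 2) - c ^ 2 := by
      have : ∀ θ : ℝ, (f' (x + θ * h) - c) ^ 2 = f' (x + θ * h) ^ 2 - (2 * c * f' (x + θ * h) - c ^ 2) := by
        intro θ; ring
      simp_rw [this]
      rw [intervalIntegral.integral_sub (Continuous.intervalIntegrable (by fun_prop) _ _)
        (Continuous.intervalIntegrable (by fun_prop) _ _), intervalIntegral.integral_sub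
        (Continuous.intervalIntegrable (by fun_prop) _ _) (Continuous.intervalIntegrable (by fun_prop) _ _),
        intervalIntegral.integral_const_mul, intervalIntegral.integral_const]
      simp only [smul_eq_mul]
      change _ - (2 * c * c - _) = _
      ring
    linarith
  calc ∫ x in (-r)..r, (h⁻¹ * (f (x + h) - f x)) ^ 2
      ≤ ∫ x in (-r)..r, ∫ θ in (0 : ℝ)..1, f' (x + θ * h) ^ 2 := by
        apply intervalIntegral.integral_mono_on (by linarith)
        · exact Continuous.intervalIntegrable (by fun_prop) _ _
        · exact (intervalIntegral.continuous_parametric_intervalIntegral_of_continuous'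
            (f := fun x θ ↦ f' (x + θ * h) ^ 2) (by fun_prop) 0 1).intervalIntegrable _ _
        · intro x _
          exact hJ x
    _ = ∫ θ in (0 : ℝ)..1, ∫ x in (-r)..r, f' (x + θ * h) ^ 2 := by
        apply intervalIntegral_intervalIntegral_swap
        have hcu : Continuous (Function.uncurry fun x θ ↦ f' (x + θ * h) ^ 2) := by fun_prop
        exact (hcu.continuousOn.integrableOn_compact (isCompact_uIcc.prod isCompact_uIcc)).mono_set
          (Set.prod_mono Set.uIoc_subset_uIcc Set.uIoc_subset_uIcc)
    _ ≤ ∫ θ in (0 : ℝ)..1, K ^ 2 := by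
        apply intervalIntegral.integral_mono_on zero_le_one
        · exact (intervalIntegral.continuous_parametric_intervalIntegral_of_continuous'
            (f := fun θ x ↦ f' (x + θ * h) ^ 2) (by fun_prop) (-r) r).intervalIntegrable _ _
        · simp
        · intro θ _
          exact (h2.comp_add_right hc (θ * h)).integral_sq_le (by fun_prop) hK (by linarith)
    _ = K ^ 2 := by simp

theorem abs_difference_quotient_le {f f' : ℝ → ℝ} {S : ℝ} (hf : ∀ x, HasDerivAt f (f' x) x)
    (hS : ∀ x, |f' x| ≤ S) {h : ℝ} (hh : h ≠ 0) (x : ℝ) : |h⁻¹ * (f (x + h) - f x)| ≤ S := by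
  have := Convex.norm_image_sub_le_of_norm_hasDerivWithin_le (f := f) (f' := f') (s := Set.univ) (C := S)
    (x := x) (y := x + h) (fun y _ ↦ (hf y).hasDerivWithinAt) (fun y _ ↦ hS y) convex_univ
    (Set.mem_univ _) (Set.mem_univ _)
  rw [Real.norm_eq_abs, Real.norm_eq_abs, add_sub_cancel_left] at this
  rw [abs_mul, abs_inv, inv_mul_le_iff₀ (abs_pos.2 hh)]
  linarith

/-- `A` behaves like a derivative of order `n`: it is bounded by `E` in `L^2`, and by `S` if `n ≤ M`. -/
structure Tame (S E : ℝ) (M n : ℕ) (A : ℝ → ℝ) : Prop where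
  cont : Continuous A
  l2 : L2Le A E
  sup : n ≤ M → ∀ x, |A x| ≤ S

variable {S E : ℝ} {M : ℕ}

theorem Tame.comp_add_right {n : ℕ} {A : ℝ → ℝ} (hA : Tame S E M n A) (h : ℝ) :
    Tame S E M n (fun x ↦ A (x + h)) :=
  ⟨hA.cont.comp (by fun_prop), hA.l2.comp_add_right hA.cont h, fun hn x ↦ hA.sup hn _⟩

theorem Tame.difference_quotient {n : ℕ} {f f' : ℝ → ℝ} (hf : ∀ x, HasDerivAt f (f' x) x) (hE : 0 ≤ E)
    (h' : Tame S E M n f') {h : ℝ} (hh : h ≠ 0) : Tame S E M n (fun x ↦ h⁻¹ * (f (x + h) - f x)) := by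
  have hfc : Continuous f := continuous_iff_continuousAt.2 fun x ↦ (hf x).continuousAt
  exact ⟨by fun_prop, L2Le.difference_quotient hf h'.cont hE h'.l2 hh,
    fun hn x ↦ abs_difference_quotient_le hf (h'.sup hn) hh x⟩

/-- At most one of the three orders exceeds `M`. That factor is measured in `L^2` and the other two
in the sup norm. -/
theorem Tame.mul_mul {a b c : ℕ} {A B C : ℝ → ℝ} (hS : 0 ≤ S) (hA : Tame S E M a A)
    (hB : Tame S E M b B) (hC : Tame S E M c C) (h : a + b + c ≤ 2 * M + 1) :
    L2Le (fun x ↦ A x * (B x * C x)) (S * S * E) := by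
  have hSS : 0 ≤ S * S := by positivity
  by_cases hb : b ≤ M
  · by_cases hc : c ≤ M
    · refine hA.l2.of_abs_le hSS fun x ↦ ?_
      rw [abs_mul, abs_mul, mul_comm]
      gcongr
      exacts [hB.sup hb x, hC.sup hc x]
    · have ha : a ≤ M := by omega
      refine hC.l2.of_abs_le hSS fun x ↦ ?_
      rw [abs_mul, abs_mul, ← mul_assoc]
      gcongr
      exacts [hA.sup ha x, hB.sup hb x]
  · have ha : a ≤ M := by omega
    have hc : c ≤ M := by omega
    refine hB.l2.of_abs_le hSS fun x ↦ ?_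
    rw [abs_mul, abs_mul, mul_comm |B x|, ← mul_assoc]
    gcongr
    exacts [hA.sup ha x, hC.sup hc x]

/-- The constant of the Leibniz estimate below. -/
def leibnizConst (k : ℕ) : ℝ :=
  2 + ∑ m ∈ Finset.range (k - 1), ∑ p ∈ Finset.range (k - 1 - m + 1),
    3 * (((k - 1).choose m : ℝ) * ((k - 1 - m).choose p : ℝ))

theorem leibnizConst_nonneg (k : ℕ) : 0 ≤ leibnizConst k := by
  unfold leibnizConst
  positivity

theorem iteratedDeriv_mul_mul {n : ℕ} {F G H : ℝ → ℝ} (hF : ContDiff ℝ n F) (hG : ContDiff ℝ n G)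
    (hH : ContDiff ℝ n H) (x : ℝ) :
    iteratedDeriv n (fun x ↦ F x * (G x * H x)) x = iteratedDeriv n F x * (G x * H x)
      + ∑ m ∈ Finset.range n, ∑ p ∈ Finset.range (n - m + 1), ((n.choose m : ℝ) * ((n - m).choose p : ℝ)) *
        (iteratedDeriv m F x * (iteratedDeriv p G x * iteratedDeriv (n - m - p) H x)) := by
  rw [iteratedDeriv_fun_mul hF.contDiffAt (hG.mul hH).contDiffAt, Finset.sum_range_succ, add_comm]
  congr 1
  · simp
  · refine Finset.sum_congr rfl fun m hm ↦ ?_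
    have hle : ((n - m : ℕ) : WithTop ℕ∞) ≤ (n : ℕ) := by exact_mod_cast Nat.sub_le _ _
    rw [iteratedDeriv_fun_mul (hG.of_le hle).contDiffAt (hH.of_le hle).contDiffAt, Finset.mul_sum]
    refine Finset.sum_congr rfl fun p hp ↦ ?_
    ring

/-- The Leibniz formula for `diffOp k h`, with a remainder that involves no top order derivative of `F`. -/
theorem diffOp_mul_mul {k : ℕ} (hk : k ≤ 2 * M + 1) (hS : 0 ≤ S) (hE : 0 ≤ E) {F G H : ℝ → ℝ}
    (hF : ContDiff ℝ (k - 1 : ℕ) F) (hG : ContDiff ℝ k G) (hH : ContDiff ℝ k H)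
    (tF : ∀ m < k, Tame S E M m (iteratedDeriv m F)) (tG : ∀ m ≤ k, Tame S E M m (iteratedDeriv m G))
    (tH : ∀ m ≤ k, Tame S E M m (iteratedDeriv m H)) {h : ℝ} (hh : h ≠ 0) :
    L2Le (fun x ↦ diffOp k h (fun x ↦ F x * (G x * H x)) x - diffOp k h F x * (G (x + h) * H (x + h)))
      (leibnizConst k * (S * S * E)) := by
  have hSSE : 0 ≤ S * S * E := by positivity
  -- For `k = 0` the remainder is zero because a translation is multiplicative.
  rcases k with _ | n
  · simp only [diffOp, sub_self]
    exact L2Le.zero.mono (mul_nonneg (leibnizConst_nonneg 0) hSSE)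
  simp only [Nat.add_sub_cancel] at hF
  have hGn : ContDiff ℝ n G := hG.of_le (by norm_cast; omega)
  have hHn : ContDiff ℝ n H := hH.of_le (by norm_cast; omega)
  have dF : ∀ m < n, ∀ x, HasDerivAt (iteratedDeriv m F) (iteratedDeriv (m + 1) F x) x :=
    fun m hm x ↦ hasDerivAt_iteratedDeriv (hF.of_le (by norm_cast)) x
  have dG : ∀ m ≤ n, ∀ x, HasDerivAt (iteratedDeriv m G) (iteratedDeriv (m + 1) G x) x :=
    fun m hm x ↦ hasDerivAt_iteratedDeriv (hG.of_le (by norm_cast; omega)) x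
  have dH : ∀ m ≤ n, ∀ x, HasDerivAt (iteratedDeriv m H) (iteratedDeriv (m + 1) H x) x :=
    fun m hm x ↦ hasDerivAt_iteratedDeriv (hH.of_le (by norm_cast; omega)) x
  have qF : ∀ m < n, Tame S E M (m + 1) (fun x ↦ h⁻¹ * (iteratedDeriv m F (x + h) - iteratedDeriv m F x)) :=
    fun m hm ↦ Tame.difference_quotient (dF m hm) hE (tF (m + 1) (by omega)) hh
  have qG : ∀ m ≤ n, Tame S E M (m + 1) (fun x ↦ h⁻¹ * (iteratedDeriv m G (x + h) - iteratedDeriv m G x)) :=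
    fun m hm ↦ Tame.difference_quotient (dG m hm) hE (tG (m + 1) (by omega)) hh
  have qH : ∀ m ≤ n, Tame S E M (m + 1) (fun x ↦ h⁻¹ * (iteratedDeriv m H (x + h) - iteratedDeriv m H x)) :=
    fun m hm ↦ Tame.difference_quotient (dH m hm) hE (tH (m + 1) (by omega)) hh
  set c : ℕ → ℕ → ℝ := fun m p ↦ (n.choose m : ℝ) * ((n - m).choose p : ℝ)
  set r1 : ℝ → ℝ := fun x ↦ iteratedDeriv n F x *
    ((h⁻¹ * (iteratedDeriv 0 G (x + h) - iteratedDeriv 0 G x)) * iteratedDeriv 0 H (x + h))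
  set r2 : ℝ → ℝ := fun x ↦ iteratedDeriv n F x *
    (iteratedDeriv 0 G x * (h⁻¹ * (iteratedDeriv 0 H (x + h) - iteratedDeriv 0 H x)))
  set s1 : ℕ → ℕ → ℝ → ℝ := fun m p x ↦ (h⁻¹ * (iteratedDeriv m F (x + h) - iteratedDeriv m F x)) *
    (iteratedDeriv p G (x + h) * iteratedDeriv (n - m - p) H (x + h))
  set s2 : ℕ → ℕ → ℝ → ℝ := fun m p x ↦ iteratedDeriv m F x *
    ((h⁻¹ * (iteratedDeriv p G (x + h) - iteratedDeriv p G x)) * iteratedDeriv (n - m - p) H (x + h))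
  set s3 : ℕ → ℕ → ℝ → ℝ := fun m p x ↦ iteratedDeriv m F x *
    (iteratedDeriv p G x * (h⁻¹ * (iteratedDeriv (n - m - p) H (x + h) - iteratedDeriv (n - m - p) H x)))
  -- A difference of products telescopes into three products, each with one difference quotient. The
  -- quotient of `F ^ (n)`, which is not controlled here, occurs only in the term subtracted on the
  -- left; for the order `n` of `F` only `r1` and `r2` remain.
  have hid : (fun x ↦ diffOp (n + 1) h (fun x ↦ F x * (G x * H x)) x - diffOp (n + 1) h F x * (G (x + h) * H (x + h)))
      = fun x ↦ (r1 x + r2 x) + ∑ m ∈ Finset.range n, ∑ p ∈ Finset.range (n - m + 1),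
        c m p * ((s1 m p x + s2 m p x) + s3 m p x) := by
    ext x
    simp only [diffOp]
    rw [iteratedDeriv_mul_mul hF hGn hHn, iteratedDeriv_mul_mul hF hGn hHn]
    have : ∀ m p, c m p * ((s1 m p x + s2 m p x) + s3 m p x)
        = h⁻¹ * (c m p * (iteratedDeriv m F (x + h) * (iteratedDeriv p G (x + h) * iteratedDeriv (n - m - p) H (x + h)))
          - c m p * (iteratedDeriv m F x * (iteratedDeriv p G x * iteratedDeriv (n - m - p) H x))) := by
      intro m p
      simp only [s1, s2, s3]
      ring
    simp only [this, ← Finset.mul_sum, Finset.sum_sub_distrib]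
    simp only [r1, r2, c, iteratedDeriv_zero]
    ring
  rw [hid]
  have hb : ∀ m ∈ Finset.range n, ∀ p ∈ Finset.range (n - m + 1),
      Continuous (fun x ↦ c m p * ((s1 m p x + s2 m p x) + s3 m p x)) ∧
      L2Le (fun x ↦ c m p * ((s1 m p x + s2 m p x) + s3 m p x)) (3 * c m p * (S * S * E)) := by
    intro m hm p hp
    rw [Finset.mem_range] at hm hp
    have e1 := tF m (by omega)
    have e2 := tG p (by omega)
    have e3 := tH (n - m - p) (by omega)
    have d1 := qF m hm
    have d2 := qG p (by omega)
    have d3 := qH (n - m - p) (by omega)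
    have k1 := d1.mul_mul hS (e2.comp_add_right h) (e3.comp_add_right h) (by omega)
    have k2 := e1.mul_mul hS d2 (e3.comp_add_right h) (by omega)
    have k3 := e1.mul_mul hS e2 d3 (by omega)
    have c1 : Continuous (s1 m p) := d1.cont.mul ((e2.comp_add_right h).cont.mul (e3.comp_add_right h).cont)
    have c2 : Continuous (s2 m p) := e1.cont.mul (d2.cont.mul (e3.comp_add_right h).cont)
    have c3 : Continuous (s3 m p) := e1.cont.mul (e2.cont.mul d3.cont)
    refine ⟨by fun_prop, ?_⟩
    have k4 := ((k1.add c1 c2 k2 hSSE hSSE).add (c1.add c2) c3 k3 (by positivity) hSSE).const_mul (c m p)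
    have hc : 0 ≤ c m p := by positivity
    rw [abs_of_nonneg hc] at k4
    exact k4.mono (le_of_eq (by ring))
  have hr1 : L2Le r1 (S * S * E) :=
    (tF n (by omega)).mul_mul hS (qG 0 (by omega)) ((tH 0 (by omega)).comp_add_right h) (by omega)
  have hr2 : L2Le r2 (S * S * E) := (tF n (by omega)).mul_mul hS (tG 0 (by omega)) (qH 0 (by omega)) (by omega)
  have cr1 : Continuous r1 :=
    (tF n (by omega)).cont.mul ((qG 0 (by omega)).cont.mul ((tH 0 (by omega)).comp_add_right h).cont)
  have cr2 : Continuous r2 := (tF n (by omega)).cont.mul ((tG 0 (by omega)).cont.mul (qH 0 (by omega)).cont)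
  have hsum : L2Le (fun x ↦ ∑ m ∈ Finset.range n, ∑ p ∈ Finset.range (n - m + 1),
        c m p * ((s1 m p x + s2 m p x) + s3 m p x)) (∑ m ∈ Finset.range n, ∑ p ∈ Finset.range (n - m + 1),
        3 * c m p * (S * S * E)) := by
    refine L2Le.sum (fun m hm ↦ continuous_finsetSum _ fun p hp ↦ (hb m hm p hp).1) (fun m hm ↦ ?_)
      (fun m hm ↦ Finset.sum_nonneg fun p _ ↦ by positivity)
    exact L2Le.sum (fun p hp ↦ (hb m hm p hp).1) (fun p hp ↦ (hb m hm p hp).2) (fun p _ ↦ by positivity)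
  have hcs : Continuous (fun x ↦ ∑ m ∈ Finset.range n, ∑ p ∈ Finset.range (n - m + 1),
        c m p * ((s1 m p x + s2 m p x) + s3 m p x)) :=
    continuous_finsetSum _ fun m hm ↦ continuous_finsetSum _ fun p hp ↦ (hb m hm p hp).1
  refine ((hr1.add cr1 cr2 hr2 hSSE hSSE).add (cr1.add cr2) hcs hsum (by positivity) ?_).mono (le_of_eq ?_)
  · exact Finset.sum_nonneg fun m _ ↦ Finset.sum_nonneg fun p _ ↦ by positivity
  · simp only [leibnizConst, Nat.add_sub_cancel, ← Finset.sum_mul, c]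
    ring_nf

end

section

/-! ### Cubic quasilinear polynomials -/

/-- A cubic monomial is a product of three variables, at most one of which is `1` or `2`; a
permutation puts that one first. -/
theorem exists_eq_single_add {d : Fin 5 →₀ ℕ} (h3 : d.degree = 3) (h12 : d 1 + d 2 ≤ 1) :
    ∃ i j l : Fin 5, (j ≠ 1 ∧ j ≠ 2) ∧ (l ≠ 1 ∧ l ≠ 2) ∧
      ∀ y : Fin 5 → ℝ, ∏ m, y m ^ d m = y i * (y j * y l) := by
  have hcard : Multiset.card (Finsupp.toMultiset d) = 3 := by
    rw [Finsupp.card_toMultiset]; exact h3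
  obtain ⟨i, j, l, h⟩ := Multiset.card_eq_three.1 hcard
  have hd : d = Finsupp.single i 1 + Finsupp.single j 1 + Finsupp.single l 1 := by
    apply Multiset.toFinsupp.symm.injective
    change Finsupp.toMultiset d = Finsupp.toMultiset _
    rw [h]
    simp only [map_add, Finsupp.toMultiset_single, one_smul]
    rfl
  have hprod : ∀ y : Fin 5 → ℝ, ∏ m, y m ^ d m = y i * y j * y l := by
    intro y
    simp only [hd, Finsupp.add_apply, pow_add, Finset.prod_mul_distrib, Finsupp.single_apply, pow_ite,
      pow_one, pow_zero, Finset.prod_ite_eq, Finset.mem_univ, if_true]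
  have key : ∀ i j l : Fin 5, (Finsupp.single i 1 + Finsupp.single j 1 + Finsupp.single l 1 : Fin 5 →₀ ℕ) 1
      + (Finsupp.single i 1 + Finsupp.single j 1 + Finsupp.single l 1 : Fin 5 →₀ ℕ) 2 ≤ 1 →
      ((j ≠ 1 ∧ j ≠ 2) ∧ (l ≠ 1 ∧ l ≠ 2)) ∨ ((i ≠ 1 ∧ i ≠ 2) ∧ (l ≠ 1 ∧ l ≠ 2)) ∨
        ((i ≠ 1 ∧ i ≠ 2) ∧ (j ≠ 1 ∧ j ≠ 2)) := by
    simp only [Finsupp.add_apply, Finsupp.single_apply]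
    decide
  rw [hd] at h12
  rcases key i j l h12 with hc | hc | hc
  · exact ⟨i, j, l, hc.1, hc.2, fun y ↦ by rw [hprod, mul_assoc]⟩
  · exact ⟨j, i, l, hc.1, hc.2, fun y ↦ by rw [hprod]; ring⟩
  · exact ⟨l, i, j, hc.1, hc.2, fun y ↦ by rw [hprod]; ring⟩

/-- The monomials of `P` are products of three variables, of which only the first may be `X₂` or `X₃`. -/
theorem IsCubicQuasilinear.exists_eval_eq {P : MvPolynomial (Fin 5) ℝ} (hP : IsCubicQuasilinear P) :
    ∃ i j l : (Fin 5 →₀ ℕ) → Fin 5, (∀ d, j d ≠ 1 ∧ j d ≠ 2) ∧ (∀ d, l d ≠ 1 ∧ l d ≠ 2) ∧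
      ∀ y : Fin 5 → ℝ, MvPolynomial.eval y P
        = ∑ d ∈ P.support, P.coeff d * (y (i d) * (y (j d) * y (l d))) := by
  have h : ∀ d : Fin 5 →₀ ℕ, ∃ q : Fin 5 × Fin 5 × Fin 5, (q.2.1 ≠ 1 ∧ q.2.1 ≠ 2) ∧ (q.2.2 ≠ 1 ∧ q.2.2 ≠ 2) ∧
      (d ∈ P.support → ∀ y : Fin 5 → ℝ, ∏ m, y m ^ d m = y q.1 * (y q.2.1 * y q.2.2)) := by
    intro d
    by_cases hd : d ∈ P.support
    · have h3 : d.degree = 3 := by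
        have := hP.homogeneous (MvPolynomial.mem_support_iff.1 hd)
        rw [Finsupp.degree_eq_weight_one (R := ℕ)]
        exact this
      obtain ⟨i, j, l, hj, hl, h⟩ := exists_eq_single_add h3 (hP.affine d hd)
      exact ⟨(i, j, l), hj, hl, fun _ ↦ h⟩
    · exact ⟨(0, 0, 0), by decide, by decide, fun h ↦ absurd h hd⟩
  choose q hq1 hq2 hq3 using h
  refine ⟨fun d ↦ (q d).1, fun d ↦ (q d).2.1, fun d ↦ (q d).2.2, hq1, hq2, fun y ↦ ?_⟩
  rw [MvPolynomial.eval_eq']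
  exact Finset.sum_congr rfl fun d hd ↦ by rw [hq3 d hd]

/-! ### Smoothness in the space variable -/

/-- The space derivatives of `f` up to order `n` exist and are continuous on the strip. -/
structure XSmooth (T : ℝ) (n : ℕ) (f : ℝ → ℝ → ℝ) : Prop where
  contDiff : ∀ t ∈ Set.Icc 1 T, ContDiff ℝ n (f t)
  contStrip : ∀ j ≤ n, ContStrip T fun t ↦ iteratedDeriv j (f t)

variable {T : ℝ} {n : ℕ} {f g : ℝ → ℝ → ℝ}

theorem XSmooth.mono (hf : XSmooth T n f) {m : ℕ} (h : m ≤ n) : XSmooth T m f :=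
  ⟨fun t ht ↦ (hf.contDiff t ht).of_le (by exact_mod_cast h), fun j hj ↦ hf.contStrip j (hj.trans h)⟩

theorem XSmooth.cont (hf : XSmooth T n f) : ContStrip T f := by
  simpa using hf.contStrip 0 (Nat.zero_le n)

theorem XSmooth.congr (hf : XSmooth T n f) (h : ∀ t ∈ Set.Icc 1 T, ∀ x, g t x = f t x) : XSmooth T n g := by
  refine ⟨fun t ht ↦ ?_, fun j hj ↦ (hf.contStrip j hj).congr fun t ht x ↦ ?_⟩
  · rw [funext (h t ht)]; exact hf.contDiff t ht
  · rw [funext (h t ht)]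

theorem XSmooth.isDerivX (hf : XSmooth T n f) {j : ℕ} (hj : j < n) :
    IsDerivX T (fun t ↦ iteratedDeriv j (f t)) (fun t ↦ iteratedDeriv (j + 1) (f t)) :=
  fun t ht x ↦ hasDerivAt_iteratedDeriv ((hf.contDiff t ht).of_le (by exact_mod_cast hj)) x

theorem XSmooth.deriv (hf : XSmooth T (n + 1) f) : XSmooth T n (fun t ↦ deriv (f t)) := by
  refine ⟨fun t ht ↦ ?_, fun j hj ↦ ?_⟩
  · exact ((contDiff_succ_iff_deriv (n := n)).1 (by exact_mod_cast hf.contDiff t ht)).2.2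
  · have := hf.contStrip (j + 1) (by omega)
    simpa only [iteratedDeriv_succ'] using this

theorem XSmooth.isDerivX_deriv (hf : XSmooth T (n + 1) f) : IsDerivX T f (fun t ↦ _root_.deriv (f t)) := by
  simpa using hf.isDerivX (j := 0) (by omega)

theorem XSmooth.add (hf : XSmooth T n f) (hg : XSmooth T n g) : XSmooth T n (fun t x ↦ f t x + g t x) := by
  refine ⟨fun t ht ↦ (hf.contDiff t ht).add (hg.contDiff t ht), fun j hj ↦
    ((hf.contStrip j hj).add (hg.contStrip j hj)).congr fun t ht x ↦ ?_⟩
  exact iteratedDeriv_fun_add ((hf.contDiff t ht).of_le (by exact_mod_cast hj)).contDiffAt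
    ((hg.contDiff t ht).of_le (by exact_mod_cast hj)).contDiffAt

theorem XSmooth.mul (hf : XSmooth T n f) (hg : XSmooth T n g) : XSmooth T n (fun t x ↦ f t x * g t x) := by
  refine ⟨fun t ht ↦ (hf.contDiff t ht).mul (hg.contDiff t ht), fun j hj ↦ ?_⟩
  have : ContStrip T (fun t x ↦ ∑ i ∈ Finset.range (j + 1), (j.choose i : ℝ) *
      (iteratedDeriv i (f t) x * iteratedDeriv (j - i) (g t) x)) := by
    refine ContStrip.sum fun i hi ↦ ContStrip.const_mul ?_ _
    rw [Finset.mem_range] at hi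
    exact (hf.contStrip i (by omega)).mul (hg.contStrip (j - i) (by omega))
  refine this.congr fun t ht x ↦ ?_
  rw [iteratedDeriv_fun_mul ((hf.contDiff t ht).of_le (by exact_mod_cast hj)).contDiffAt
    ((hg.contDiff t ht).of_le (by exact_mod_cast hj)).contDiffAt]
  exact Finset.sum_congr rfl fun i _ ↦ by ring

theorem XSmooth.const (c : ℝ) : XSmooth T n (fun _ _ ↦ c) := by
  refine ⟨fun t _ ↦ contDiff_const, fun j _ ↦ ?_⟩
  refine contStrip_of_continuous ?_
  simp only [iteratedDeriv_const]
  exact continuous_const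

theorem XSmooth.const_mul (hf : XSmooth T n f) (c : ℝ) : XSmooth T n (fun t x ↦ c * f t x) :=
  (XSmooth.const c).mul hf

theorem XSmooth.sub (hf : XSmooth T n f) (hg : XSmooth T n g) : XSmooth T n (fun t x ↦ f t x - g t x) :=
  (hf.add (hg.const_mul (-1))).congr fun t _ x ↦ by ring

theorem XSmooth.sum {ι : Type*} {s : Finset ι} {f : ι → ℝ → ℝ → ℝ} (hf : ∀ i ∈ s, XSmooth T n (f i)) :
    XSmooth T n (fun t x ↦ ∑ i ∈ s, f i t x) := by
  classical
  induction s using Finset.induction_on with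
  | empty => simpa using XSmooth.const 0
  | insert a s ha ih =>
    simp only [Finset.sum_insert ha]
    exact (hf a (Finset.mem_insert_self a s)).add (ih fun i hi ↦ hf i (Finset.mem_insert_of_mem hi))

/-- Each further space derivative is exchanged with `∂_t` by `IsDerivT.of_mixed`. -/
theorem IsDerivT.iteratedDeriv (h : IsDerivT T f g) (hf : XSmooth T n f) (hg : XSmooth T n g) {j : ℕ} (hj : j ≤ n) :
    IsDerivT T (fun t ↦ iteratedDeriv j (f t)) (fun t ↦ iteratedDeriv j (g t)) := by
  induction j with
  | zero => simpa using h
  | succ j ih =>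
    exact IsDerivT.of_mixed (hf.isDerivX (by omega)) (ih (by omega)) (hg.isDerivX (by omega)) (hg.contStrip _ hj)

/-! ### The operator `diffOp` on the strip -/

theorem diffOp_add (k : ℕ) (h : ℝ) {f g : ℝ → ℝ} (hf : ContDiff ℝ (k - 1 : ℕ) f) (hg : ContDiff ℝ (k - 1 : ℕ) g)
    (x : ℝ) : diffOp k h (fun x ↦ f x + g x) x = diffOp k h f x + diffOp k h g x := by
  cases k with
  | zero => rfl
  | succ k =>
    simp only [diffOp, Nat.add_sub_cancel] at hf hg ⊢
    rw [iteratedDeriv_fun_add hf.contDiffAt hg.contDiffAt, iteratedDeriv_fun_add hf.contDiffAt hg.contDiffAt]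
    ring

theorem diffOp_const_mul (k : ℕ) (h c : ℝ) (f : ℝ → ℝ) (x : ℝ) :
    diffOp k h (fun x ↦ c * f x) x = c * diffOp k h f x := by
  cases k with
  | zero => rfl
  | succ k =>
    simp only [diffOp, iteratedDeriv_const_mul_field]
    ring

theorem diffOp_sub (k : ℕ) (h : ℝ) {f g : ℝ → ℝ} (hf : ContDiff ℝ (k - 1 : ℕ) f) (hg : ContDiff ℝ (k - 1 : ℕ) g)
    (x : ℝ) : diffOp k h (fun x ↦ f x - g x) x = diffOp k h f x - diffOp k h g x := by
  cases k with
  | zero => rfl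
  | succ k =>
    simp only [diffOp, Nat.add_sub_cancel] at hf hg ⊢
    rw [iteratedDeriv_fun_sub hf.contDiffAt hg.contDiffAt, iteratedDeriv_fun_sub hf.contDiffAt hg.contDiffAt]
    ring

theorem diffOp_sum (k : ℕ) (h : ℝ) {ι : Type*} {s : Finset ι} {f : ι → ℝ → ℝ}
    (hf : ∀ i ∈ s, ContDiff ℝ (k - 1 : ℕ) (f i)) (x : ℝ) :
    diffOp k h (fun x ↦ ∑ i ∈ s, f i x) x = ∑ i ∈ s, diffOp k h (f i) x := by
  classical
  induction s using Finset.induction_on with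
  | empty => cases k <;> simp [diffOp]
  | insert a s ha ih =>
    simp only [Finset.sum_insert ha]
    rw [diffOp_add k h (hf a (Finset.mem_insert_self a s))
      (ContDiff.sum fun i hi ↦ hf i (Finset.mem_insert_of_mem hi)),
      ih fun i hi ↦ hf i (Finset.mem_insert_of_mem hi)]

theorem XSmooth.contStrip_diffOp (hf : XSmooth T n f) {k : ℕ} (hk : k - 1 ≤ n) (h : ℝ) :
    ContStrip T (fun t ↦ diffOp k h (f t)) := by
  cases k with
  | zero => exact hf.cont.comp_add_right h
  | succ k =>
    have := hf.contStrip k hk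
    exact ((this.comp_add_right h).sub this).const_mul h⁻¹

theorem XSmooth.isDerivX_diffOp (hf : XSmooth T n f) {k : ℕ} (hk : k - 1 + 1 ≤ n) (h : ℝ) :
    IsDerivX T (fun t ↦ diffOp k h (f t)) (fun t ↦ diffOp k h (_root_.deriv (f t))) := by
  cases k with
  | zero => exact (hf.mono hk).isDerivX_deriv.comp_add_right h
  | succ k =>
    have := hf.isDerivX (j := k) hk
    simp only [iteratedDeriv_succ'] at this
    exact ((this.comp_add_right h).sub this).const_mul h⁻¹

theorem IsDerivT.diffOp (h' : IsDerivT T f g) (hf : XSmooth T n f) (hg : XSmooth T n g) {k : ℕ} (hk : k - 1 ≤ n)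
    (h : ℝ) : IsDerivT T (fun t ↦ diffOp k h (f t)) (fun t ↦ KleinGordon.diffOp k h (g t)) := by
  cases k with
  | zero => exact h'.comp_add_right h
  | succ k =>
    have := h'.iteratedDeriv hf hg hk
    exact ((this.comp_add_right h).sub this).const_mul h⁻¹

theorem L2Le.diffOp {k : ℕ} {f : ℝ → ℝ} {K : ℝ} (hf : ContDiff ℝ k f) (hK : 0 ≤ K)
    (h2 : L2Le (iteratedDeriv k f) K) {h : ℝ} (hh : h ≠ 0) : L2Le (diffOp k h f) K := by
  cases k with
  | zero => exact L2Le.comp_add_right hf.continuous (by simpa using h2) h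
  | succ k =>
    exact L2Le.difference_quotient (fun x ↦ hasDerivAt_iteratedDeriv hf x)
      (hf.continuous_iteratedDeriv _ le_rfl) hK h2 hh

theorem continuous_diffOp {k : ℕ} {f : ℝ → ℝ} (hf : ContDiff ℝ (k - 1 : ℕ) f) (h : ℝ) :
    Continuous (diffOp k h f) := by
  cases k with
  | zero => exact hf.continuous.comp (by fun_prop)
  | succ k =>
    have : Continuous (iteratedDeriv k f) := hf.continuous_iteratedDeriv _ le_rfl
    change Continuous fun x ↦ h⁻¹ * (iteratedDeriv k f (x + h) - iteratedDeriv k f x)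
    fun_prop

theorem tendsto_diffOp {k : ℕ} {f : ℝ → ℝ} (hf : ContDiff ℝ k f) (x : ℝ) :
    Filter.Tendsto (fun h ↦ diffOp k h f x) (𝓝[≠] 0) (𝓝 (iteratedDeriv k f x)) := by
  cases k with
  | zero =>
    have : Continuous fun h ↦ f (x + h) := hf.continuous.comp (by fun_prop)
    simpa [diffOp] using (this.tendsto 0).mono_left nhdsWithin_le_nhds
  | succ k =>
    have := hasDerivAt_iff_tendsto_slope_zero.1 (hasDerivAt_iteratedDeriv hf x)
    simp only [smul_eq_mul] at this
    exact this

/-- Uniform bounds for `diffOp k h f` as `h → 0` give a bound for the derivative. -/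
theorem L2Le.of_diffOp {k : ℕ} {f : ℝ → ℝ} {K : ℝ} (hf : ContDiff ℝ k f)
    (h2 : ∀ h : ℝ, h ≠ 0 → L2Le (KleinGordon.diffOp k h f) K) : L2Le (iteratedDeriv k f) K := by
  have hf' : ContDiff ℝ (k - 1 : ℕ) f := hf.of_le (by exact_mod_cast Nat.sub_le _ _)
  -- Fatou's lemma needs a sequence of steps tending to zero through nonzero values.
  set h : ℕ → ℝ := fun n ↦ 1 / ((n : ℝ) + 1)
  have hne : ∀ n, h n ≠ 0 := fun n ↦ by simp only [h]; positivity
  have hlim : Filter.Tendsto h Filter.atTop (𝓝[≠] 0) :=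
    tendsto_nhdsWithin_iff.2 ⟨tendsto_one_div_add_atTop_nhds_zero_nat, Filter.Eventually.of_forall hne⟩
  refine le_trans (Lp.eLpNorm_lim_le_liminf_eLpNorm
    (f := fun n ↦ KleinGordon.diffOp k (h n) f) (fun n ↦ (continuous_diffOp hf' _).aestronglyMeasurable) _
    (Filter.Eventually.of_forall fun x ↦ (tendsto_diffOp hf x).comp hlim)) ?_
  refine Filter.liminf_le_of_frequently_le' (Filter.Frequently.of_forall fun n ↦ h2 (h n) (hne n))

end

section

/-! ### Regularity of functions with values in Sobolev spaces -/

/-- No regularity of `f` is assumed, since this is applied to a derivative in the Sobolev sense,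
known only up to null sets. -/
theorem eLpNorm_le_sobolevNorm (m : ℕ) (f : ℝ → ℝ) : eLpNorm f 2 ≤ sobolevNorm m f := by
  unfold sobolevNorm besselNorm
  refine le_iInf fun S ↦ le_iInf fun hS ↦ le_iInf fun g ↦ le_iInf fun hg ↦ ?_
  have hb : ∀ ξ, ‖((bracketSymbol (-m) ξ : ℝ) : ℂ)‖ ≤ 1 := by
    intro ξ
    rw [Complex.norm_real, Real.norm_of_nonneg (bracketSymbol_pos _ _).le, ← bracketSymbol_zero ξ]
    exact bracketSymbol_mono (by simp) ξ
  obtain ⟨h, hh, hgh⟩ := exists_Lp_fourierMultiplier (bracketSymbol_hasTemperateGrowth (-m)) hb g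
  have hSh : S = (h : 𝓢'(ℝ, ℂ)) := (eq_bracketD_neg hg).trans hgh
  have key : ∀ᵐ x, (f x : ℂ) = h x := by
    apply ae_eq_of_integral_contDiff_smul_eq
    · intro x
      obtain ⟨U, hU, hi⟩ := hS.locallyIntegrable x
      exact ⟨U, hU, hi.ofReal⟩
    · exact (Lp.memLp h).locallyIntegrable (by norm_num)
    · intro φ h1 h2
      have h3 := (hS (testSchwartz φ h1 h2)).2
      rw [hSh, Lp.toTemperedDistribution_apply] at h3
      simp only [testSchwartz_apply, smul_eq_mul] at h3
      simp only [Complex.real_smul]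
      rw [h3]
  have h5 : eLpNorm f 2 = eLpNorm h 2 := by
    apply eLpNorm_congr_norm_ae
    filter_upwards [key] with x hx
    rw [← hx]
    simp
  rw [h5, ← Lp.enorm_def, ← ofReal_norm, ← ofReal_norm]
  exact ENNReal.ofReal_le_ofReal hh

theorem aestronglyMeasurable_of_sobolevNorm_lt_top {m : ℕ} {f : ℝ → ℝ} (h : sobolevNorm m f < ⊤) :
    AEStronglyMeasurable f := by
  obtain ⟨S, hS, -⟩ := exists_of_besselNorm_lt_top h
  exact hS.locallyIntegrable.aestronglyMeasurable

/-- The embedding applied to `v t - v t₀` gives continuity in time uniformly in `x`. Together with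
continuity in `x` at the time `t₀`, this is joint continuity. -/
theorem ContinuousInSobolev.xSmooth {T : ℝ} {n : ℕ} {v : ℝ → ℝ → ℝ}
    (h : ContinuousInSobolev (Set.Icc 1 T) (n + 1) v) (hc : ∀ t ∈ Set.Icc 1 T, Continuous (v t)) :
    XSmooth T n v := by
  have hC : ∀ t ∈ Set.Icc 1 T, ContDiff ℝ n (v t) := fun t ht ↦ contDiff_of_sobolevNorm_lt_top (hc t ht) (h.1 t ht)
  refine ⟨hC, fun j hj ↦ ?_⟩
  obtain ⟨C, hC0, hb⟩ := exists_abs_iteratedDeriv_le_sobolevNorm (m := n + 1) (j := j) (by omega)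
  have hCj : ∀ t ∈ Set.Icc 1 T, ContDiff ℝ j (v t) := fun t ht ↦ (hC t ht).of_le (by exact_mod_cast hj)
  rintro ⟨t₀, x₀⟩ ⟨ht₀, -⟩
  simp only at ht₀
  refine Metric.continuousWithinAt_iff'.2 fun ε hε ↦ ?_
  have h1 : Filter.Tendsto (fun t ↦ ENNReal.ofReal C * sobolevNorm (n + 1) (fun x ↦ v t x - v t₀ x))
      (𝓝[Set.Icc 1 T] t₀) (𝓝 0) := by
    have := ENNReal.Tendsto.const_mul (a := ENNReal.ofReal C) (h.2 t₀ ht₀) (Or.inr ENNReal.ofReal_ne_top)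
    simpa using this
  have h2 : ∀ᶠ t in 𝓝[Set.Icc 1 T] t₀, ∀ x, |iteratedDeriv j (v t) x - iteratedDeriv j (v t₀) x| ≤ ε / 2 := by
    filter_upwards [h1.eventually_le_const (show 0 < ENNReal.ofReal (ε / 2) by simpa using hε),
      self_mem_nhdsWithin] with t ht htI x
    rw [← iteratedDeriv_fun_sub (hCj t htI).contDiffAt (hCj t₀ ht₀).contDiffAt]
    exact (ENNReal.ofReal_le_ofReal_iff (by positivity)).1 ((hb _ ((hCj t htI).sub (hCj t₀ ht₀)) x).trans ht)
  have h3 : ∀ᶠ x in 𝓝 x₀, |iteratedDeriv j (v t₀) x - iteratedDeriv j (v t₀) x₀| < ε / 2 :=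
    Metric.continuousAt_iff'.1 ((hCj t₀ ht₀).continuous_iteratedDeriv j le_rfl).continuousAt (ε / 2) (by positivity)
  rw [nhdsWithin_prod_eq, nhdsWithin_univ]
  filter_upwards [h2.prod_mk h3] with q hq
  rw [Real.dist_eq]
  calc |iteratedDeriv j (v q.1) q.2 - iteratedDeriv j (v t₀) x₀|
      ≤ |iteratedDeriv j (v q.1) q.2 - iteratedDeriv j (v t₀) q.2|
        + |iteratedDeriv j (v t₀) q.2 - iteratedDeriv j (v t₀) x₀| := abs_sub_le _ _ _
    _ < ε / 2 + ε / 2 := add_lt_add_of_le_of_lt (hq.1 q.2) hq.2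
    _ = ε := by ring

/-- A classical time derivative of a function of class `C^1([1,T]; H^k)` is in `C^0([1,T]; H^k)`. -/
theorem ContDiffOneInSobolev.continuousInSobolev {T : ℝ} (hT : 1 < T) {k : ℕ} {v v' : ℝ → ℝ → ℝ}
    (h : ContDiffOneInSobolev (Set.Icc 1 T) k v) (hv : IsDerivT T v v') :
    ContinuousInSobolev (Set.Icc 1 T) k v' := by
  obtain ⟨h0, w, hw, hlim⟩ := h
  -- Along a sequence of times, the difference quotients minus `w` tend to zero in `L^2` and to `v'
  -- - w` pointwise, so `v' = w` almost everywhere by Fatou's lemma.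
  have hae : ∀ t ∈ Set.Icc 1 T, w t =ᵐ[volume] v' t := by
    intro t₀ ht₀
    set l : Filter ℝ := 𝓝[Set.Icc 1 T \ {t₀}] t₀
    have : l.NeBot := by
      have h1 : t₀ ∈ closure (Set.Icc 1 T \ {t₀}) := by
        have : AccPt t₀ (Filter.principal (Set.Icc 1 T)) := by
          exact (uniqueDiffOn_Icc hT t₀ ht₀).accPt
        rwa [accPt_principal_iff_clusterPt, ← mem_closure_iff_clusterPt] at this
      exact mem_closure_iff_nhdsWithin_neBot.1 h1
    obtain ⟨τ, hτ⟩ := Filter.exists_seq_tendsto l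
    have hτI : ∀ᶠ n in Filter.atTop, τ n ∈ Set.Icc 1 T \ {t₀} := hτ.eventually self_mem_nhdsWithin
    obtain ⟨N, hN⟩ := Filter.eventually_atTop.1 hτI
    set τ' : ℕ → ℝ := fun n ↦ τ (n + N)
    have hτ' : Filter.Tendsto τ' Filter.atTop l := hτ.comp (Filter.tendsto_add_atTop_nat N)
    have hτ'I : ∀ n, τ' n ∈ Set.Icc 1 T \ {t₀} := fun n ↦ hN _ (Nat.le_add_left _ _)
    set q : ℕ → ℝ → ℝ := fun n x ↦ (v (τ' n) x - v t₀ x) / (τ' n - t₀) - w t₀ x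
    have hqm : ∀ n, AEStronglyMeasurable (q n) := fun n ↦ by
      have m1 := aestronglyMeasurable_of_sobolevNorm_lt_top (h0.1 _ (hτ'I n).1)
      have m2 := aestronglyMeasurable_of_sobolevNorm_lt_top (h0.1 _ ht₀)
      have m3 := aestronglyMeasurable_of_sobolevNorm_lt_top (hw.1 _ ht₀)
      have := ((m1.sub m2).const_mul ((τ' n - t₀)⁻¹)).sub m3
      refine this.congr (Filter.Eventually.of_forall fun x ↦ ?_)
      simp only [q, Pi.sub_apply, div_eq_inv_mul]
    have hq0 : Filter.Tendsto (fun n ↦ sobolevNorm k (q n)) Filter.atTop (𝓝 0) := (hlim t₀ ht₀).comp hτ'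
    have hqL : Filter.Tendsto (fun n ↦ eLpNorm (q n) 2) Filter.atTop (𝓝 0) :=
      tendsto_of_tendsto_of_tendsto_of_le_of_le tendsto_const_nhds hq0 (fun _ ↦ zero_le)
        (fun n ↦ eLpNorm_le_sobolevNorm k (q n))
    have hqx : ∀ x, Filter.Tendsto (fun n ↦ q n x) Filter.atTop (𝓝 (v' t₀ x - w t₀ x)) := by
      intro x
      have h2 := (hasDerivWithinAt_iff_tendsto_slope.1 (hv t₀ ht₀ x)).comp hτ'
      refine Filter.Tendsto.sub_const (h2.congr fun n ↦ ?_) _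
      simp [slope_def_field]
    have h3 : eLpNorm (fun x ↦ v' t₀ x - w t₀ x) 2 ≤ 0 := by
      refine (Lp.eLpNorm_lim_le_liminf_eLpNorm hqm _ (Filter.Eventually.of_forall hqx)).trans ?_
      rw [hqL.liminf_eq]
    have hm : AEStronglyMeasurable (fun x ↦ v' t₀ x - w t₀ x) :=
      aestronglyMeasurable_of_tendsto_ae Filter.atTop hqm (Filter.Eventually.of_forall hqx)
    have h4 := (eLpNorm_eq_zero_iff hm (by norm_num)).1 (le_antisymm h3 zero_le)
    filter_upwards [h4] with x hx
    simp only [Pi.zero_apply] at hx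
    linarith
  refine ⟨fun t ht ↦ ?_, fun t₀ ht₀ ↦ ?_⟩
  · rw [← sobolevNorm_congr_ae (hae t ht)]
    exact hw.1 t ht
  · refine (hw.2 t₀ ht₀).congr' ?_
    filter_upwards [self_mem_nhdsWithin] with t ht
    exact sobolevNorm_congr_ae ((hae t ht).sub (hae t₀ ht₀))

end

section

/-! ### Cubic nonlinearities -/

/-- A sum of products of three variables, of which only the first may be one of the variables `1` and `2`. -/
structure Cubic where
  index : Finset (Fin 5 →₀ ℕ)
  c : (Fin 5 →₀ ℕ) → ℝ
  i : (Fin 5 →₀ ℕ) → Fin 5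
  j : (Fin 5 →₀ ℕ) → Fin 5
  l : (Fin 5 →₀ ℕ) → Fin 5
  hj : ∀ d, j d ≠ 1 ∧ j d ≠ 2
  hl : ∀ d, l d ≠ 1 ∧ l d ≠ 2

/-- The value of a cubic nonlinearity. -/
def Cubic.eval (N : Cubic) (y : Fin 5 → ℝ) : ℝ := ∑ d ∈ N.index, N.c d * (y (N.i d) * (y (N.j d) * y (N.l d)))

/-- The sum of the moduli of the coefficients. -/
def Cubic.size (N : Cubic) : ℝ := ∑ d ∈ N.index, |N.c d|

theorem Cubic.size_nonneg (N : Cubic) : 0 ≤ N.size := Finset.sum_nonneg fun _ _ ↦ abs_nonneg _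

theorem IsCubicQuasilinear.exists_cubic {P : MvPolynomial (Fin 5) ℝ} (hP : IsCubicQuasilinear P) :
    ∃ N : Cubic, ∀ y, MvPolynomial.eval y P = N.eval y := by
  obtain ⟨i, j, l, hj, hl, h⟩ := hP.exists_eval_eq
  exact ⟨⟨P.support, fun d ↦ P.coeff d, i, j, l, hj, hl⟩, h⟩

/-- The coefficient of the variable `p ∈ {1, 2}`, polarized. -/
def Cubic.coef (N : Cubic) (p : Fin 5) (y z : Fin 5 → ℝ) : ℝ :=
  ∑ d ∈ N.index, (if N.i d = p then N.c d else 0) * (y (N.j d) * z (N.l d))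

theorem Cubic.abs_coef_le (N : Cubic) (p : Fin 5) {y z : Fin 5 → ℝ} {S : ℝ}
    (hy : ∀ m, m ≠ 1 → m ≠ 2 → |y m| ≤ S) (hz : ∀ m, m ≠ 1 → m ≠ 2 → |z m| ≤ S) :
    |N.coef p y z| ≤ N.size * (S * S) := by
  unfold coef size
  rw [Finset.sum_mul]
  refine (Finset.abs_sum_le_sum_abs _ _).trans (Finset.sum_le_sum fun d _ ↦ ?_)
  rw [abs_mul, abs_mul]
  have h1 := hy _ (N.hj d).1 (N.hj d).2
  have h2 := hz _ (N.hl d).1 (N.hl d).2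
  have h3 : |if N.i d = p then N.c d else 0| ≤ |N.c d| := by split_ifs <;> simp
  have h4 : 0 ≤ S := (abs_nonneg _).trans h1
  gcongr

/-! ### Classical consequences of the solution class -/

/-- The quantities `(u, ∂_t ∂_x u, ∂_x² u; ∂_t u, ∂_x u)`. -/
def jet (u ut : ℝ → ℝ → ℝ) : Fin 5 → ℝ → ℝ → ℝ :=
  ![u, fun t ↦ deriv (ut t), fun t ↦ deriv (deriv (u t)), ut, fun t ↦ deriv (u t)]

/-- A solution with `n + 2` continuous space derivatives, together with its time derivatives. -/
structure RegularSolution (T : ℝ) (n : ℕ) (N : Cubic) (u ut utt : ℝ → ℝ → ℝ) : Prop where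
  smooth : XSmooth T (n + 2) u
  smooth_t : XSmooth T (n + 1) ut
  smooth_tt : XSmooth T n utt
  deriv_t : IsDerivT T u ut
  deriv_tt : IsDerivT T ut utt
  eq : ∀ t ∈ Set.Icc 1 T, ∀ x, utt t x = deriv (deriv (u t)) x - u t x + N.eval fun m ↦ jet u ut m t x

variable {T : ℝ} {n : ℕ} {N : Cubic} {u ut utt : ℝ → ℝ → ℝ}

theorem xSmooth_jet (h0 : XSmooth T (n + 2) u) (h1 : XSmooth T (n + 1) ut) (m : Fin 5) :
    XSmooth T n (jet u ut m) := by
  fin_cases m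
  · exact h0.mono (by omega)
  · exact h1.deriv
  · exact h0.deriv.deriv
  · exact h1.mono (by omega)
  · exact h0.deriv.mono (by omega)

theorem xSmooth_jet_of_ne (h0 : XSmooth T (n + 1) u) (h1 : XSmooth T n ut) {m : Fin 5} (hm : m ≠ 1)
    (hm' : m ≠ 2) : XSmooth T n (jet u ut m) := by
  fin_cases m
  · exact h0.mono (by omega)
  · exact absurd rfl hm
  · exact absurd rfl hm'
  · exact h1
  · exact h0.deriv

theorem IsDerivT.deriv {f g : ℝ → ℝ → ℝ} (h : IsDerivT T f g) (hf : XSmooth T 1 f) (hg : XSmooth T 1 g) :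
    IsDerivT T (fun t ↦ deriv (f t)) (fun t ↦ _root_.deriv (g t)) := by
  simpa using h.iteratedDeriv hf hg le_rfl

theorem IsDerivT.deriv_deriv {f g : ℝ → ℝ → ℝ} (h : IsDerivT T f g) (hf : XSmooth T 2 f) (hg : XSmooth T 2 g) :
    IsDerivT T (fun t ↦ _root_.deriv (_root_.deriv (f t))) (fun t ↦ _root_.deriv (_root_.deriv (g t))) :=
  (h.deriv (hf.mono (by omega)) (hg.mono (by omega))).deriv hf.deriv hg.deriv

theorem XSmooth.eval_jet (h0 : XSmooth T (n + 2) u) (h1 : XSmooth T (n + 1) ut) (N : Cubic) :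
    XSmooth T n (fun t x ↦ N.eval fun m ↦ jet u ut m t x) :=
  XSmooth.sum fun _ _ ↦ ((xSmooth_jet h0 h1 _).mul ((xSmooth_jet h0 h1 _).mul (xSmooth_jet h0 h1 _))).const_mul _

/-- The strip has unique derivatives up to its boundary, so the one-sided `∂_t` is the derivative
within the strip in the direction `(1, 0)`, with one order of regularity less. -/
theorem exists_dt_of_contDiffOn {n : ℕ} (hT : 1 < T)
    (h : ContDiffOn ℝ (n + 1 : ℕ) (fun q : ℝ × ℝ ↦ u q.1 q.2) (Set.Icc 1 T ×ˢ Set.univ)) :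
    IsDerivT T u (dt T u) ∧ ContDiffOn ℝ n (fun q : ℝ × ℝ ↦ dt T u q.1 q.2) (Set.Icc 1 T ×ˢ Set.univ) := by
  set f := fun q : ℝ × ℝ ↦ u q.1 q.2
  set Ω : Set (ℝ × ℝ) := Set.Icc 1 T ×ˢ Set.univ
  have hu : UniqueDiffOn ℝ Ω := (uniqueDiffOn_Icc hT).prod uniqueDiffOn_univ
  have hd : IsDerivT T u (fun t x ↦ fderivWithin ℝ f Ω (t, x) (1, 0)) := by
    intro t ht x
    have h1 : HasFDerivWithinAt f (fderivWithin ℝ f Ω (t, x)) Ω (t, x) :=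
      (h.differentiableOn (by simp) (t, x) ⟨ht, Set.mem_univ _⟩).hasFDerivWithinAt
    have h2 : HasDerivWithinAt (fun τ : ℝ ↦ (τ, x)) ((1, 0) : ℝ × ℝ) (Set.Icc 1 T) t :=
      ((hasDerivAt_id t).prodMk (hasDerivAt_const t x)).hasDerivWithinAt
    have h3 : Set.MapsTo (fun τ : ℝ ↦ (τ, x)) (Set.Icc 1 T) Ω := fun τ hτ ↦ ⟨hτ, Set.mem_univ _⟩
    exact h1.comp_hasDerivWithinAt t h2 h3
  have he : ∀ t ∈ Set.Icc 1 T, ∀ x, dt T u t x = fderivWithin ℝ f Ω (t, x) (1, 0) := fun t ht x ↦ hd.dt_eq hT ht x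
  refine ⟨hd.congr (fun _ _ _ ↦ rfl) he, ?_⟩
  have h3 : ContDiffOn ℝ n (fun q ↦ fderivWithin ℝ f Ω q (1, 0)) Ω :=
    (h.fderivWithin hu (by norm_cast)).clm_apply contDiffOn_const
  exact h3.congr fun q hq ↦ he q.1 hq.1 q.2

/-- With `s = n + 2`, the embedding gives `s` continuous space derivatives for `u` and `s - 1` for
`∂_t u`. The `s - 2` derivatives of `∂_t ^ 2 u` come from the equation. -/
theorem IsSolution.regularSolution {P : MvPolynomial (Fin 5) ℝ} (hP : ∀ y, MvPolynomial.eval y P = N.eval y)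
    (hT : 1 < T) {ε : ℝ} {u₀ u₁ : ℝ → ℝ} (h : IsSolution P (n + 2) ε u₀ u₁ T u) :
    RegularSolution T n N u (dt T u) (dt T (dt T u)) := by
  obtain ⟨d1, c1⟩ := exists_dt_of_contDiffOn (n := 1) hT h.classical
  obtain ⟨d2, -⟩ := exists_dt_of_contDiffOn (n := 0) hT c1
  have cu : ContStrip T u := h.classical.continuousOn
  have cut : ContStrip T (dt T u) := c1.continuousOn
  have hu : XSmooth T (n + 2) u := h.continuous_sobolev.xSmooth fun t ht ↦ cu.continuous ht
  have hut : XSmooth T (n + 1) (dt T u) :=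
    (h.contDiff_sobolev.continuousInSobolev hT d1).xSmooth fun t ht ↦ cut.continuous ht
  have heq : ∀ t ∈ Set.Icc 1 T, ∀ x, dt T (dt T u) t x
      = deriv (deriv (u t)) x - u t x + N.eval fun m ↦ jet u (dt T u) m t x := by
    intro t ht x
    have h1 := h.equation t ht x
    have h2 : dt T (dx u) t x = deriv (dt T u t) x :=
      (d1.deriv (hu.mono (by omega)) (hut.mono (by omega))).dt_eq hT ht x
    have h3 : (fun m ↦ jet u (dt T u) m t x)
        = ![u t x, dt T (dx u) t x, dx (dx u) t x, dt T u t x, dx u t x] := by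
      rw [h2]
      funext m
      fin_cases m <;> rfl
    rw [hP, ← h3] at h1
    have h4 : dx (dx u) t x = deriv (deriv (u t)) x := rfl
    linarith
  refine ⟨hu, hut, ?_, d1, d2, heq⟩
  exact ((hu.deriv.deriv.sub (hu.mono (by omega))).add (hu.eval_jet hut N)).congr heq

end

section

/-! ### Energy estimates for the solution -/

variable {T : ℝ} {n M : ℕ} {N : Cubic} {u ut utt : ℝ → ℝ → ℝ}

theorem isDerivT_jet_of_ne (h0 : XSmooth T 1 u) (h1 : XSmooth T 1 ut) (d0 : IsDerivT T u ut)
    (d1 : IsDerivT T ut utt) {m : Fin 5} (hm : m ≠ 1) (hm' : m ≠ 2) : IsDerivT T (jet u ut m) (jet ut utt m) := by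
  fin_cases m
  · exact d0
  · exact absurd rfl hm
  · exact absurd rfl hm'
  · exact d1
  · exact d0.deriv h0 h1

section coef

variable {F F' G : Fin 5 → ℝ → ℝ → ℝ} (N : Cubic) (p : Fin 5)

theorem Cubic.isDerivT_coef (h : ∀ m, m ≠ 1 → m ≠ 2 → IsDerivT T (F m) (F' m)) :
    IsDerivT T (fun t x ↦ N.coef p (fun m ↦ F m t x) (fun m ↦ F m t x))
      (fun t x ↦ N.coef p (fun m ↦ F' m t x) (fun m ↦ F m t x) + N.coef p (fun m ↦ F m t x) (fun m ↦ F' m t x)) := by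
  refine (IsDerivT.sum fun d _ ↦ ((h _ (N.hj d).1 (N.hj d).2).mul (h _ (N.hl d).1 (N.hl d).2)).const_mul
    (if N.i d = p then N.c d else 0)).congr (fun _ _ _ ↦ rfl) fun t ht x ↦ ?_
  simp only [coef, mul_add, Finset.sum_add_distrib]

theorem Cubic.isDerivX_coef (h : ∀ m, m ≠ 1 → m ≠ 2 → IsDerivX T (F m) (F' m)) :
    IsDerivX T (fun t x ↦ N.coef p (fun m ↦ F m t x) (fun m ↦ F m t x))
      (fun t x ↦ N.coef p (fun m ↦ F' m t x) (fun m ↦ F m t x) + N.coef p (fun m ↦ F m t x) (fun m ↦ F' m t x)) := by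
  refine (IsDerivX.sum fun d _ ↦ ((h _ (N.hj d).1 (N.hj d).2).mul (h _ (N.hl d).1 (N.hl d).2)).const_mul
    (if N.i d = p then N.c d else 0)).congr (fun _ _ _ ↦ rfl) fun t ht x ↦ ?_
  simp only [coef, mul_add, Finset.sum_add_distrib]

theorem Cubic.contStrip_coef (h : ∀ m, m ≠ 1 → m ≠ 2 → ContStrip T (F m))
    (h' : ∀ m, m ≠ 1 → m ≠ 2 → ContStrip T (G m)) :
    ContStrip T (fun t x ↦ N.coef p (fun m ↦ F m t x) (fun m ↦ G m t x)) :=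
  ContStrip.sum fun d _ ↦ ((h _ (N.hj d).1 (N.hj d).2).mul (h' _ (N.hl d).1 (N.hl d).2)).const_mul _

end coef

/-- Bounds for a solution and its derivatives at a fixed time. -/
structure JetBound (n M : ℕ) (S E : ℝ) (f g : ℝ → ℝ) : Prop where
  sup : ∀ m ≤ M + 2, ∀ x, |iteratedDeriv m f x| ≤ S
  sup_t : ∀ m ≤ M + 1, ∀ x, |iteratedDeriv m g x| ≤ S
  l2 : ∀ m ≤ n + 2, L2Le (iteratedDeriv m f) E
  l2_t : ∀ m ≤ n + 1, L2Le (iteratedDeriv m g) E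

/-- The jet contains at most two space derivatives of `u` and one of `ut`, which explains the ranges
in `JetBound`. -/
theorem RegularSolution.tame_jet (h : RegularSolution T n N u ut utt) {t S E : ℝ} (ht : t ∈ Set.Icc 1 T)
    (hB : JetBound n M S E (u t) (ut t)) {m : ℕ} (hm : m ≤ n) (p : Fin 5) :
    Tame S E M m (iteratedDeriv m (jet u ut p t)) := by
  refine ⟨((xSmooth_jet h.smooth h.smooth_t p).contStrip m hm).continuous ht, ?_, ?_⟩
  · fin_cases p
    · exact hB.l2 m (by omega)
    · have := hB.l2_t (m + 1) (by omega)
      simp only [iteratedDeriv_succ'] at this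
      exact this
    · have := hB.l2 (m + 2) (by omega)
      simp only [iteratedDeriv_succ'] at this
      exact this
    · exact hB.l2_t m (by omega)
    · have := hB.l2 (m + 1) (by omega)
      simp only [iteratedDeriv_succ'] at this
      exact this
  · intro hM
    fin_cases p
    · exact hB.sup m (by omega)
    · have := hB.sup_t (m + 1) (by omega)
      simp only [iteratedDeriv_succ'] at this
      exact this
    · have := hB.sup (m + 2) (by omega)
      simp only [iteratedDeriv_succ'] at this
      exact this
    · exact hB.sup_t m (by omega)
    · have := hB.sup (m + 1) (by omega)
      simp only [iteratedDeriv_succ'] at this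
      exact this

theorem RegularSolution.tame_jet_of_ne (h : RegularSolution T n N u ut utt) {t S E : ℝ} (ht : t ∈ Set.Icc 1 T)
    (hB : JetBound n M S E (u t) (ut t)) {m : ℕ} (hm : m ≤ n + 1) {p : Fin 5} (hp : p ≠ 1) (hp' : p ≠ 2) :
    Tame S E M m (iteratedDeriv m (jet u ut p t)) := by
  refine ⟨((xSmooth_jet_of_ne h.smooth h.smooth_t hp hp').contStrip m hm).continuous ht, ?_, ?_⟩
  · fin_cases p
    · exact hB.l2 m (by omega)
    · exact absurd rfl hp
    · exact absurd rfl hp'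
    · exact hB.l2_t m (by omega)
    · have := hB.l2 (m + 1) (by omega)
      simp only [iteratedDeriv_succ'] at this
      exact this
  · intro hM
    fin_cases p
    · exact hB.sup m (by omega)
    · exact absurd rfl hp
    · exact absurd rfl hp'
    · exact hB.sup_t m (by omega)
    · have := hB.sup (m + 1) (by omega)
      simp only [iteratedDeriv_succ'] at this
      exact this

/-- A function of class `C^2` on the strip, with its derivatives. -/
structure WaveJet (T : ℝ) (v vt vx vtt vtx vxx : ℝ → ℝ → ℝ) : Prop where
  v_t : IsDerivT T v vt
  v_x : IsDerivX T v vx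
  vt_t : IsDerivT T vt vtt
  vt_x : IsDerivX T vt vtx
  vx_t : IsDerivT T vx vtx
  vx_x : IsDerivX T vx vxx
  cont_v : ContStrip T v
  cont_vt : ContStrip T vt
  cont_vx : ContStrip T vx
  cont_vtt : ContStrip T vtt
  cont_vtx : ContStrip T vtx
  cont_vxx : ContStrip T vxx

/-- The linearized equation at `u(t, x + h)`, applied to `v`. -/
def linearized (N : Cubic) (u ut : ℝ → ℝ → ℝ) (h : ℝ) (v vtt vtx vxx : ℝ → ℝ → ℝ) : ℝ → ℝ → ℝ := fun t x ↦
  vtt t x - vxx t x + v t x - N.coef 1 (fun m ↦ jet u ut m t (x + h)) (fun m ↦ jet u ut m t (x + h)) * vtx t x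
    - N.coef 2 (fun m ↦ jet u ut m t (x + h)) (fun m ↦ jet u ut m t (x + h)) * vxx t x

/-- The bounds available on the solution in the bootstrap argument. -/
structure Bootstrap (T : ℝ) (n M : ℕ) (α κ σ : ℝ) (u ut utt : ℝ → ℝ → ℝ) : Prop where
  bound : ∀ t ∈ Set.Icc 1 T, JetBound n M (α * t ^ (-(1 / 2) : ℝ)) (κ * t ^ σ) (u t) (ut t)
  sup_tt : ∀ t ∈ Set.Icc 1 T, ∀ x, |utt t x| ≤ α * t ^ (-(1 / 2) : ℝ)

theorem sq_mul_rpow_neg_half {t : ℝ} (ht : 1 ≤ t) (α : ℝ) :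
    (α * t ^ (-(1 / 2) : ℝ)) * (α * t ^ (-(1 / 2) : ℝ)) = α ^ 2 / t := by
  have h0 : 0 < t := by linarith
  have : t ^ (-(1 / 2) : ℝ) * t ^ (-(1 / 2) : ℝ) = t⁻¹ := by
    rw [← Real.rpow_add h0, ← Real.rpow_neg_one]
    norm_num
  rw [div_eq_mul_inv (α ^ 2), ← this]
  ring

/-- The function `linearized` serves as the source of the equation of `v`, so it remains to bound
the coefficients. They are quadratic in `(u, ∂_t u, ∂_x u)`, hence of size `α ^ 2 / t` together with
the derivatives that occur. The sup bound on `∂_t ^ 2 u` is needed for the time derivative of the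
coefficient of `v_xx`. -/
theorem RegularSolution.energy_le (hu : RegularSolution T n N u ut utt) (hT : 1 ≤ T) {α κ σ δ κ₁ h : ℝ}
    (hκ : 0 ≤ κ) (hσ : 0 < σ) (hδ : 0 < δ) (hδ2 : δ ≤ 1 / 2) (hκ₁ : 0 ≤ κ₁) (hB : Bootstrap T n M α κ σ u ut utt)
    (hαδ : 2 * N.size * α ^ 2 ≤ δ) {v vt vx vtt vtx vxx : ℝ → ℝ → ℝ} (hv : WaveJet T v vt vx vtt vtx vxx)
    (hvb : ∀ t ∈ Set.Icc 1 T, L2Le (v t) (κ * t ^ σ)) (hvtb : ∀ t ∈ Set.Icc 1 T, L2Le (vt t) (κ * t ^ σ))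
    (hvxb : ∀ t ∈ Set.Icc 1 T, L2Le (vx t) (κ * t ^ σ))
    (hfb : ∀ t ∈ Set.Icc 1 T, L2Le (linearized N u ut h v vtt vtx vxx t) (δ / t * (κ * t ^ σ)))
    (h1 : L2Le (v 1) κ₁) (h1t : L2Le (vt 1) κ₁) (h1x : L2Le (vx 1) κ₁) {t K : ℝ} (ht : t ∈ Set.Icc 1 T)
    (hK : 0 ≤ K) (hKb : 12 * κ₁ ^ 2 + 18 * δ * κ ^ 2 * t ^ (2 * σ) / σ ≤ K ^ 2) :
    L2Le (v t) K ∧ L2Le (vt t) K ∧ L2Le (vx t) K := by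
  have hs0 : XSmooth T (n + 1 + 1) u := hu.smooth
  have hs1 : XSmooth T (n + 1) ut := hu.smooth_t
  have smooth : ∀ m, m ≠ 1 → m ≠ 2 → XSmooth T (n + 1) (jet u ut m) := fun m hm hm' ↦
    xSmooth_jet_of_ne hs0 hs1 hm hm'
  have dT : ∀ m, m ≠ 1 → m ≠ 2 → IsDerivT T (fun t x ↦ jet u ut m t (x + h)) (fun t x ↦ jet ut utt m t (x + h)) :=
    fun m hm hm' ↦ (isDerivT_jet_of_ne (hs0.mono (by omega)) (hs1.mono (by omega)) hu.deriv_t hu.deriv_tt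
      hm hm').comp_add_right h
  have dX : ∀ m, m ≠ 1 → m ≠ 2 → IsDerivX T (fun t x ↦ jet u ut m t (x + h))
      (fun t x ↦ deriv (jet u ut m t) (x + h)) := fun m hm hm' ↦ ((smooth m hm hm').isDerivX_deriv).comp_add_right h
  have c0 : ∀ m, m ≠ 1 → m ≠ 2 → ContStrip T (fun t x ↦ jet u ut m t (x + h)) := fun m hm hm' ↦
    (smooth m hm hm').cont.comp_add_right h
  have cX : ∀ m, m ≠ 1 → m ≠ 2 → ContStrip T (fun t x ↦ deriv (jet u ut m t) (x + h)) := fun m hm hm' ↦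
    (smooth m hm hm').deriv.cont.comp_add_right h
  have cT : ∀ m, m ≠ 1 → m ≠ 2 → ContStrip T (fun t x ↦ jet ut utt m t (x + h)) := fun m hm hm' ↦
    (xSmooth_jet_of_ne hs1 hu.smooth_tt hm hm').cont.comp_add_right h
  have sup0 : ∀ t ∈ Set.Icc 1 T, ∀ x m, m ≠ 1 → m ≠ 2 → |jet u ut m t (x + h)| ≤ α * t ^ (-(1 / 2) : ℝ) := by
    intro t ht x m hm hm'
    simpa using (hu.tame_jet_of_ne ht (hB.bound t ht) (m := 0) (by omega) hm hm').sup (by omega) (x + h)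
  have supX : ∀ t ∈ Set.Icc 1 T, ∀ x m, m ≠ 1 → m ≠ 2 → |deriv (jet u ut m t) (x + h)| ≤ α * t ^ (-(1 / 2) : ℝ) := by
    intro t ht x m hm hm'
    have hb := hB.bound t ht
    fin_cases m
    · have := hb.sup 1 (by omega) (x + h)
      simp only [iteratedDeriv_one] at this
      exact this
    · exact absurd rfl hm
    · exact absurd rfl hm'
    · have := hb.sup_t 1 (by omega) (x + h)
      simp only [iteratedDeriv_one] at this
      exact this
    · have := hb.sup 2 (by omega) (x + h)
      simp only [iteratedDeriv_succ', iteratedDeriv_zero] at this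
      exact this
  have supT : ∀ t ∈ Set.Icc 1 T, ∀ x m, m ≠ 1 → m ≠ 2 → |jet ut utt m t (x + h)| ≤ α * t ^ (-(1 / 2) : ℝ) := by
    intro t ht x m hm hm'
    have hb := hB.bound t ht
    fin_cases m
    · have := hb.sup_t 0 (by omega) (x + h)
      simp only [iteratedDeriv_zero] at this
      exact this
    · exact absurd rfl hm
    · exact absurd rfl hm'
    · exact hB.sup_tt t ht (x + h)
    · have := hb.sup_t 1 (by omega) (x + h)
      simp only [iteratedDeriv_one] at this
      exact this
  have hN := N.size_nonneg
  -- Half of `δ / t` is kept because the derivative of a quadratic coefficient has two terms.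
  have half : ∀ t ∈ Set.Icc 1 T, N.size * (α * t ^ (-(1 / 2) : ℝ) * (α * t ^ (-(1 / 2) : ℝ))) ≤ δ / t / 2 := by
    intro t ht
    have h0 : 0 < t := by linarith [ht.1]
    rw [sq_mul_rpow_neg_half ht.1, div_div, mul_div_assoc', div_le_div_iff₀ h0 (by positivity)]
    nlinarith
  have full : ∀ t ∈ Set.Icc 1 T, δ / t / 2 ≤ δ / t := fun t ht ↦
    half_le_self (div_nonneg hδ.le (by linarith [ht.1]))
  have two : ∀ t ∈ Set.Icc 1 T, ∀ y z : ℝ, |y| ≤ δ / t / 2 → |z| ≤ δ / t / 2 → |y + z| ≤ δ / t := by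
    intro t ht y z hy hz
    linarith [abs_add_le y z]
  have hQ : QuasilinearWave T v vt vx vtt vtx vxx _ _ _ _ _ _ (linearized N u ut h v vtt vtx vxx) :=
    { v_t := hv.v_t, v_x := hv.v_x, vt_t := hv.vt_t, vt_x := hv.vt_x, vx_t := hv.vx_t, vx_x := hv.vx_x
      a_t := N.isDerivT_coef 1 dT, a_x := N.isDerivX_coef 1 dX
      b_t := N.isDerivT_coef 2 dT, b_x := N.isDerivX_coef 2 dX
      cont_v := hv.cont_v, cont_vt := hv.cont_vt, cont_vx := hv.cont_vx, cont_vtt := hv.cont_vtt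
      cont_vtx := hv.cont_vtx, cont_vxx := hv.cont_vxx
      cont_a := N.contStrip_coef 1 c0 c0
      cont_ax := (N.contStrip_coef 1 cX c0).add (N.contStrip_coef 1 c0 cX)
      cont_b := N.contStrip_coef 2 c0 c0
      cont_bt := (N.contStrip_coef 2 cT c0).add (N.contStrip_coef 2 c0 cT)
      cont_bx := (N.contStrip_coef 2 cX c0).add (N.contStrip_coef 2 c0 cX)
      cont_f := (((hv.cont_vtt.sub hv.cont_vxx).add hv.cont_v).sub
        ((N.contStrip_coef 1 c0 c0).mul hv.cont_vtx)).sub ((N.contStrip_coef 2 c0 c0).mul hv.cont_vxx)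
      eq := fun t _ x ↦ by simp only [linearized]; ring }
  exact hQ.energy_le hT hσ hδ hδ2 hκ hκ₁ hvb hvtb hvxb hfb
    (fun t ht x ↦ ((N.abs_coef_le 1 (sup0 t ht x) (sup0 t ht x)).trans (half t ht)).trans (full t ht))
    (fun t ht x ↦ two t ht _ _ ((N.abs_coef_le 1 (supX t ht x) (sup0 t ht x)).trans (half t ht))
      ((N.abs_coef_le 1 (sup0 t ht x) (supX t ht x)).trans (half t ht)))
    (fun t ht x ↦ ((N.abs_coef_le 2 (sup0 t ht x) (sup0 t ht x)).trans (half t ht)).trans (full t ht))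
    (fun t ht x ↦ two t ht _ _ ((N.abs_coef_le 2 (supT t ht x) (sup0 t ht x)).trans (half t ht))
      ((N.abs_coef_le 2 (sup0 t ht x) (supT t ht x)).trans (half t ht)))
    (fun t ht x ↦ two t ht _ _ ((N.abs_coef_le 2 (supX t ht x) (sup0 t ht x)).trans (half t ht))
      ((N.abs_coef_le 2 (sup0 t ht x) (supX t ht x)).trans (half t ht)))
    h1 h1t h1x ht hK hKb

end

/-! ### The energy estimate for the space derivatives of the solution. -/

section

variable {T : ℝ} {n M : ℕ} {N : Cubic} {u ut utt : ℝ → ℝ → ℝ}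

theorem RegularSolution.waveJet_diffOp (hu : RegularSolution T n N u ut utt) {k : ℕ} (hk : k ≤ n + 1) (h : ℝ) :
    WaveJet T (fun t ↦ diffOp k h (u t)) (fun t ↦ diffOp k h (ut t)) (fun t ↦ diffOp k h (deriv (u t)))
      (fun t ↦ diffOp k h (utt t)) (fun t ↦ diffOp k h (deriv (ut t))) (fun t ↦ diffOp k h (deriv (deriv (u t)))) := by
  have s0 := hu.smooth
  have s0' : XSmooth T (n + 1) (fun t ↦ deriv (u t)) := hu.smooth.deriv
  have s1 := hu.smooth_t
  have s1' := hu.smooth_t.deriv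
  have dx : IsDerivT T (fun t ↦ deriv (u t)) (fun t ↦ deriv (ut t)) :=
    hu.deriv_t.deriv (s0.mono (by omega)) (s1.mono (by omega))
  exact
    { v_t := hu.deriv_t.diffOp (s0.mono (m := n + 1) (by omega)) s1 (by omega) h
      v_x := s0.isDerivX_diffOp (by omega) h
      vt_t := hu.deriv_tt.diffOp (s1.mono (m := n) (by omega)) hu.smooth_tt (by omega) h
      vt_x := s1.isDerivX_diffOp (by omega) h
      vx_t := dx.diffOp (s0'.mono (m := n) (by omega)) s1' (by omega) h
      vx_x := s0'.isDerivX_diffOp (by omega) h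
      cont_v := s0.contStrip_diffOp (by omega) h
      cont_vt := s1.contStrip_diffOp (by omega) h
      cont_vx := s0'.contStrip_diffOp (by omega) h
      cont_vtt := hu.smooth_tt.contStrip_diffOp (by omega) h
      cont_vtx := s1'.contStrip_diffOp (by omega) h
      cont_vxx := s0'.deriv.contStrip_diffOp (by omega) h }

/-- When `diffOp k h` is applied to the equation, each monomial yields a commutator `R d`, bounded
by `diffOp_mul_mul`, and a principal term. The latter belongs to the linearized operator if its
first factor has second order. Otherwise it is `Q d`, where the first factor has `k` derivatives in
`L^2`. -/
theorem RegularSolution.linearized_diffOp_le (hu : RegularSolution T n N u ut utt) {k : ℕ} (hk : k ≤ n + 1)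
    (hM : n + 1 ≤ 2 * M + 1) {t S E : ℝ} (hS : 0 ≤ S) (hE : 0 ≤ E) (ht : t ∈ Set.Icc 1 T)
    (hB : JetBound n M S E (u t) (ut t)) {h : ℝ} (hh : h ≠ 0) :
    L2Le (linearized N u ut h (fun t ↦ diffOp k h (u t)) (fun t ↦ diffOp k h (utt t))
      (fun t ↦ diffOp k h (deriv (ut t))) (fun t ↦ diffOp k h (deriv (deriv (u t)))) t)
      (N.size * ((leibnizConst k + 1) * (S * S * E))) := by
  set F : Fin 5 → ℝ → ℝ := fun m ↦ jet u ut m t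
  have hF : ∀ m, ContDiff ℝ (k - 1 : ℕ) (F m) := fun m ↦
    ((xSmooth_jet hu.smooth hu.smooth_t m).contDiff t ht).of_le (by exact_mod_cast (by omega))
  have hG : ∀ m, m ≠ 1 → m ≠ 2 → ContDiff ℝ k (F m) := fun m hm hm' ↦
    ((xSmooth_jet_of_ne hu.smooth hu.smooth_t hm hm').contDiff t ht).of_le (by exact_mod_cast hk)
  have tF : ∀ p, ∀ m < k, Tame S E M m (iteratedDeriv m (F p)) := fun p m hm ↦ hu.tame_jet ht hB (by omega) p
  have tG : ∀ p, p ≠ 1 → p ≠ 2 → ∀ m ≤ k, Tame S E M m (iteratedDeriv m (F p)) := fun p hp hp' m hm ↦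
    hu.tame_jet_of_ne ht hB (by omega) hp hp'
  have hL := leibnizConst_nonneg k
  have hSSE : 0 ≤ S * S * E := by positivity
  set R : (Fin 5 →₀ ℕ) → ℝ → ℝ := fun d x ↦ diffOp k h (fun x ↦ F (N.i d) x * (F (N.j d) x * F (N.l d) x)) x
    - diffOp k h (F (N.i d)) x * (F (N.j d) (x + h) * F (N.l d) (x + h))
  set Q : (Fin 5 →₀ ℕ) → ℝ → ℝ := fun d x ↦ if N.i d = 1 ∨ N.i d = 2 then 0 else
    F (N.j d) (x + h) * F (N.l d) (x + h) * diffOp k h (F (N.i d)) x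
  have hprod : ∀ d, ContDiff ℝ (k - 1 : ℕ) fun x ↦ F (N.i d) x * (F (N.j d) x * F (N.l d) x) := fun d ↦
    (hF _).mul ((hF _).mul (hF _))
  have hRc : ∀ d, Continuous (R d) := fun d ↦ by
    have c1 := continuous_diffOp (hprod d) h
    have c2 := continuous_diffOp (hF (N.i d)) h
    have c3 := (hF (N.j d)).continuous
    have c4 := (hF (N.l d)).continuous
    fun_prop
  have hR : ∀ d, L2Le (R d) (leibnizConst k * (S * S * E)) := fun d ↦
    diffOp_mul_mul (by omega) hS hE (hF _) (hG _ (N.hj d).1 (N.hj d).2) (hG _ (N.hl d).1 (N.hl d).2)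
      (tF _) (tG _ (N.hj d).1 (N.hj d).2) (tG _ (N.hl d).1 (N.hl d).2) hh
  have hQ : ∀ d, Continuous (Q d) ∧ L2Le (Q d) (S * S * E) := fun d ↦ by
    simp only [Q]
    split_ifs with hd
    · exact ⟨continuous_const, L2Le.zero.mono hSSE⟩
    · rw [not_or] at hd
      have c2 := continuous_diffOp (hF (N.i d)) h
      have c3 := (hF (N.j d)).continuous
      have c4 := (hF (N.l d)).continuous
      refine ⟨by fun_prop, L2Le.of_abs_le (mul_nonneg hS hS)
        (L2Le.diffOp (hG _ hd.1 hd.2) hE (tG _ hd.1 hd.2 k le_rfl).l2 hh) fun x ↦ ?_⟩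
      have b1 := (tG _ (N.hj d).1 (N.hj d).2 0 (by omega)).sup (by omega) (x + h)
      have b2 := (tG _ (N.hl d).1 (N.hl d).2 0 (by omega)).sup (by omega) (x + h)
      simp only [iteratedDeriv_zero] at b1 b2
      rw [abs_mul, abs_mul]
      gcongr
  have hid : linearized N u ut h (fun t ↦ diffOp k h (u t)) (fun t ↦ diffOp k h (utt t))
      (fun t ↦ diffOp k h (deriv (ut t))) (fun t ↦ diffOp k h (deriv (deriv (u t)))) t
      = fun x ↦ ∑ d ∈ N.index, N.c d * (R d x + Q d x) := by
    funext x
    have hutt : diffOp k h (utt t) x = diffOp k h (F 2) x - diffOp k h (F 0) x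
        + ∑ d ∈ N.index, N.c d * diffOp k h (fun x ↦ F (N.i d) x * (F (N.j d) x * F (N.l d) x)) x := by
      have : utt t = fun x ↦ (F 2 x - F 0 x) + ∑ d ∈ N.index, N.c d * (F (N.i d) x * (F (N.j d) x * F (N.l d) x)) :=
        funext fun x ↦ hu.eq t ht x
      rw [this, diffOp_add k h ((hF 2).sub (hF 0)) (ContDiff.sum fun d _ ↦ contDiff_const.mul (hprod d)),
        diffOp_sub k h (hF 2) (hF 0), diffOp_sum k h (fun d _ ↦ contDiff_const.mul (hprod d))]
      simp only [diffOp_const_mul]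
    have hterm : ∀ d, N.c d * (R d x + Q d x)
        = N.c d * diffOp k h (fun x ↦ F (N.i d) x * (F (N.j d) x * F (N.l d) x)) x
          - (if N.i d = 1 then N.c d else 0) * (F (N.j d) (x + h) * F (N.l d) (x + h)) * diffOp k h (F 1) x
          - (if N.i d = 2 then N.c d else 0) * (F (N.j d) (x + h) * F (N.l d) (x + h)) * diffOp k h (F 2) x := by
      intro d
      simp only [R, Q]
      by_cases h1 : N.i d = 1
      · simp only [h1, true_or, if_true, show (1 : Fin 5) ≠ 2 by decide, if_false]
        ring
      · by_cases h2 : N.i d = 2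
        · simp only [h2, or_true, if_true, show (2 : Fin 5) ≠ 1 by decide, if_false]
          ring
        · simp only [h1, h2, or_self, if_false]
          ring
    simp only [hterm, Finset.sum_sub_distrib, ← Finset.sum_mul]
    simp only [linearized, hutt, Cubic.coef]
    change diffOp k h (F 2) x - diffOp k h (F 0) x + _ - diffOp k h (F 2) x + diffOp k h (F 0) x
      - _ * diffOp k h (F 1) x - _ * diffOp k h (F 2) x = _
    ring
  rw [hid]
  have := L2Le.sum (s := N.index) (f := fun d x ↦ N.c d * (R d x + Q d x))
    (K := fun d ↦ |N.c d| * (leibnizConst k * (S * S * E) + S * S * E))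
    (fun d _ ↦ continuous_const.mul ((hRc d).add (hQ d).1))
    (fun d _ ↦ ((hR d).add (hRc d) (hQ d).1 (hQ d).2 (by positivity) hSSE).const_mul _)
    (fun d _ ↦ by positivity)
  refine this.mono (le_of_eq ?_)
  rw [← Finset.sum_mul, Cubic.size]
  ring

/-- The energy estimate for `∂_x ^ k u`. -/
theorem RegularSolution.energy_iteratedDeriv_le (hu : RegularSolution T n N u ut utt) (hT : 1 ≤ T) {α κ σ δ κ₁ : ℝ}
    (hα : 0 ≤ α) (hκ : 0 ≤ κ) (hσ : 0 < σ) (hδ : 0 < δ) (hδ2 : δ ≤ 1 / 2) (hκ₁ : 0 ≤ κ₁)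
    (hB : Bootstrap T n M α κ σ u ut utt) (hM : n + 1 ≤ 2 * M + 1) {k : ℕ} (hk : k ≤ n + 1)
    (hαδ : N.size * (leibnizConst k + 2) * α ^ 2 ≤ δ)
    (h0 : ∀ m ≤ n + 2, L2Le (iteratedDeriv m (u 1)) κ₁) (h1 : ∀ m ≤ n + 1, L2Le (iteratedDeriv m (ut 1)) κ₁)
    {t K : ℝ} (ht : t ∈ Set.Icc 1 T) (hK : 0 ≤ K) (hKb : 12 * κ₁ ^ 2 + 18 * δ * κ ^ 2 * t ^ (2 * σ) / σ ≤ K ^ 2) :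
    L2Le (iteratedDeriv k (u t)) K ∧ L2Le (iteratedDeriv k (ut t)) K ∧ L2Le (iteratedDeriv (k + 1) (u t)) K := by
  have hN := N.size_nonneg
  have hL := leibnizConst_nonneg k
  have h1I : (1 : ℝ) ∈ Set.Icc 1 T := ⟨le_rfl, hT⟩
  have s0 : XSmooth T k u := hu.smooth.mono (by omega)
  have s1 : XSmooth T k ut := hu.smooth_t.mono hk
  have s0' : XSmooth T k (fun t ↦ deriv (u t)) := (hu.smooth.mono (m := k + 1) (by omega)).deriv
  have hcon : ∀ h : ℝ, h ≠ 0 →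
      L2Le (diffOp k h (u t)) K ∧ L2Le (diffOp k h (ut t)) K ∧ L2Le (diffOp k h (deriv (u t))) K := by
    intro h hh
    have hE : ∀ t ∈ Set.Icc 1 T, 0 ≤ κ * t ^ σ := fun t ht ↦
      mul_nonneg hκ (Real.rpow_nonneg (by linarith [ht.1]) _)
    -- The constant `leibnizConst k + 2` in the smallness condition covers both the factor `2`
    -- required for the coefficients and the factor `leibnizConst k + 1` of the source.
    refine hu.energy_le (h := h) hT hκ hσ hδ hδ2 hκ₁ hB ?_ (hu.waveJet_diffOp hk h)
      (fun t ht ↦ L2Le.diffOp (s0.contDiff t ht) (hE t ht) ((hB.bound t ht).l2 k (by omega)) hh)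
      (fun t ht ↦ L2Le.diffOp (s1.contDiff t ht) (hE t ht) ((hB.bound t ht).l2_t k (by omega)) hh)
      (fun t ht ↦ L2Le.diffOp (s0'.contDiff t ht) (hE t ht)
        (by rw [← iteratedDeriv_succ']; exact (hB.bound t ht).l2 (k + 1) (by omega)) hh)
      (fun t ht ↦ ?_)
      (L2Le.diffOp (s0.contDiff 1 h1I) hκ₁ (h0 k (by omega)) hh)
      (L2Le.diffOp (s1.contDiff 1 h1I) hκ₁ (h1 k (by omega)) hh)
      (L2Le.diffOp (s0'.contDiff 1 h1I) hκ₁ (by rw [← iteratedDeriv_succ']; exact h0 (k + 1) (by omega)) hh)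
      ht hK hKb
    · have : 0 ≤ N.size * leibnizConst k * α ^ 2 := by positivity
      linarith
    · have ht0 : 0 < t := by linarith [ht.1]
      have := hu.linearized_diffOp_le hk hM (mul_nonneg hα (Real.rpow_nonneg ht0.le _)) (hE t ht) ht (hB.bound t ht) hh
      refine this.mono ?_
      rw [sq_mul_rpow_neg_half ht.1]
      have h2 : N.size * ((leibnizConst k + 1) * (α ^ 2 / t * (κ * t ^ σ)))
          = N.size * (leibnizConst k + 1) * α ^ 2 / t * (κ * t ^ σ) := by ring
      rw [h2]
      have := hE t ht
      gcongr
      refine le_trans ?_ hαδ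
      gcongr
      norm_num
  refine ⟨L2Le.of_diffOp (s0.contDiff t ht) fun h hh ↦ (hcon h hh).1,
    L2Le.of_diffOp (s1.contDiff t ht) fun h hh ↦ (hcon h hh).2.1, ?_⟩
  rw [iteratedDeriv_succ']
  exact L2Le.of_diffOp (s0'.contDiff t ht) fun h hh ↦ (hcon h hh).2.2

end

section

/-! ### The energy estimate for `Z u` -/

variable {T : ℝ} {n M : ℕ} {N : Cubic} {u ut utt : ℝ → ℝ → ℝ}

/-- `Z u`. -/
def zField (u ut : ℝ → ℝ → ℝ) : ℝ → ℝ → ℝ := fun t x ↦ t * deriv (u t) x + x * ut t x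

/-- `∂_t Z u`. -/
def zFieldT (u ut utt : ℝ → ℝ → ℝ) : ℝ → ℝ → ℝ := fun t x ↦
  deriv (u t) x + t * deriv (ut t) x + x * utt t x

/-- `∂_x Z u`. -/
def zFieldX (u ut : ℝ → ℝ → ℝ) : ℝ → ℝ → ℝ := fun t x ↦
  t * deriv (deriv (u t)) x + ut t x + x * deriv (ut t) x

/-- The derivative of the cubic nonlinearity. -/
def Cubic.evalDeriv (N : Cubic) (y z : Fin 5 → ℝ) : ℝ :=
  ∑ d ∈ N.index, N.c d * (z (N.i d) * (y (N.j d) * y (N.l d))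
    + y (N.i d) * (z (N.j d) * y (N.l d) + y (N.j d) * z (N.l d)))

theorem Cubic.isDerivT_eval (N : Cubic) {F F' : Fin 5 → ℝ → ℝ → ℝ} (h : ∀ m, IsDerivT T (F m) (F' m)) :
    IsDerivT T (fun t x ↦ N.eval fun m ↦ F m t x) (fun t x ↦ N.evalDeriv (fun m ↦ F m t x) (fun m ↦ F' m t x)) :=
  IsDerivT.sum fun _ _ ↦ ((h _).mul ((h _).mul (h _))).const_mul _

theorem Cubic.isDerivX_eval (N : Cubic) {F F' : Fin 5 → ℝ → ℝ → ℝ} (h : ∀ m, IsDerivX T (F m) (F' m)) :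
    IsDerivX T (fun t x ↦ N.eval fun m ↦ F m t x) (fun t x ↦ N.evalDeriv (fun m ↦ F m t x) (fun m ↦ F' m t x)) :=
  IsDerivX.sum fun _ _ ↦ ((h _).mul ((h _).mul (h _))).const_mul _

theorem Cubic.contStrip_evalDeriv (N : Cubic) {F F' : Fin 5 → ℝ → ℝ → ℝ} (h : ∀ m, ContStrip T (F m))
    (h' : ∀ m, ContStrip T (F' m)) :
    ContStrip T (fun t x ↦ N.evalDeriv (fun m ↦ F m t x) (fun m ↦ F' m t x)) :=
  ContStrip.sum fun _ _ ↦ (((h' _).mul ((h _).mul (h _))).add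
    ((h _).mul (((h' _).mul (h _)).add ((h _).mul (h' _))))).const_mul _

theorem isDerivT_jet (h0 : XSmooth T 2 u) (h1 : XSmooth T 2 ut) (h2 : XSmooth T 1 utt) (d0 : IsDerivT T u ut)
    (d1 : IsDerivT T ut utt) (m : Fin 5) : IsDerivT T (jet u ut m) (jet ut utt m) := by
  fin_cases m
  · exact d0
  · exact d1.deriv (h1.mono (by omega)) h2
  · exact d0.deriv_deriv h0 h1
  · exact d1
  · exact d0.deriv (h0.mono (by omega)) (h1.mono (by omega))

theorem isDerivT_time : IsDerivT T (fun t _ ↦ t) (fun _ _ ↦ 1) := fun t _ _ ↦ hasDerivWithinAt_id t _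

theorem isDerivT_space : IsDerivT T (fun _ x ↦ x) (fun _ _ ↦ 0) := fun t _ x ↦ hasDerivWithinAt_const t _ x

theorem isDerivX_time : IsDerivX T (fun t _ ↦ t) (fun _ _ ↦ 0) := fun t _ x ↦ hasDerivAt_const x t

theorem isDerivX_space : IsDerivX T (fun _ x ↦ x) (fun _ _ ↦ 1) := fun _ _ x ↦ hasDerivAt_id x

theorem contStrip_time : ContStrip T (fun t _ ↦ t) := contStrip_of_continuous continuous_fst

theorem contStrip_space : ContStrip T (fun _ x ↦ x) := contStrip_of_continuous continuous_snd

/-- `∂_t ^ 3 u`, from the equation. -/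
def thirdTimeDeriv (N : Cubic) (u ut utt : ℝ → ℝ → ℝ) : ℝ → ℝ → ℝ := fun t x ↦
  deriv (deriv (ut t)) x - ut t x + N.evalDeriv (fun m ↦ jet u ut m t x) (fun m ↦ jet ut utt m t x)

/-- A third time derivative is not part of the solution class: the equation expresses `∂_t ^ 2 u`
through quantities differentiable in time. -/
theorem RegularSolution.isDerivT_utt (hu : RegularSolution T (n + 1) N u ut utt) :
    IsDerivT T utt (thirdTimeDeriv N u ut utt) := by
  have s0 : XSmooth T 2 u := hu.smooth.mono (by omega)
  have s1 : XSmooth T 2 ut := hu.smooth_t.mono (by omega)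
  exact (((hu.deriv_t.deriv_deriv s0 s1).sub hu.deriv_t).add (N.isDerivT_eval
    (isDerivT_jet s0 s1 (hu.smooth_tt.mono (by omega)) hu.deriv_t hu.deriv_tt))).congr hu.eq fun _ _ _ ↦ rfl

theorem RegularSolution.deriv_utt (hu : RegularSolution T (n + 1) N u ut utt) {t : ℝ} (ht : t ∈ Set.Icc 1 T)
    (x : ℝ) : deriv (utt t) x = deriv (deriv (deriv (u t))) x - deriv (u t) x
      + N.evalDeriv (fun m ↦ jet u ut m t x) (fun m ↦ deriv (jet u ut m t) x) := by
  have s0 : XSmooth T (2 + 1) u := hu.smooth.mono (by omega)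
  have h : IsDerivX T utt _ := ((s0.deriv.deriv.isDerivX_deriv.sub (s0.isDerivX_deriv)).add (N.isDerivX_eval fun m ↦
    (xSmooth_jet hu.smooth hu.smooth_t m).isDerivX_deriv)).congr hu.eq fun _ _ _ ↦ rfl
  exact h.dx_eq ht x

theorem RegularSolution.waveJet_zField (hu : RegularSolution T (n + 1) N u ut utt) :
    WaveJet T (zField u ut) (zFieldT u ut utt) (zFieldX u ut)
      (fun t x ↦ 2 * deriv (ut t) x + t * deriv (utt t) x + x * thirdTimeDeriv N u ut utt t x)
      (fun t x ↦ deriv (deriv (u t)) x + t * deriv (deriv (ut t)) x + utt t x + x * deriv (utt t) x)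
      (fun t x ↦ t * deriv (deriv (deriv (u t))) x + 2 * deriv (ut t) x + x * deriv (deriv (ut t)) x) := by
  have s0 : XSmooth T (2 + 1) u := hu.smooth.mono (by omega)
  have s1 : XSmooth T (1 + 1) ut := hu.smooth_t.mono (by omega)
  have s2 : XSmooth T (0 + 1) utt := hu.smooth_tt.mono (by omega)
  have dux := hu.deriv_t.deriv (s0.mono (by omega)) (s1.mono (by omega))
  have duxx := hu.deriv_t.deriv_deriv (s0.mono (by omega)) s1
  have dutx := hu.deriv_tt.deriv (s1.mono (by omega)) s2
  have duttt := hu.isDerivT_utt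
  have cuttt : ContStrip T (thirdTimeDeriv N u ut utt) :=
    (s1.deriv.deriv.cont.sub s1.cont).add (N.contStrip_evalDeriv
      (fun m ↦ (xSmooth_jet hu.smooth hu.smooth_t m).cont)
      (fun m ↦ (xSmooth_jet (u := ut) (ut := utt) (s1) (s2) m).cont))
  refine ⟨?_, ?_, ?_, ?_, ?_, ?_, ?_, ?_, ?_, ?_, ?_, ?_⟩
  · refine ((isDerivT_time.mul dux).add (isDerivT_space.mul hu.deriv_tt)).congr (fun _ _ _ ↦ rfl) fun t _ x ↦ ?_
    simp only [zFieldT]; ring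
  · refine ((isDerivX_time.mul s0.deriv.isDerivX_deriv).add (isDerivX_space.mul s1.isDerivX_deriv)).congr
      (fun _ _ _ ↦ rfl) fun t _ x ↦ ?_
    simp only [zFieldX]; ring
  · refine ((dux.add (isDerivT_time.mul dutx)).add (isDerivT_space.mul duttt)).congr (fun _ _ _ ↦ rfl)
      fun t _ x ↦ ?_
    ring
  · refine ((s0.deriv.isDerivX_deriv.add (isDerivX_time.mul s1.deriv.isDerivX_deriv)).add
      (isDerivX_space.mul s2.isDerivX_deriv)).congr (fun _ _ _ ↦ rfl) fun t _ x ↦ ?_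
    ring
  · refine (((isDerivT_time.mul duxx).add hu.deriv_tt).add (isDerivT_space.mul dutx)).congr (fun _ _ _ ↦ rfl)
      fun t _ x ↦ ?_
    ring
  · refine (((isDerivX_time.mul s0.deriv.deriv.isDerivX_deriv).add s1.isDerivX_deriv).add
      (isDerivX_space.mul s1.deriv.isDerivX_deriv)).congr (fun _ _ _ ↦ rfl) fun t _ x ↦ ?_
    ring
  · exact (contStrip_time.mul s0.deriv.cont).add (contStrip_space.mul s1.cont)
  · exact (s0.deriv.cont.add (contStrip_time.mul s1.deriv.cont)).add (contStrip_space.mul s2.cont)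
  · exact ((contStrip_time.mul s0.deriv.deriv.cont).add s1.cont).add (contStrip_space.mul s1.deriv.cont)
  · exact ((s1.deriv.cont.const_mul 2).add (contStrip_time.mul s2.deriv.cont)).add (contStrip_space.mul cuttt)
  · exact ((s0.deriv.deriv.cont.add (contStrip_time.mul s1.deriv.deriv.cont)).add s2.cont).add
      (contStrip_space.mul s2.deriv.cont)
  · exact ((contStrip_time.mul s0.deriv.deriv.deriv.cont).add (s1.deriv.cont.const_mul 2)).add
      (contStrip_space.mul s1.deriv.deriv.cont)

/-- The second time derivative is bounded in `L^2` through the equation. -/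
theorem RegularSolution.l2_utt (hu : RegularSolution T n N u ut utt) {t S E : ℝ} (hS : 0 ≤ S) (hE : 0 ≤ E)
    (hNS : N.size * (S * S) ≤ 1) (ht : t ∈ Set.Icc 1 T) (hB : JetBound n M S E (u t) (ut t)) :
    L2Le (utt t) (3 * E) := by
  have tame : ∀ m, Tame S E M 0 (jet u ut m t) := fun m ↦ by
    simpa only [iteratedDeriv_zero] using hu.tame_jet ht hB (m := 0) (by omega) m
  have hprod : ∀ d, L2Le (fun x ↦ jet u ut (N.i d) t x * (jet u ut (N.j d) t x * jet u ut (N.l d) t x)) (S * S * E) :=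
    fun d ↦ (tame _).mul_mul hS (tame _) (tame _) (by omega)
  have cprod : ∀ d, Continuous (fun x ↦ jet u ut (N.i d) t x * (jet u ut (N.j d) t x * jet u ut (N.l d) t x)) :=
    fun d ↦ (tame _).cont.mul ((tame _).cont.mul (tame _).cont)
  have hsum := L2Le.sum (s := N.index) (f := fun d x ↦ N.c d *
    (jet u ut (N.i d) t x * (jet u ut (N.j d) t x * jet u ut (N.l d) t x)))
    (K := fun d ↦ |N.c d| * (S * S * E)) (fun d _ ↦ continuous_const.mul (cprod d))
    (fun d _ ↦ (hprod d).const_mul _) (fun d _ ↦ by positivity)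
  have csum : Continuous fun x ↦ ∑ d ∈ N.index, N.c d *
    (jet u ut (N.i d) t x * (jet u ut (N.j d) t x * jet u ut (N.l d) t x)) :=
    continuous_finsetSum _ fun d _ ↦ continuous_const.mul (cprod d)
  rw [funext (hu.eq t ht)]
  refine (((tame 2).l2.sub (tame 2).cont (tame 0).cont (tame 0).l2 hE hE).add ((tame 2).cont.sub (tame 0).cont) csum
    hsum (by positivity) (Finset.sum_nonneg fun d _ ↦ by positivity)).mono ?_
  rw [← Finset.sum_mul]
  have : N.size * (S * S) * E ≤ 1 * E := by gcongr
  simp only [Cubic.size] at this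
  linarith

/-- Since `Z` commutes with `∂_t ^ 2 - ∂_x ^ 2`, it falls on the cubic term by the product rule.
From `[∂_x, Z] = ∂_t` and `[∂_t, Z] = ∂_x`, applying `Z` to a component of the jet gives the same
derivative of `Z u` plus a commutator. The second derivatives of `Z u` enter the linearized
operator, and the rest is bounded in `L^2`. -/
theorem RegularSolution.linearized_zField_le (hu : RegularSolution T (n + 1) N u ut utt) {t S E : ℝ} (hS : 0 ≤ S)
    (hE : 0 ≤ E) (hNS : N.size * (S * S) ≤ 1) (ht : t ∈ Set.Icc 1 T) (hB : JetBound (n + 1) M S E (u t) (ut t))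
    (hv : L2Le (zField u ut t) E) (hvt : L2Le (zFieldT u ut utt t) E) (hvx : L2Le (zFieldX u ut t) E) :
    L2Le (linearized N u ut 0 (zField u ut)
      (fun t x ↦ 2 * deriv (ut t) x + t * deriv (utt t) x + x * thirdTimeDeriv N u ut utt t x)
      (fun t x ↦ deriv (deriv (u t)) x + t * deriv (deriv (ut t)) x + utt t x + x * deriv (utt t) x)
      (fun t x ↦ t * deriv (deriv (deriv (u t))) x + 2 * deriv (ut t) x + x * deriv (deriv (ut t)) x) t)
      (N.size * (12 * (S * S * E))) := by
  have tame : ∀ m, Tame S E M 0 (jet u ut m t) := fun m ↦ by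
    simpa only [iteratedDeriv_zero] using hu.tame_jet ht hB (m := 0) (by omega) m
  have hutt := hu.l2_utt hS hE hNS ht hB
  have hw := hu.waveJet_zField
  have cv := hw.cont_v.continuous ht
  have cvt := hw.cont_vt.continuous ht
  have cvx := hw.cont_vx.continuous ht
  have cutt := hu.smooth_tt.cont.continuous ht
  set F : Fin 5 → ℝ → ℝ := fun m ↦ jet u ut m t
  -- Entries `1` and `2` are the commutators `-(u_xx + u_tt)` and `-2 u_tx`. Each entry is at most
  -- `4 * E` in `L^2`, the extreme case being `u_tt`, bounded by `3 * E`; three such terms give the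
  -- constant `12`.
  set G : Fin 5 → ℝ → ℝ := ![zField u ut t, fun x ↦ -(F 2 x + utt t x), fun x ↦ -(F 1 x + F 1 x),
    fun x ↦ zFieldT u ut utt t x - F 4 x, fun x ↦ zFieldX u ut t x - F 3 x]
  have hG : ∀ m, Continuous (G m) ∧ L2Le (G m) (4 * E) := by
    intro m
    have t1 := tame 1
    have t2 := tame 2
    have t3 := tame 3
    have t4 := tame 4
    fin_cases m
    · exact ⟨cv, hv.mono (by linarith)⟩
    · exact ⟨(t2.cont.add cutt).neg, ((t2.l2.add t2.cont cutt hutt hE (by positivity)).neg).mono (by linarith)⟩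
    · exact ⟨(t1.cont.add t1.cont).neg, ((t1.l2.add t1.cont t1.cont t1.l2 hE hE).neg).mono (by linarith)⟩
    · exact ⟨cvt.sub t4.cont, (hvt.sub cvt t4.cont t4.l2 hE hE).mono (by linarith)⟩
    · exact ⟨cvx.sub t3.cont, (hvx.sub cvx t3.cont t3.l2 hE hE).mono (by linarith)⟩
  have hSS : 0 ≤ S * S := by positivity
  have b2 : ∀ p q x, |F p x * F q x| ≤ S * S := fun p q x ↦ by
    rw [abs_mul]
    have h1 := (tame p).sup (by omega) x
    have h2 := (tame q).sup (by omega) x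
    gcongr
  set r : (Fin 5 →₀ ℕ) → ℝ → ℝ := fun d x ↦ (F (N.j d) x * F (N.l d) x) * G (N.i d) x
    + (F (N.i d) x * F (N.l d) x) * G (N.j d) x + (F (N.i d) x * F (N.j d) x) * G (N.l d) x
  have hterm : ∀ p q m, Continuous (fun x ↦ (F p x * F q x) * G m x) ∧
      L2Le (fun x ↦ (F p x * F q x) * G m x) (S * S * (4 * E)) := fun p q m ↦
    ⟨((tame p).cont.mul (tame q).cont).mul (hG m).1, L2Le.of_abs_le hSS (hG m).2 fun x ↦ by
      rw [abs_mul]; gcongr; exact b2 p q x⟩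
  have hr : ∀ d, Continuous (r d) ∧ L2Le (r d) (12 * (S * S * E)) := fun d ↦ by
    obtain ⟨c1, l1⟩ := hterm (N.j d) (N.l d) (N.i d)
    obtain ⟨c2, l2⟩ := hterm (N.i d) (N.l d) (N.j d)
    obtain ⟨c3, l3⟩ := hterm (N.i d) (N.j d) (N.l d)
    refine ⟨(c1.add c2).add c3, ((l1.add c1 c2 l2 (by positivity) (by positivity)).add (c1.add c2) c3 l3
      (by positivity) (by positivity)).mono (le_of_eq (by ring))⟩
  have hsum := L2Le.sum (s := N.index) (f := fun d x ↦ N.c d * r d x)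
    (K := fun d ↦ |N.c d| * (12 * (S * S * E))) (fun d _ ↦ continuous_const.mul (hr d).1)
    (fun d _ ↦ (hr d).2.const_mul _) (fun d _ ↦ by positivity)
  rw [← Finset.sum_mul] at hsum
  refine le_trans (le_of_eq ?_) hsum
  congr 1
  funext x
  set vtx := deriv (deriv (u t)) x + t * deriv (deriv (ut t)) x + utt t x + x * deriv (utt t) x with hvtx
  set vxx := t * deriv (deriv (deriv (u t))) x + 2 * deriv (ut t) x + x * deriv (deriv (ut t)) x with hvxx
  have hZ : ∀ m, t * deriv (F m) x + x * jet ut utt m t x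
      = G m x + (if m = 1 then vtx else 0) + (if m = 2 then vxx else 0) := by
    intro m
    fin_cases m
    · change t * deriv (u t) x + x * ut t x = (t * deriv (u t) x + x * ut t x) + 0 + 0
      ring
    · change t * deriv (deriv (ut t)) x + x * deriv (utt t) x = -(deriv (deriv (u t)) x + utt t x) + vtx + 0
      rw [hvtx]; ring
    · change t * deriv (deriv (deriv (u t))) x + x * deriv (deriv (ut t)) x
        = -(deriv (ut t) x + deriv (ut t) x) + 0 + vxx
      rw [hvxx]; ring
    · change t * deriv (ut t) x + x * utt t x
        = (deriv (u t) x + t * deriv (ut t) x + x * utt t x - deriv (u t) x) + 0 + 0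
      ring
    · change t * deriv (deriv (u t)) x + x * deriv (ut t) x
        = (t * deriv (deriv (u t)) x + ut t x + x * deriv (ut t) x - ut t x) + 0 + 0
      ring
  have hdiff : t * N.evalDeriv (fun m ↦ F m x) (fun m ↦ deriv (F m) x)
      + x * N.evalDeriv (fun m ↦ F m x) (fun m ↦ jet ut utt m t x)
      = (∑ d ∈ N.index, N.c d * r d x) + N.coef 1 (fun m ↦ F m x) (fun m ↦ F m x) * vtx
        + N.coef 2 (fun m ↦ F m x) (fun m ↦ F m x) * vxx := by
    simp only [Cubic.evalDeriv, Cubic.coef, Finset.mul_sum, Finset.sum_mul, ← Finset.sum_add_distrib]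
    refine Finset.sum_congr rfl fun d _ ↦ ?_
    have e1 := hZ (N.i d)
    have e2 := hZ (N.j d)
    have e3 := hZ (N.l d)
    simp only [(N.hj d).1, (N.hj d).2, if_false, add_zero] at e2
    simp only [(N.hl d).1, (N.hl d).2, if_false, add_zero] at e3
    have i1 : (if N.i d = 1 then N.c d else 0) * vtx * (F (N.j d) x * F (N.l d) x)
        = N.c d * (if N.i d = 1 then vtx else 0) * (F (N.j d) x * F (N.l d) x) := by
      split_ifs <;> ring
    have i2 : (if N.i d = 2 then N.c d else 0) * vxx * (F (N.j d) x * F (N.l d) x)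
        = N.c d * (if N.i d = 2 then vxx else 0) * (F (N.j d) x * F (N.l d) x) := by
      split_ifs <;> ring
    simp only [r]
    linear_combination (N.c d * (F (N.j d) x * F (N.l d) x)) * e1 + (N.c d * (F (N.i d) x * F (N.l d) x)) * e2
      + (N.c d * (F (N.i d) x * F (N.j d) x)) * e3 - i1 - i2
  have e1 := hu.deriv_utt ht x
  simp only [linearized, add_zero]
  change _ - _ * vtx - _ * vxx = _
  rw [e1]
  simp only [thirdTimeDeriv, zField]
  rw [hvxx] at hdiff ⊢
  linear_combination hdiff

/-- The energy estimate for `Z u`. -/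
theorem RegularSolution.energy_zField_le (hu : RegularSolution T (n + 1) N u ut utt) (hT : 1 ≤ T)
    {α κ σ δ κ₁ : ℝ} (hα : 0 ≤ α) (hκ : 0 ≤ κ) (hσ : 0 < σ) (hδ : 0 < δ) (hδ2 : δ ≤ 1 / 2) (hκ₁ : 0 ≤ κ₁)
    (hB : Bootstrap T (n + 1) M α κ σ u ut utt) (hαδ : N.size * 12 * α ^ 2 ≤ δ)
    (hvb : ∀ t ∈ Set.Icc 1 T, L2Le (zField u ut t) (κ * t ^ σ))
    (hvtb : ∀ t ∈ Set.Icc 1 T, L2Le (zFieldT u ut utt t) (κ * t ^ σ))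
    (hvxb : ∀ t ∈ Set.Icc 1 T, L2Le (zFieldX u ut t) (κ * t ^ σ))
    (h1 : L2Le (zField u ut 1) κ₁) (h1t : L2Le (zFieldT u ut utt 1) κ₁) (h1x : L2Le (zFieldX u ut 1) κ₁)
    {t K : ℝ} (ht : t ∈ Set.Icc 1 T) (hK : 0 ≤ K)
    (hKb : 12 * κ₁ ^ 2 + 18 * δ * κ ^ 2 * t ^ (2 * σ) / σ ≤ K ^ 2) :
    L2Le (zField u ut t) K ∧ L2Le (zFieldT u ut utt t) K ∧ L2Le (zFieldX u ut t) K := by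
  have hN := N.size_nonneg
  have hNα : 0 ≤ N.size * α ^ 2 := by positivity
  refine hu.energy_le (h := 0) hT hκ hσ hδ hδ2 hκ₁ hB (by linarith) hu.waveJet_zField hvb hvtb hvxb
    (fun t ht ↦ ?_) h1 h1t h1x ht hK hKb
  have ht0 : 0 < t := by linarith [ht.1]
  have hE : 0 ≤ κ * t ^ σ := mul_nonneg hκ (Real.rpow_nonneg ht0.le _)
  have hNS : N.size * (α ^ 2 / t) ≤ 1 := by
    rw [mul_div_assoc', div_le_one ht0]
    linarith [ht.1]
  have := hu.linearized_zField_le (mul_nonneg hα (Real.rpow_nonneg ht0.le _)) hE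
    (by rw [sq_mul_rpow_neg_half ht.1]; exact hNS) ht (hB.bound t ht) (hvb t ht) (hvtb t ht) (hvxb t ht)
  refine this.mono ?_
  rw [sq_mul_rpow_neg_half ht.1]
  have h2 : N.size * (12 * (α ^ 2 / t * (κ * t ^ σ))) = N.size * 12 * α ^ 2 / t * (κ * t ^ σ) := by ring
  rw [h2]
  gcongr

end

section

/-! ### Extraction of bounds from the norms -/

/-- Each sup estimate costs one derivative, so the orders `M + 2`, `M + 1` and `0` require `ρ`, `ρ -
1` and `ρ - 2` to be at least `M + 3`, `M + 2` and `1`. -/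
theorem exists_sup_le_of_wNorm_le {M ρ : ℕ} (hρ : M + 3 ≤ ρ) : ∃ C : ℝ, 0 ≤ C ∧
    ∀ (T : ℝ) (u : ℝ → ℝ → ℝ) (t R : ℝ), 0 ≤ R → ContDiff ℝ (M + 2 : ℕ) (u t) → ContDiff ℝ (M + 1 : ℕ) (dt T u t) →
      Continuous (dt T (dt T u) t) → wNorm T ρ u t ≤ ENNReal.ofReal R →
      (∀ m ≤ M + 2, ∀ x, |iteratedDeriv m (u t) x| ≤ C * R) ∧
      (∀ m ≤ M + 1, ∀ x, |iteratedDeriv m (dt T u t) x| ≤ C * R) ∧ ∀ x, |dt T (dt T u) t x| ≤ C * R := by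
  have h0 : ∀ m : ℕ, ∃ C : ℝ, 0 ≤ C ∧ (m ≤ M + 2 → ∀ f : ℝ → ℝ, ContDiff ℝ m f → ∀ x,
      ENNReal.ofReal |iteratedDeriv m f x| ≤ ENNReal.ofReal C * besselNorm ((ρ : ℝ) - (0 : ℕ)) ⊤ f) := by
    intro m
    by_cases hm : m ≤ M + 2
    · have : (m : ℝ) + 1 ≤ (ρ : ℝ) - (0 : ℕ) := by
        have : m + 1 ≤ ρ := by omega
        push_cast; rw [sub_zero]; exact_mod_cast this
      obtain ⟨C, hC, h⟩ := exists_abs_iteratedDeriv_le_besselNorm_top this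
      exact ⟨C, hC, fun _ ↦ h⟩
    -- The default value zero outside the range lets the constants be chosen for all orders and
    -- summed.
    · exact ⟨0, le_rfl, fun h ↦ absurd h hm⟩
  have h1 : ∀ m : ℕ, ∃ C : ℝ, 0 ≤ C ∧ (m ≤ M + 1 → ∀ f : ℝ → ℝ, ContDiff ℝ m f → ∀ x,
      ENNReal.ofReal |iteratedDeriv m f x| ≤ ENNReal.ofReal C * besselNorm ((ρ : ℝ) - (1 : ℕ)) ⊤ f) := by
    intro m
    by_cases hm : m ≤ M + 1
    · have : (m : ℝ) + 1 ≤ (ρ : ℝ) - (1 : ℕ) := by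
        have : ((m + 2 : ℕ) : ℝ) ≤ (ρ : ℕ) := by exact_mod_cast (by omega : m + 2 ≤ ρ)
        push_cast at this ⊢; linarith
      obtain ⟨C, hC, h⟩ := exists_abs_iteratedDeriv_le_besselNorm_top this
      exact ⟨C, hC, fun _ ↦ h⟩
    · exact ⟨0, le_rfl, fun h ↦ absurd h hm⟩
  have h2 : ((0 : ℕ) : ℝ) + 1 ≤ (ρ : ℝ) - (2 : ℕ) := by
    have : ((3 : ℕ) : ℝ) ≤ (ρ : ℕ) := by exact_mod_cast (by omega : 3 ≤ ρ)
    push_cast at this ⊢; linarith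
  choose C0 hC0 h0 using h0
  choose C1 hC1 h1 using h1
  obtain ⟨C2, hC2, h2⟩ := exists_abs_iteratedDeriv_le_besselNorm_top h2
  set D0 := ∑ m ∈ Finset.range (M + 3), C0 m
  set D1 := ∑ m ∈ Finset.range (M + 3), C1 m
  have hD0 : 0 ≤ D0 := Finset.sum_nonneg fun m _ ↦ hC0 m
  have hD1 : 0 ≤ D1 := Finset.sum_nonneg fun m _ ↦ hC1 m
  refine ⟨D0 + D1 + C2, by positivity, fun T u t R hR c0 c1 c2 hw ↦ ?_⟩
  have hi : ∀ i < 3, besselNorm ((ρ : ℝ) - (i : ℕ)) ⊤ ((dt T)^[i] u t) ≤ ENNReal.ofReal R := fun i hi ↦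
    le_trans (Finset.single_le_sum (f := fun i : ℕ ↦ besselNorm ((ρ : ℝ) - (i : ℝ)) ⊤ ((dt T)^[i] u t))
      (fun _ _ ↦ zero_le) (Finset.mem_range.2 hi)) hw
  have conv : ∀ {y C : ℝ} {b : ℝ≥0∞}, 0 ≤ C → ENNReal.ofReal |y| ≤ ENNReal.ofReal C * b → b ≤ ENNReal.ofReal R →
      C ≤ D0 + D1 + C2 → |y| ≤ (D0 + D1 + C2) * R := by
    intro y C b hC h hb hCD
    have h3 : ENNReal.ofReal |y| ≤ ENNReal.ofReal (C * R) := by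
      rw [ENNReal.ofReal_mul hC]
      exact h.trans (by gcongr)
    exact ((ENNReal.ofReal_le_ofReal_iff (by positivity)).1 h3).trans (by gcongr)
  refine ⟨fun m hm x ↦ ?_, fun m hm x ↦ ?_, fun x ↦ ?_⟩
  · refine conv (hC0 m) (h0 m hm _ (c0.of_le (by exact_mod_cast hm)) x) (hi 0 (by norm_num)) ?_
    have : C0 m ≤ D0 := Finset.single_le_sum (fun i _ ↦ hC0 i) (Finset.mem_range.2 (by omega))
    linarith
  · refine conv (hC1 m) (h1 m hm _ (c1.of_le (by exact_mod_cast hm)) x) (hi 1 (by norm_num)) ?_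
    have : C1 m ≤ D1 := Finset.single_le_sum (fun i _ ↦ hC1 i) (Finset.mem_range.2 (by omega))
    linarith
  · have := h2 (dt T (dt T u) t) (contDiff_zero.2 c2) x
    simp only [iteratedDeriv_zero] at this
    exact conv hC2 this (hi 2 (by norm_num)) (by linarith)

theorem L2Le.of_energy_le {T t K : ℝ} {v : ℝ → ℝ → ℝ} (h : energy T v t ≤ ENNReal.ofReal K) :
    L2Le (v t) K ∧ L2Le (dt T v t) K ∧ L2Le (dx v t) K := by
  have key : ∀ a b : ℝ≥0∞, a ^ 2 ≤ b → a ≤ b ^ (1 / 2 : ℝ) := by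
    intro a b hab
    calc a = (a ^ 2) ^ (1 / 2 : ℝ) := by
          rw [← ENNReal.rpow_natCast, ← ENNReal.rpow_mul]; norm_num
      _ ≤ _ := by gcongr
  refine ⟨le_trans (key _ _ ?_) h, le_trans (key _ _ ?_) h, le_trans (key _ _ ?_) h⟩
  · exact le_add_self
  · exact le_self_add.trans le_self_add
  · exact le_add_self.trans le_self_add

theorem energy_le_of_l2Le {T t K : ℝ} {v : ℝ → ℝ → ℝ} (hK : 0 ≤ K) (h0 : L2Le (v t) K) (h1 : L2Le (dt T v t) K)
    (h2 : L2Le (dx v t) K) : energy T v t ≤ ENNReal.ofReal (2 * K) := by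
  have : eLpNorm (dt T v t) 2 ^ 2 + eLpNorm (dx v t) 2 ^ 2 + eLpNorm (v t) 2 ^ 2 ≤ ENNReal.ofReal (2 * K) ^ 2 := by
    calc _ ≤ ENNReal.ofReal K ^ 2 + ENNReal.ofReal K ^ 2 + ENNReal.ofReal K ^ 2 := by
          gcongr
          exacts [h1, h2, h0]
      _ = ENNReal.ofReal (K ^ 2 + K ^ 2 + K ^ 2) := by
          rw [ENNReal.ofReal_add (by positivity) (by positivity), ENNReal.ofReal_add (by positivity) (by positivity),
            ENNReal.ofReal_pow hK]
      _ ≤ ENNReal.ofReal ((2 * K) ^ 2) := ENNReal.ofReal_le_ofReal (by nlinarith [sq_nonneg K])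
      _ = _ := ENNReal.ofReal_pow (by positivity) 2
  calc energy T v t ≤ (ENNReal.ofReal (2 * K) ^ 2) ^ (1 / 2 : ℝ) := by
        unfold energy
        gcongr
    _ = ENNReal.ofReal (2 * K) := by
        rw [← ENNReal.rpow_natCast, ← ENNReal.rpow_mul]; norm_num

theorem energySum_le_of_forall_energy_le {T t K : ℝ} {Γ : (ℝ → ℝ → ℝ) → ℝ → ℝ → ℝ} {m : ℕ} {u : ℝ → ℝ → ℝ}
    (h : ∀ k ≤ m, energy T (Γ^[k] u) t ≤ ENNReal.ofReal K) :
    energySum T Γ m u t ≤ ENNReal.ofReal ((m + 1 : ℕ) * K) := by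
  refine (Finset.sum_le_sum fun k hk ↦ h k (by rw [Finset.mem_range] at hk; omega)).trans ?_
  rw [Finset.sum_const, Finset.card_range, nsmul_eq_mul, ENNReal.ofReal_mul (Nat.cast_nonneg _), ENNReal.ofReal_natCast]

theorem energy_le_energySum {T t : ℝ} {Γ : (ℝ → ℝ → ℝ) → ℝ → ℝ → ℝ} {m : ℕ} {u : ℝ → ℝ → ℝ} {k : ℕ} (hk : k ≤ m) :
    energy T (Γ^[k] u) t ≤ energySum T Γ m u t :=
  Finset.single_le_sum (f := fun k ↦ energy T (Γ^[k] u) t) (fun _ _ ↦ zero_le) (Finset.mem_range.2 (by omega))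

theorem iterate_dx_eq (u : ℝ → ℝ → ℝ) (k : ℕ) : dx^[k] u = fun t ↦ iteratedDeriv k (u t) := by
  induction k with
  | zero => simp
  | succ k ih =>
    rw [Function.iterate_succ_apply', ih]
    funext t x
    rw [iteratedDeriv_succ]
    rfl

variable {T : ℝ} {n M : ℕ} {N : Cubic} {u ut utt : ℝ → ℝ → ℝ}

theorem dt_iterate_dx_eq (hT : 1 < T) (h0 : XSmooth T n u) (h1 : XSmooth T n ut) (h : IsDerivT T u ut) {k : ℕ}
    (hk : k ≤ n) {t : ℝ} (ht : t ∈ Set.Icc 1 T) : dt T (dx^[k] u) t = iteratedDeriv k (ut t) := by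
  rw [iterate_dx_eq]
  exact funext fun x ↦ (h.iteratedDeriv h0 h1 hk).dt_eq hT ht x

theorem dx_iterate_dx_eq (u : ℝ → ℝ → ℝ) (k : ℕ) (t : ℝ) : dx (dx^[k] u) t = iteratedDeriv (k + 1) (u t) := by
  rw [← Function.iterate_succ_apply' dx, iterate_dx_eq]

/-! ### The initial data -/

theorem L2Le.of_sobolevNorm_le {f : ℝ → ℝ} {m j : ℕ} (hj : j ≤ m) (hf : ContDiff ℝ j f) {ε : ℝ} (hε : 0 ≤ ε)
    (h : sobolevNorm m f ≤ 1) : L2Le (fun x ↦ ε * iteratedDeriv j f x) ε := by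
  have h1 : L2Le (iteratedDeriv j f) 1 := by
    unfold L2Le
    rw [ENNReal.ofReal_one]
    exact (eLpNorm_iteratedDeriv_le_sobolevNorm hj hf).trans h
  simpa [abs_of_nonneg hε] using h1.const_mul ε

/-- The initial bounds for a solution with weighted data. -/
theorem RegularSolution.initial_bounds (hu : RegularSolution T (n + 1) N u ut utt) (hT : 1 ≤ T) {ε S E : ℝ}
    (hε : 0 < ε) {u₀ u₁ : ℝ → ℝ} (hdata : NormalizedData (n + 1 + 2) u₀ u₁) (h0 : ∀ x, u 1 x = ε * u₀ x)
    (h1 : ∀ x, ut 1 x = ε * u₁ x) (hS : 0 ≤ S) (hNS : N.size * (S * S) ≤ 1)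
    (hB : JetBound (n + 1) M S E (u 1) (ut 1)) :
    (∀ m ≤ n + 1 + 2, L2Le (iteratedDeriv m (u 1)) ε) ∧ (∀ m ≤ n + 1 + 1, L2Le (iteratedDeriv m (ut 1)) ε) ∧
      L2Le (zField u ut 1) (9 * ε) ∧ L2Le (zFieldT u ut utt 1) (9 * ε) ∧ L2Le (zFieldX u ut 1) (9 * ε) := by
  have h1I : (1 : ℝ) ∈ Set.Icc 1 T := ⟨le_rfl, hT⟩
  unfold NormalizedData at hdata
  have n0 : sobolevNorm (n + 1 + 2 + 1) u₀ ≤ 1 := (le_self_add.trans (le_self_add.trans le_self_add)).trans hdata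
  have n1 : sobolevNorm (n + 1 + 2) u₁ ≤ 1 := (le_add_self.trans (le_self_add.trans le_self_add)).trans hdata
  have n2 : sobolevNorm 2 (fun x ↦ x * u₀ x) ≤ 1 := (le_add_self.trans le_self_add).trans hdata
  have n3 : sobolevNorm 1 (fun x ↦ x * u₁ x) ≤ 1 := le_add_self.trans hdata
  have c0 := hu.smooth.contDiff 1 h1I
  have c1 := hu.smooth_t.contDiff 1 h1I
  have cu : ContDiff ℝ (n + 1 + 2 : ℕ) u₀ := by
    have : u₀ = fun x ↦ ε⁻¹ * u 1 x := by
      funext x; rw [h0]; field_simp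
    rw [this]
    exact contDiff_const.mul c0
  have cv : ContDiff ℝ (n + 1 + 1 : ℕ) u₁ := by
    have : u₁ = fun x ↦ ε⁻¹ * ut 1 x := by
      funext x; rw [h1]; field_simp
    rw [this]
    exact contDiff_const.mul c1
  have e0 : ∀ m, iteratedDeriv m (u 1) = fun x ↦ ε * iteratedDeriv m u₀ x := fun m ↦ by
    rw [show u 1 = fun x ↦ ε * u₀ x from funext h0]
    funext x
    exact iteratedDeriv_const_mul_field _ _
  have e1 : ∀ m, iteratedDeriv m (ut 1) = fun x ↦ ε * iteratedDeriv m u₁ x := fun m ↦ by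
    rw [show ut 1 = fun x ↦ ε * u₁ x from funext h1]
    funext x
    exact iteratedDeriv_const_mul_field _ _
  have L0 : ∀ m ≤ n + 1 + 2, L2Le (iteratedDeriv m (u 1)) ε := fun m hm ↦ by
    rw [e0]
    exact L2Le.of_sobolevNorm_le (by omega) (cu.of_le (by exact_mod_cast hm)) hε.le n0
  have L1 : ∀ m ≤ n + 1 + 1, L2Le (iteratedDeriv m (ut 1)) ε := fun m hm ↦ by
    rw [e1]
    exact L2Le.of_sobolevNorm_le (by omega) (cv.of_le (by exact_mod_cast hm)) hε.le n1
  have k0 : ∀ m ≤ n + 1 + 2, Continuous (iteratedDeriv m (u 1)) := fun m hm ↦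
    c0.continuous_iteratedDeriv m (by exact_mod_cast hm)
  have k1 : ∀ m ≤ n + 1 + 1, Continuous (iteratedDeriv m (ut 1)) := fun m hm ↦
    c1.continuous_iteratedDeriv m (by exact_mod_cast hm)
  have cxu : ContDiff ℝ 2 (fun x ↦ x * u 1 x) := contDiff_id.mul (c0.of_le (by norm_cast; omega))
  have cxv : ContDiff ℝ 1 (fun x ↦ x * ut 1 x) := contDiff_id.mul (c1.of_le (by norm_cast; omega))
  have cxu0 : ContDiff ℝ 2 (fun x ↦ x * u₀ x) := contDiff_id.mul (cu.of_le (by norm_cast; omega))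
  have cxv0 : ContDiff ℝ 1 (fun x ↦ x * u₁ x) := contDiff_id.mul (cv.of_le (by norm_cast; omega))
  have X0 : ∀ m ≤ 2, L2Le (iteratedDeriv m fun x ↦ x * u 1 x) ε := fun m hm ↦ by
    have : (fun x ↦ x * u 1 x) = fun x ↦ ε * (x * u₀ x) := by funext x; rw [h0]; ring
    rw [this, show iteratedDeriv m (fun x ↦ ε * (x * u₀ x)) = fun x ↦ ε * iteratedDeriv m (fun x ↦ x * u₀ x) x from
      funext fun x ↦ iteratedDeriv_const_mul_field _ _]
    exact L2Le.of_sobolevNorm_le hm (cxu0.of_le (by exact_mod_cast hm)) hε.le n2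
  have X1 : ∀ m ≤ 1, L2Le (iteratedDeriv m fun x ↦ x * ut 1 x) ε := fun m hm ↦ by
    have : (fun x ↦ x * ut 1 x) = fun x ↦ ε * (x * u₁ x) := by funext x; rw [h1]; ring
    rw [this, show iteratedDeriv m (fun x ↦ ε * (x * u₁ x)) = fun x ↦ ε * iteratedDeriv m (fun x ↦ x * u₁ x) x from
      funext fun x ↦ iteratedDeriv_const_mul_field _ _]
    exact L2Le.of_sobolevNorm_le hm (cxv0.of_le (by exact_mod_cast hm)) hε.le n3
  have s0 : XSmooth T (1 + 1) u := hu.smooth.mono (by omega)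
  have s1 : XSmooth T (0 + 1) ut := hu.smooth_t.mono (by omega)
  have D0 : ∀ x, HasDerivAt (u 1) (deriv (u 1) x) x := fun x ↦ s0.isDerivX_deriv 1 h1I x
  have D00 : ∀ x, HasDerivAt (deriv (u 1)) (deriv (deriv (u 1)) x) x := fun x ↦ s0.deriv.isDerivX_deriv 1 h1I x
  have D1 : ∀ x, HasDerivAt (ut 1) (deriv (ut 1) x) x := fun x ↦ s1.isDerivX_deriv 1 h1I x
  have dx0 : deriv (fun x ↦ x * u 1 x) = fun x ↦ u 1 x + x * deriv (u 1) x := funext fun x ↦ by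
    simpa using ((hasDerivAt_id' x).fun_mul (D0 x)).deriv
  have dx1 : deriv (fun x ↦ x * ut 1 x) = fun x ↦ ut 1 x + x * deriv (ut 1) x := funext fun x ↦ by
    simpa using ((hasDerivAt_id' x).fun_mul (D1 x)).deriv
  have dx00 : deriv (deriv (fun x ↦ x * u 1 x)) = fun x ↦ deriv (u 1) x + (deriv (u 1) x + x * deriv (deriv (u 1)) x) := by
    rw [dx0]
    funext x
    simpa using ((D0 x).fun_add ((hasDerivAt_id' x).fun_mul (D00 x))).deriv
  have l0 := L0 0 (by omega)
  have l01 := L0 1 (by omega)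
  have l02 := L0 2 (by omega)
  have l1 := L1 0 (by omega)
  have l11 := L1 1 (by omega)
  have x0 := X0 0 (by omega)
  have x01 := X0 1 (by omega)
  have x02 := X0 2 (by omega)
  have x1 := X1 0 (by omega)
  have x11 := X1 1 (by omega)
  have q0 := k0 0 (by omega)
  have q01 := k0 1 (by omega)
  have q02 := k0 2 (by omega)
  have q1 := k1 0 (by omega)
  have q11 := k1 1 (by omega)
  simp only [iteratedDeriv_succ', iteratedDeriv_zero] at l0 l01 l02 l1 l11 x0 x01 x02 x1 x11 q0 q01 q02 q1 q11
  rw [dx0] at x01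
  rw [dx00] at x02
  rw [dx1] at x11
  -- Weighted derivatives come from derivatives of weighted functions: `x f' = (x f)' - f` and `x
  -- f'' = (x f)'' - 2 f'`.
  have y01 : L2Le (fun x ↦ x * deriv (u 1) x) (2 * ε) := by
    have := x01.sub (by fun_prop) q0 l0 hε.le hε.le
    simp only [add_sub_cancel_left] at this
    exact this.mono (by linarith)
  have y11 : L2Le (fun x ↦ x * deriv (ut 1) x) (2 * ε) := by
    have := x11.sub (by fun_prop) q1 l1 hε.le hε.le
    simp only [add_sub_cancel_left] at this
    exact this.mono (by linarith)
  have y02 : L2Le (fun x ↦ x * deriv (deriv (u 1)) x) (3 * ε) := by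
    have h2 := x02.sub (by fun_prop) q01 l01 hε.le hε.le
    simp only [add_sub_cancel_left] at h2
    have := h2.sub (by fun_prop) q01 l01 (by positivity) hε.le
    simp only [add_sub_cancel_left] at this
    exact this.mono (by linarith)
  have tame : ∀ m, Tame S E M 0 (jet u ut m 1) := fun m ↦ by
    simpa only [iteratedDeriv_zero] using hu.tame_jet h1I hB (m := 0) (by omega) m
  have yF : ∀ m, L2Le (fun x ↦ x * jet u ut m 1 x) (3 * ε) := by
    intro m
    fin_cases m
    · exact x0.mono (by linarith)
    · exact y11.mono (by linarith)
    · exact y02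
    · exact x1.mono (by linarith)
    · exact y01.mono (by linarith)
  have hSS : 0 ≤ S * S := by positivity
  -- The weight `x` goes with the first factor, the only one that may be of second order; the other
  -- two are taken in the sup norm.
  have hterm : ∀ d, L2Le (fun x ↦ (jet u ut (N.j d) 1 x * jet u ut (N.l d) 1 x) * (x * jet u ut (N.i d) 1 x))
      (S * S * (3 * ε)) := fun d ↦ L2Le.of_abs_le hSS (yF _) fun x ↦ by
    rw [abs_mul, abs_mul]
    have b1 := (tame (N.j d)).sup (by omega) x
    have b2 := (tame (N.l d)).sup (by omega) x
    gcongr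
  have cterm : ∀ d, Continuous
      (fun x ↦ (jet u ut (N.j d) 1 x * jet u ut (N.l d) 1 x) * (x * jet u ut (N.i d) 1 x)) := fun d ↦
    ((tame _).cont.mul (tame _).cont).mul (continuous_id.mul (tame _).cont)
  have hsum := L2Le.sum (s := N.index) (fun d _ ↦ continuous_const.mul (cterm d))
    (fun d _ ↦ (hterm d).const_mul (N.c d)) (fun d _ ↦ by positivity)
  have csum : Continuous fun x ↦ ∑ d ∈ N.index, N.c d *
      ((jet u ut (N.j d) 1 x * jet u ut (N.l d) 1 x) * (x * jet u ut (N.i d) 1 x)) :=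
    continuous_finsetSum _ fun d _ ↦ continuous_const.mul (cterm d)
  have hsum' := hsum.mono (K' := 3 * ε) (by
    rw [← Finset.sum_mul]
    have : N.size * (S * S) * (3 * ε) ≤ 1 * (3 * ε) := by gcongr
    simp only [Cubic.size] at this
    linarith)
  -- By the equation at `t = 1`, the constant `7` is `3 + 1 + 3`, from `x u_xx`, `x u` and the cubic
  -- term.
  have ytt : L2Le (fun x ↦ x * utt 1 x) (7 * ε) := by
    have h2 := (y02.sub (by fun_prop) (by fun_prop) x0 (by positivity) hε.le).add (by fun_prop) csum hsum'
      (by positivity) (by positivity)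
    refine le_trans (le_of_eq ?_) (h2.mono (by linarith))
    congr 1
    funext x
    rw [hu.eq 1 h1I, Cubic.eval, mul_add, Finset.mul_sum, mul_sub]
    congr 1
    exact Finset.sum_congr rfl fun d _ ↦ by ring
  have ctt : Continuous (utt 1) := hu.smooth_tt.cont.continuous h1I
  refine ⟨L0, L1, ?_, ?_, ?_⟩
  · have := l01.add q01 (by fun_prop) x1 hε.le hε.le
    refine le_trans (le_of_eq ?_) (this.mono (by linarith : ε + ε ≤ 9 * ε))
    congr 1
    funext x
    simp only [zField, one_mul]
  · have := (l01.add q01 q11 l11 hε.le hε.le).add (by fun_prop) (by fun_prop) ytt (by positivity) (by positivity)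
    refine le_trans (le_of_eq ?_) (this.mono (by linarith : ε + ε + 7 * ε ≤ 9 * ε))
    congr 1
    funext x
    simp only [zFieldT, one_mul]
  · have := (l02.add q02 q1 l1 hε.le hε.le).add (by fun_prop) (by fun_prop) y11 (by positivity) (by positivity)
    refine le_trans (le_of_eq ?_) (this.mono (by linarith : ε + ε + 2 * ε ≤ 9 * ε))
    congr 1
    funext x
    simp only [zFieldX, one_mul]

end

section

/-! ### The propagation of the energy estimates -/

/-- The bootstrap step, with the conditions on the constants made explicit. -/
theorem RegularSolution.propagation {T : ℝ} {n M : ℕ} {N : Cubic} {u : ℝ → ℝ → ℝ}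
    (hu : RegularSolution T (n + 1) N u (dt T u) (dt T (dt T u))) (hT : 1 < T) (hM : n + 1 + 1 ≤ 2 * M + 1)
    {ε α B σ δ : ℝ} (hε : 0 < ε) (hα : 0 ≤ α) (hB : 200 * (n + 3 : ℝ) ≤ B) (hσ : 0 < σ) (hδ : 0 < δ)
    (hδ2 : δ ≤ 1 / 2) (hδσ : 1200 * (n + 3 : ℝ) ^ 2 * δ ≤ σ)
    (hαδ : N.size * ((∑ k ∈ Finset.range (n + 3), leibnizConst k) + 12) * α ^ 2 ≤ δ)
    {u₀ u₁ : ℝ → ℝ} (hdata : NormalizedData (n + 1 + 2) u₀ u₁) (h0 : ∀ x, u 1 x = ε * u₀ x)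
    (h1 : ∀ x, dt T u 1 x = ε * u₁ x)
    (hsup : ∀ t ∈ Set.Icc 1 T, (∀ m ≤ M + 2, ∀ x, |iteratedDeriv m (u t) x| ≤ α * t ^ (-(1 / 2) : ℝ)) ∧
      (∀ m ≤ M + 1, ∀ x, |iteratedDeriv m (dt T u t) x| ≤ α * t ^ (-(1 / 2) : ℝ)) ∧
      ∀ x, |dt T (dt T u) t x| ≤ α * t ^ (-(1 / 2) : ℝ))
    (hE : ∀ t ∈ Set.Icc 1 T, energySum T dx (n + 2) u t ≤ ENNReal.ofReal (B * ε * t ^ σ))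
    (hEZ : ∀ t ∈ Set.Icc 1 T, energySum T (Z T) 1 u t ≤ ENNReal.ofReal (B * ε * t ^ σ)) :
    ∀ t ∈ Set.Icc 1 T, energySum T dx (n + 2) u t ≤ ENNReal.ofReal (B / 2 * ε * t ^ σ) ∧
      energySum T (Z T) 1 u t ≤ ENNReal.ofReal (B / 2 * ε * t ^ σ) := by
  have h1I : (1 : ℝ) ∈ Set.Icc 1 T := ⟨le_rfl, hT.le⟩
  have hN := N.size_nonneg
  have hn : (0 : ℝ) ≤ n := Nat.cast_nonneg n
  have hB0 : 0 < B := by linarith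
  have hw := hu.waveJet_zField
  have s0 : XSmooth T (n + 2) u := hu.smooth.mono (by omega)
  have s1 : XSmooth T (n + 2) (dt T u) := hu.smooth_t
  have dtZ : ∀ t ∈ Set.Icc 1 T, dt T (Z T u) t = zFieldT u (dt T u) (dt T (dt T u)) t := fun t ht ↦
    funext fun x ↦ hw.v_t.dt_eq hT ht x
  have dxZ : ∀ t ∈ Set.Icc 1 T, dx (Z T u) t = zFieldX u (dt T u) t := fun t ht ↦
    funext fun x ↦ hw.v_x.dx_eq ht x
  have hl2 : ∀ t ∈ Set.Icc 1 T, ∀ k ≤ n + 2, L2Le (iteratedDeriv k (u t)) (B * ε * t ^ σ) ∧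
      L2Le (iteratedDeriv k (dt T u t)) (B * ε * t ^ σ) ∧ L2Le (iteratedDeriv (k + 1) (u t)) (B * ε * t ^ σ) := by
    intro t ht k hk
    have := L2Le.of_energy_le ((energy_le_energySum hk).trans (hE t ht))
    rwa [dt_iterate_dx_eq hT s0 s1 hu.deriv_t hk ht, dx_iterate_dx_eq, iterate_dx_eq] at this
  have hboot : Bootstrap T (n + 1) M α (B * ε) σ u (dt T u) (dt T (dt T u)) := by
    refine ⟨fun t ht ↦ ⟨(hsup t ht).1, (hsup t ht).2.1, fun m hm ↦ ?_, fun m hm ↦ (hl2 t ht m (by omega)).2.1⟩,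
      fun t ht ↦ (hsup t ht).2.2⟩
    -- The top order `n + 3` of `u` is read off the `∂_x` part of the energy of `∂_x ^ (n + 2) u`.
    rcases Nat.lt_or_ge m (n + 3) with h | h
    · exact (hl2 t ht m (by omega)).1
    · obtain rfl : m = n + 2 + 1 := by omega
      exact (hl2 t ht (n + 2) le_rfl).2.2
  have hZb : ∀ t ∈ Set.Icc 1 T, L2Le (zField u (dt T u) t) (B * ε * t ^ σ) ∧
      L2Le (zFieldT u (dt T u) (dt T (dt T u)) t) (B * ε * t ^ σ) ∧ L2Le (zFieldX u (dt T u) t) (B * ε * t ^ σ) := by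
    intro t ht
    have := L2Le.of_energy_le ((energy_le_energySum (k := 1) le_rfl).trans (hEZ t ht))
    rwa [Function.iterate_one, dtZ t ht, dxZ t ht] at this
  have hsumL : 0 ≤ ∑ k ∈ Finset.range (n + 3), leibnizConst k := Finset.sum_nonneg fun k _ ↦ leibnizConst_nonneg k
  have hNα : 0 ≤ N.size * α ^ 2 := by positivity
  have hNL : 0 ≤ N.size * (∑ k ∈ Finset.range (n + 3), leibnizConst k) * α ^ 2 := by positivity
  have hinit := hu.initial_bounds (S := α * 1 ^ (-(1 / 2) : ℝ)) hT.le hε hdata h0 h1 (by simpa using hα)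
    (by rw [sq_mul_rpow_neg_half le_rfl, div_one]; linarith) (hboot.bound 1 h1I)
  obtain ⟨i0, i1, iz, izt, izx⟩ := hinit
  intro t ht
  have ht0 : 0 < t := by linarith [ht.1]
  have htσ : 1 ≤ t ^ σ := Real.one_le_rpow ht.1 hσ.le
  -- There are `n + 3` energies, each at most `2 * K`, so this value makes their sum at most `B / 2
  -- * ε * t ^ σ`.
  set K := B / (4 * (n + 3)) * ε * t ^ σ with hKdef
  have hK : 0 ≤ K := by positivity
  have hKb : 12 * (9 * ε) ^ 2 + 18 * δ * (B * ε) ^ 2 * t ^ (2 * σ) / σ ≤ K ^ 2 := by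
    have htt : t ^ (2 * σ) = (t ^ σ) ^ 2 := by
      rw [mul_comm, Real.rpow_mul ht0.le]; norm_num
    rw [htt, hKdef]
    set τ := t ^ σ
    set p : ℝ := n + 3 with hp
    have hp0 : 0 < p := by positivity
    -- The choice of `δ` gives `18 / 1200 = 3 / 200`, and the lower bound on `B` gives `12 * 9 ^ 2 /
    -- 200 ^ 2 = 972 / 40000`. Their sum is less than `1 / 16`, the coefficient in `K ^ 2`.
    have e1 : 18 * δ * (B * ε) ^ 2 * τ ^ 2 / σ ≤ 3 / 200 / p ^ 2 * (B * ε * τ) ^ 2 := by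
      rw [div_le_iff₀ hσ]
      calc 18 * δ * (B * ε) ^ 2 * τ ^ 2 = 3 / 200 / p ^ 2 * (B * ε * τ) ^ 2 * (1200 * p ^ 2 * δ) := by
            field_simp; ring
        _ ≤ _ := by gcongr
    have e2 : 12 * (9 * ε) ^ 2 ≤ 972 / 40000 / p ^ 2 * (B * ε * τ) ^ 2 := by
      have hB2 : (200 * p) ^ 2 ≤ B ^ 2 := by gcongr
      have hτ : 1 ≤ τ ^ 2 := one_le_pow₀ htσ
      calc 12 * (9 * ε) ^ 2 = 972 / 40000 / p ^ 2 * ((200 * p) ^ 2 * ε ^ 2 * 1) := by field_simp; ring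
        _ ≤ 972 / 40000 / p ^ 2 * (B ^ 2 * ε ^ 2 * τ ^ 2) := by gcongr
        _ = _ := by ring
    have e3 : (B / (4 * p) * ε * τ) ^ 2 = 1 / 16 / p ^ 2 * (B * ε * τ) ^ 2 := by field_simp; ring
    have e4 : 0 ≤ 1 / p ^ 2 * (B * ε * τ) ^ 2 := by positivity
    rw [e3]
    have e5 : ∀ c : ℝ, c / p ^ 2 * (B * ε * τ) ^ 2 = c * (1 / p ^ 2 * (B * ε * τ) ^ 2) := fun c ↦ by ring
    rw [e5] at e1 e2 ⊢
    linarith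
  have hκ : 0 ≤ B * ε := by positivity
  have en : ∀ k ≤ n + 2, energy T (dx^[k] u) t ≤ ENNReal.ofReal (2 * K) := by
    intro k hk
    have hLk : leibnizConst k ≤ ∑ k ∈ Finset.range (n + 3), leibnizConst k :=
      Finset.single_le_sum (fun i _ ↦ leibnizConst_nonneg i) (Finset.mem_range.2 (by omega))
    obtain ⟨r0, r1, r2⟩ := hu.energy_iteratedDeriv_le hT.le hα hκ hσ hδ hδ2 (by positivity : 0 ≤ 9 * ε) hboot hM
      (k := k) (by omega) (le_trans (by gcongr; norm_num) hαδ) (fun m hm ↦ (i0 m hm).mono (by linarith))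
      (fun m hm ↦ (i1 m hm).mono (by linarith)) ht hK hKb
    refine energy_le_of_l2Le hK ?_ ?_ ?_
    · rwa [iterate_dx_eq]
    · rwa [dt_iterate_dx_eq hT s0 s1 hu.deriv_t hk ht]
    · rwa [dx_iterate_dx_eq]
  have enZ : energy T (Z T u) t ≤ ENNReal.ofReal (2 * K) := by
    obtain ⟨r0, r1, r2⟩ := hu.energy_zField_le hT.le hα hκ hσ hδ hδ2 (by positivity : 0 ≤ 9 * ε) hboot
      (by linarith) (fun t ht ↦ (hZb t ht).1) (fun t ht ↦ (hZb t ht).2.1) (fun t ht ↦ (hZb t ht).2.2)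
      iz izt izx ht hK hKb
    refine energy_le_of_l2Le hK r0 ?_ ?_
    · rwa [dtZ t ht]
    · rwa [dxZ t ht]
  have hp : (0 : ℝ) < n + 3 := by positivity
  have hfin : ((n + 2 + 1 : ℕ) : ℝ) * (2 * K) = B / 2 * ε * t ^ σ := by
    rw [hKdef]; push_cast
    have : (n : ℝ) + 2 + 1 = n + 3 := by ring
    rw [this]
    field_simp
    norm_num
  constructor
  · rw [← hfin]
    exact energySum_le_of_forall_energy_le en
  · rw [← hfin]
    -- The sum for `Z` has two terms, at most `n + 3`, so the same `K` suffices.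
    refine (energySum_le_of_forall_energy_le (m := 1) (K := 2 * K) fun k hk ↦ ?_).trans ?_
    · interval_cases k
      · exact en 0 (by omega)
      · exact enZ
    · apply ENNReal.ofReal_le_ofReal
      gcongr
      omega

end

end

end KleinGordon

theorem proposition2p1 (P : MvPolynomial (Fin 5) ℝ) (hP : KleinGordon.IsCubicQuasilinear P) :
    ∃ s₀ : ℕ, 1 ≤ s₀ ∧ ∀ s : ℕ, s₀ ≤ s → ∀ ρ : ℕ, (s - 1) / 2 + 3 ≤ ρ →
      ∃ B₀ : ℝ, 0 < B₀ ∧ ∀ B : ℝ, B₀ ≤ B → ∀ A : ℝ, 0 < A → ∀ σ : ℝ, 0 < σ →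
        ∃ ε₀ : ℝ, 0 < ε₀ ∧ ε₀ < 1 ∧
          ∀ ε : ℝ, 0 < ε → ε < ε₀ →
          ∀ u₀ u₁ : ℝ → ℝ, KleinGordon.NormalizedData s u₀ u₁ →
          ∀ T : ℝ, 1 < T → ∀ u : ℝ → ℝ → ℝ, KleinGordon.IsSolution P s ε u₀ u₁ T u →
            (∀ t ∈ Set.Icc 1 T,
              KleinGordon.wNorm T ρ u t ≤ ENNReal.ofReal (A * ε * t ^ (-(1 / 2) : ℝ)) ∧
              KleinGordon.energySum T KleinGordon.dx (s - 1) u t ≤ ENNReal.ofReal (B * ε * t ^ σ) ∧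
              KleinGordon.energySum T (KleinGordon.Z T) 1 u t ≤ ENNReal.ofReal (B * ε * t ^ σ)) →
            ∀ t ∈ Set.Icc 1 T,
              KleinGordon.energySum T KleinGordon.dx (s - 1) u t ≤ ENNReal.ofReal (B / 2 * ε * t ^ σ) ∧
              KleinGordon.energySum T (KleinGordon.Z T) 1 u t ≤ ENNReal.ofReal (B / 2 * ε * t ^ σ) := by
  obtain ⟨N, hN⟩ := hP.exists_cubic
  -- For `s ≥ 3` the solution has the three continuous space derivatives that occur in the second
  -- derivatives of `Z u`.
  refine ⟨3, by norm_num, fun s hs ρ hρ ↦ ?_⟩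
  obtain ⟨n, rfl⟩ : ∃ n, s = n + 1 + 2 := ⟨s - 3, by omega⟩
  simp only [show n + 1 + 2 - 1 = n + 2 by omega] at hρ ⊢
  obtain ⟨C, hC, hsup⟩ := KleinGordon.exists_sup_le_of_wNorm_le hρ
  refine ⟨200 * (n + 3 : ℝ), by positivity, fun B hB A hA σ hσ ↦ ?_⟩
  set Λ := N.size * ((∑ k ∈ Finset.range (n + 3), KleinGordon.leibnizConst k) + 12)
  have hΛ : 0 ≤ Λ := mul_nonneg N.size_nonneg
    (add_nonneg (Finset.sum_nonneg fun k _ ↦ KleinGordon.leibnizConst_nonneg k) (by norm_num))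
  -- The bound `1 / 2` keeps the energy coercive; the other one compensates the factor `1 / σ` from
  -- the time integration.
  set δ : ℝ := min (1 / 2) (σ / (1200 * (n + 3 : ℝ) ^ 2))
  have hδ : 0 < δ := lt_min (by norm_num) (by positivity)
  have hδσ : 1200 * (n + 3 : ℝ) ^ 2 * δ ≤ σ := by
    have : δ ≤ σ / (1200 * (n + 3 : ℝ) ^ 2) := min_le_right _ _
    rw [le_div_iff₀ (by positivity)] at this
    linarith
  set q := Λ * (C * A) ^ 2
  have hq : 0 ≤ q := by positivity
  -- The decay constant `C * A * ε` enters squared, and `q * ε ^ 2 ≤ q * ε ≤ δ` is all that is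
  -- required; `q + 1` avoids a zero denominator.
  refine ⟨min (1 / 2) (δ / (q + 1)), lt_min (by norm_num) (by positivity),
    (min_le_left _ _).trans_lt (by norm_num), fun ε hε hε₀ u₀ u₁ hdata T hT u hu hb ↦ ?_⟩
  have hreg := hu.regularSolution hN hT
  have hε1 : ε ≤ 1 / 2 := hε₀.le.trans (min_le_left _ _)
  have hε2 : ε * (q + 1) ≤ δ := by
    rw [← le_div_iff₀ (by positivity)]
    exact hε₀.le.trans (min_le_right _ _)
  -- Here `M` is the integer part of `(s - 1) / 2`, so `s - 1 ≤ 2 * M + 1` in either parity.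
  refine hreg.propagation (M := (n + 2) / 2) (α := C * (A * ε)) (δ := δ) hT (by omega) hε (by positivity) hB hσ hδ
    (min_le_left _ _) hδσ ?_ hdata hu.initial_value hu.initial_velocity (fun t ht ↦ ?_) (fun t ht ↦ (hb t ht).2.1)
    (fun t ht ↦ (hb t ht).2.2)
  · calc Λ * (C * (A * ε)) ^ 2 = q * (ε * ε) := by ring
      _ ≤ q * (ε * 1) := by gcongr; linarith
      _ ≤ δ := by linarith
  · have ht0 : 0 < t := by linarith [ht.1]
    have := hsup T u t _ (by positivity) ((hreg.smooth.contDiff t ht).of_le (by norm_cast; omega))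
      ((hreg.smooth_t.contDiff t ht).of_le (by norm_cast; omega)) (hreg.smooth_tt.cont.continuous ht) (hb t ht).1
    rw [← mul_assoc C] at this
    exact this
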